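/- Let $M$ be a smooth manifold of dimension $n>2$, $a$ a smooth (pseudo-)Riemannian metric on $M$ (of any signature), $b$ a smooth closed 1-form that is null with respect to $a$, and $m\neq 0$ a real number. Write $\alpha=\sqrt{a(y,y)}$ and $\beta=b(y)$ for tangent vectors $y$. Let $\mathcal A\subset TM\setminus\{0\}$ be an open set with non-empty fibres, invariant under $y\mapsto\lambda y$ for all $\lambda>0$, on which $\alpha>0$, $\beta\ne 0$ and $\beta^{-m}$ is defined (that is, $\beta>0$, or $m$ is an integer and $\beta\neq0$), and suppose that $F=\alpha^{1+m}\beta^{-m}$ is a Finsler metric on $\mathcal A$, i.e. the fundamental tensor $g_{ij}(x,y)=\tfrac12\,\partial^2F^2/\partial y^i\partial y^j$ is non-degenerate on $\mathcal A$ (this excludes $m=\pm1$). Suppose that $F$ is of Berwald type: the coefficients $$N^i_j=\tfrac14\,\frac{\partial}{\partial y^j}\Big(g^{ik}\Big(y^l\frac{\partial^2F^2}{\partial x^l\partial y^k}-\frac{\partial F^2}{\partial x^k}\Big)\Big)$$ of its Cartan non-linear connection have, in every chart and on all of $\mathcal A$, the form $N^i_j(x,y)=\Gamma^i_{jk}(x)y^k$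 with smooth functions $\Gamma^i_{jk}$. These are the coefficients of the affine connection of $F$, and $\bar R_{lk}=\partial_i\Gamma^i_{kl}-\partial_k\Gamma^i_{il}+\Gamma^i_{ri}\Gamma^r_{kl}-\Gamma^i_{rk}\Gamma^r_{il}$ is its affine Ricci tensor. Then the following are equivalent: (i) the affine connection is locally metrizable: every point of $M$ has an open neighbourhood carrying a (pseudo-)Riemannian metric whose Levi-Civita connection is the affine connection; (ii) the affine Ricci tensor is symmetric, $\bar R_{ij}=\bar R_{ji}$; (iii) around every point of $M$ there are local coordinates $(u,v,x^3,\dots,x^n)$ such that $$a=-2\,du\,dv+\big[\tilde H(u,x)+\phi(u)v\big]du^2+W_r(u,x)\,du\,dx^r+h_{rs}(u,x)\,dx^r dx^s,\qquad b=du,$$ where $r,s$ run from $3$ to $n$, products of differentials are symmetrized tensor products, the coefficients are smooth, and $h$ is symmetric and non-degenerate. Moreover, whenever $a$ and $b$ have the form in (iii) in a chart, an indefinite integral $\int^u\phi$ of $\phi$ exists on the set of values of $u$ in that chart, and for every such indefinite integral the affine connection is, on the domain of that chart, the Levi-Civita connection of the (pseudo-)Riemannian metric $$\tilde a=\exp\Big(\frac{m}{1-m}\int^u\phi(\tilde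 u)\,d\tilde u\Big)\,a .$$ -/

import Mathlib

open scoped Manifold ContDiff

noncomputable section

namespace Kropina

/-! ### Coordinates, 1-forms and 2-tensors -/

/-- Coordinate space `ℝⁿ`. -/
abbrev Coord (n : ℕ) : Type := EuclideanSpace ℝ (Fin n)

/-- The partial derivative `∂f/∂xⁱ` at `x`. -/
def pd {n : ℕ} (i : Fin n) (f : Coord n → ℝ) (x : Coord n) : ℝ :=
  fderiv ℝ f x (EuclideanSpace.single i 1)

/-- The smooth charts of `M` (all charts of the maximal atlas). -/
abbrev charts (n : ℕ) (M : Type*) [TopologicalSpace M] [ChartedSpace (Coord n) M] :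
    Set (OpenPartialHomeomorph M (Coord n)) :=
  IsManifold.maximalAtlas (𝓡 n) ∞ M

/-- (Not necessarily smooth) 1-forms on `M`. -/
abbrev OneForm (n : ℕ) (M : Type*) [TopologicalSpace M] [ChartedSpace (Coord n) M] : Type _ :=
  (p : M) → TangentSpace (𝓡 n) p →ₗ[ℝ] ℝ

/-- (Not necessarily smooth) covariant 2-tensors on `M`. -/
abbrev TwoTensor (n : ℕ) (M : Type*) [TopologicalSpace M] [ChartedSpace (Coord n) M] : Type _ :=
  (p : M) → TangentSpace (𝓡 n) p →ₗ[ℝ] TangentSpace (𝓡 n) p →ₗ[ℝ] ℝ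

/-- A family of connection coefficients: `Γ e x i j k` is `Γⁱⱼₖ` at the point with coordinates
`x` in the chart `e`. -/
abbrev ConnectionCoeffs (n : ℕ) (M : Type*) [TopologicalSpace M] [ChartedSpace (Coord n) M] :
    Type _ :=
  OpenPartialHomeomorph M (Coord n) → Coord n → Fin n → Fin n → Fin n → ℝ

section Geometry

variable {n : ℕ} {M : Type*} [TopologicalSpace M] [ChartedSpace (Coord n) M]

/-- The tangent vector `yⁱ ∂ᵢ` at the point with coordinates `x` in the chart `e`. -/
def coordVec (e : OpenPartialHomeomorph M (Coord n)) (x y : Coord n) :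
    TangentSpace (𝓡 n) (e.symm x) :=
  mfderiv (𝓡 n) (𝓡 n) e.symm x y

/-- The components `bᵢ = b(∂ᵢ)` of a 1-form in the chart `e`. -/
def comp1 (b : OneForm n M) (e : OpenPartialHomeomorph M (Coord n)) (i : Fin n) (x : Coord n) :
    ℝ :=
  b (e.symm x) (coordVec e x (EuclideanSpace.single i 1))

/-- The components `gᵢⱼ = g(∂ᵢ, ∂ⱼ)` of a 2-tensor in the chart `e`. -/
def comp2 (g : TwoTensor n M) (e : OpenPartialHomeomorph M (Coord n)) (i j : Fin n)
    (x : Coord n) : ℝ :=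
  g (e.symm x) (coordVec e x (EuclideanSpace.single i 1))
    (coordVec e x (EuclideanSpace.single j 1))

/-- A smooth 1-form: its components are smooth in every smooth chart. -/
def IsSmoothOneForm (b : OneForm n M) : Prop :=
  ∀ e ∈ charts n M, ∀ i, ContDiffOn ℝ ∞ (comp1 b e i) e.target

/-- A closed 1-form: `∂ᵢ bⱼ = ∂ⱼ bᵢ` in every smooth chart. -/
def IsClosedOneForm (b : OneForm n M) : Prop :=
  ∀ e ∈ charts n M, ∀ x ∈ e.target, ∀ i j, pd i (comp1 b e j) x = pd j (comp1 b e i) x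

/-- `g` is a (pseudo-)Riemannian metric, of any signature, on the set `U` (used for open `U`):
symmetric, nondegenerate and smooth there. -/
structure IsPseudoRiemannianOn (g : TwoTensor n M) (U : Set M) : Prop where
  symm : ∀ p ∈ U, ∀ v w, g p v w = g p w v
  nondegenerate : ∀ p ∈ U, ∀ v, (∀ w, g p v w = 0) → v = 0
  smooth : ∀ e ∈ charts n M, ∀ i j, ContDiffOn ℝ ∞ (comp2 g e i j) (e.target ∩ e.symm ⁻¹' U)

/-- `b` is null with respect to `a`: the vector `V` with `a(V, ·) = b` satisfies `a(V, V) = 0`. -/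
def IsNull (a : TwoTensor n M) (b : OneForm n M) : Prop :=
  ∀ (p : M) (V : TangentSpace (𝓡 n) p), (∀ w, a p V w = b p w) → a p V V = 0

/-- The Levi-Civita Christoffel symbols of `g` in the chart `e`,
`½ gⁱˡ (∂ⱼ gₖₗ + ∂ₖ gⱼₗ - ∂ₗ gⱼₖ)`. -/
def christoffel (g : TwoTensor n M) : ConnectionCoeffs n M := fun e x i j k =>
  (1 / 2) * ∑ l, (Matrix.of fun r s => comp2 g e r s x)⁻¹ i l *
    (pd j (comp2 g e k l) x + pd k (comp2 g e j l) x - pd l (comp2 g e j k) x)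

/-- The connection with coefficients `Γ` is, over `U`, the Levi-Civita connection of `g`. -/
def IsMetrizedOn (Γ : ConnectionCoeffs n M) (g : TwoTensor n M) (U : Set M) : Prop :=
  ∀ e ∈ charts n M, ∀ x ∈ e.target, e.symm x ∈ U → ∀ i j k, Γ e x i j k = christoffel g e x i j k

/-- Local metrizability: around every point there is a (pseudo-)Riemannian metric whose
Levi-Civita connection is the given connection. -/
def IsLocallyMetrizable (Γ : ConnectionCoeffs n M) : Prop :=
  ∀ p : M, ∃ U : Set M, IsOpen U ∧ p ∈ U ∧
    ∃ g : TwoTensor n M, IsPseudoRiemannianOn g U ∧ IsMetrizedOn Γ g U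

/-- The affine curvature tensor
`R̄ₗⁱⱼₖ = ∂ⱼ Γⁱₖₗ - ∂ₖ Γⁱⱼₗ + Γⁱₘⱼ Γᵐₖₗ - Γⁱₘₖ Γᵐⱼₗ` in the chart `e`. -/
def affineCurvature (Γ : ConnectionCoeffs n M) (e : OpenPartialHomeomorph M (Coord n))
    (x : Coord n) (l i j k : Fin n) : ℝ :=
  pd j (fun x' => Γ e x' i k l) x - pd k (fun x' => Γ e x' i j l) x
    + ∑ r, (Γ e x i r j * Γ e x r k l - Γ e x i r k * Γ e x r j l)

/-- The affine Ricci tensor `R̄ₗₖ = R̄ₗⁱᵢₖ` in the chart `e`. -/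
def affineRicci (Γ : ConnectionCoeffs n M) (e : OpenPartialHomeomorph M (Coord n))
    (x : Coord n) (l k : Fin n) : ℝ :=
  ∑ i, affineCurvature Γ e x l i i k

/-- The affine Ricci tensor is symmetric. -/
def HasSymmetricRicci (Γ : ConnectionCoeffs n M) : Prop :=
  ∀ e ∈ charts n M, ∀ x ∈ e.target, ∀ i j, affineRicci Γ e x i j = affineRicci Γ e x j i

/-! ### Finsler geometry -/

/-- The point `(x, y)` of the tangent bundle, in the coordinates induced by the chart `e`. -/
def bundlePoint (e : OpenPartialHomeomorph M (Coord n)) (x y : Coord n) :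
    TangentBundle (𝓡 n) M :=
  ⟨e.symm x, coordVec e x y⟩

/-- `F²` in the coordinates `(x, y)` induced by the chart `e`. -/
def sqCoord (F : TangentBundle (𝓡 n) M → ℝ) (e : OpenPartialHomeomorph M (Coord n))
    (x y : Coord n) : ℝ :=
  F (bundlePoint e x y) ^ 2

/-- The fundamental tensor `gᵢⱼ(x, y) = ½ ∂²F²/∂yⁱ∂yʲ` in the chart `e`. -/
def fundamentalTensor (F : TangentBundle (𝓡 n) M → ℝ) (e : OpenPartialHomeomorph M (Coord n))
    (x y : Coord n) : Matrix (Fin n) (Fin n) ℝ :=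
  Matrix.of fun i j => (1 / 2) * pd i (fun y' => pd j (sqCoord F e x) y') y

/-- The coefficients of the Cartan nonlinear connection,
`Nⁱⱼ = ¼ ∂/∂yʲ (gⁱᵏ (yˡ ∂²F²/∂xˡ∂yᵏ - ∂F²/∂xᵏ))`, in the chart `e`. -/
def cartanCoeff (F : TangentBundle (𝓡 n) M → ℝ) (e : OpenPartialHomeomorph M (Coord n))
    (x y : Coord n) (i j : Fin n) : ℝ :=
  (1 / 4) * pd j (fun y' => ∑ k, (fundamentalTensor F e x y')⁻¹ i k *
    ((∑ l, y' l * pd l (fun x' => pd k (sqCoord F e x') y') x)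
      - pd k (fun x' => sqCoord F e x' y') x)) y

/-- `(M, A, F)` is a Finsler space: `A` is a conic subbundle of the slit tangent bundle with
nonempty fibres and `F` is smooth and positively homogeneous on `A`, with nondegenerate
fundamental tensor. Only the values of `F` on `A` matter. -/
structure IsFinslerSpace [IsManifold (𝓡 n) ∞ M] (A : Set (TangentBundle (𝓡 n) M))
    (F : TangentBundle (𝓡 n) M → ℝ) : Prop where
  isOpen : IsOpen A
  ne_zero : ∀ Z ∈ A, Z.2 ≠ 0
  conic : ∀ Z ∈ A, ∀ c : ℝ, 0 < c → (⟨Z.1, c • Z.2⟩ : TangentBundle (𝓡 n) M) ∈ A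
  nonempty_fibre : ∀ p : M, ∃ y : TangentSpace (𝓡 n) p, (⟨p, y⟩ : TangentBundle (𝓡 n) M) ∈ A
  smooth : ContMDiffOn (𝓡 n).tangent 𝓘(ℝ, ℝ) ∞ F A
  homogeneous : ∀ Z ∈ A, ∀ c : ℝ, 0 < c → F ⟨Z.1, c • Z.2⟩ = c * F Z
  nondegenerate : ∀ e ∈ charts n M, ∀ x ∈ e.target, ∀ y, bundlePoint e x y ∈ A →
    (fundamentalTensor F e x y).det ≠ 0

/-- The Finsler space `(M, A, F)` is of Berwald type and `Γ` are the coefficients of its affine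
connection: in every smooth chart `Nⁱⱼ(x, y) = Γⁱⱼₖ(x) yᵏ` on `A` with smooth `Γⁱⱼₖ`.
As `A` is open with nonempty fibres, this determines `Γ` in every smooth chart. -/
structure IsBerwaldWithConnection (A : Set (TangentBundle (𝓡 n) M))
    (F : TangentBundle (𝓡 n) M → ℝ) (Γ : ConnectionCoeffs n M) : Prop where
  smooth : ∀ e ∈ charts n M, ∀ i j k, ContDiffOn ℝ ∞ (fun x => Γ e x i j k) e.target
  linear : ∀ e ∈ charts n M, ∀ x ∈ e.target, ∀ y, bundlePoint e x y ∈ A →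
    ∀ i j, cartanCoeff F e x y i j = ∑ k, Γ e x i j k * y k

/-- `(M, A, F)` is the `m`-Kropina space `F = α^(1+m) β^(-m)` with `α = √(a(y, y))`, `β = b(y)`.
On `A` one has `α > 0`, and the power `β^(-m)` is defined, i.e. `β > 0`, or `m` is an integer and
`β ≠ 0`. -/
structure IsKropinaSpace [IsManifold (𝓡 n) ∞ M] (a : TwoTensor n M) (b : OneForm n M) (m : ℝ)
    (A : Set (TangentBundle (𝓡 n) M)) (F : TangentBundle (𝓡 n) M → ℝ) : Prop where
  metric : IsPseudoRiemannianOn a Set.univ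
  smooth_form : IsSmoothOneForm b
  finsler : IsFinslerSpace A F
  alpha_pos : ∀ Z ∈ A, 0 < a Z.1 Z.2 Z.2
  beta_defined : ∀ Z ∈ A, 0 < b Z.1 Z.2 ∨ (b Z.1 Z.2 ≠ 0 ∧ ∃ k : ℤ, m = k)
  eq : ∀ Z ∈ A, F Z = Real.sqrt (a Z.1 Z.2 Z.2) ^ (1 + m) * (b Z.1 Z.2) ^ (-m)

end Geometry

/-! ### The adapted coordinates -/

/-- The last `d` of the `d + 2` coordinates `(u, v, x³, …, xⁿ)`, `n = d + 2`; the coordinates `u`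
and `v` of `x` are `x 0` and `x 1`. -/
def transverse {d : ℕ} (x : Coord (d + 2)) : Fin d → ℝ := fun r => x r.succ.succ

/-- In the chart `e` with coordinates `(u, v, x³, …, xⁿ)`,
`a = -2 du dv + [H(u,x) + φ(u) v] du² + Wᵣ(u,x) du dxʳ + hᵣₛ(u,x) dxʳ dxˢ` and `b = du`,
with smooth coefficients and `h` symmetric and nondegenerate. The symmetric tensor `a` is described
by its quadratic form. -/
structure IsAdaptedChart {d : ℕ} {M : Type*} [TopologicalSpace M] [ChartedSpace (Coord (d + 2)) M]
    (a : TwoTensor (d + 2) M) (b : OneForm (d + 2) M)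
    (e : OpenPartialHomeomorph M (Coord (d + 2)))
    (H : ℝ → (Fin d → ℝ) → ℝ) (φ : ℝ → ℝ) (W : ℝ → (Fin d → ℝ) → Fin d → ℝ)
    (h : ℝ → (Fin d → ℝ) → Matrix (Fin d) (Fin d) ℝ) : Prop where
  mem : e ∈ charts (d + 2) M
  smooth_H : ContDiffOn ℝ ∞ (fun x : Coord (d + 2) => H (x 0) (transverse x)) e.target
  smooth_φ : ContDiffOn ℝ ∞ (fun x : Coord (d + 2) => φ (x 0)) e.target
  smooth_W : ∀ r, ContDiffOn ℝ ∞ (fun x : Coord (d + 2) => W (x 0) (transverse x) r) e.target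
  smooth_h : ∀ r s, ContDiffOn ℝ ∞ (fun x : Coord (d + 2) => h (x 0) (transverse x) r s) e.target
  symm_h : ∀ x ∈ e.target, (h (x 0) (transverse x)).IsSymm
  nondegenerate_h : ∀ x ∈ e.target, (h (x 0) (transverse x)).det ≠ 0
  metric_eq : ∀ x ∈ e.target, ∀ y : Coord (d + 2),
    a (e.symm x) (coordVec e x y) (coordVec e x y) =
      -2 * y 0 * y 1 + (H (x 0) (transverse x) + φ (x 0) * x 1) * y 0 ^ 2
        + ∑ r, W (x 0) (transverse x) r * y 0 * transverse y r
        + ∑ r, ∑ s, h (x 0) (transverse x) r s * transverse y r * transverse y s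
  form_eq : ∀ x ∈ e.target, ∀ y : Coord (d + 2), b (e.symm x) (coordVec e x y) = y 0

/-- `Φ = ∫ᵘ φ`, an indefinite integral of `φ` over the values of `u` in the chart `e`. -/
def IsIndefiniteIntegral {d : ℕ} {M : Type*} [TopologicalSpace M]
    (e : OpenPartialHomeomorph M (Coord (d + 2))) (φ Φ : ℝ → ℝ) : Prop :=
  ∀ x ∈ e.target, HasDerivAt Φ (φ (x 0)) (x 0)

/-- The conformal metric `exp (m / (1 - m) · Φ(u)) a`. -/
def conformalMetric {d : ℕ} {M : Type*} [TopologicalSpace M] [ChartedSpace (Coord (d + 2)) M]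
    (a : TwoTensor (d + 2) M) (m : ℝ) (e : OpenPartialHomeomorph M (Coord (d + 2))) (Φ : ℝ → ℝ) :
    TwoTensor (d + 2) M :=
  fun p => Real.exp (m / (1 - m) * Φ (e p 0)) • a p

end Kropina

end

open scoped Manifold ContDiff
open Kropina

/-! Write `L = F²`. In a chart `log L = (1 + m) log a(y,y) - 2m log |b(y)|` on the cone. If the
Cartan connection is linear in `y`, Euler's relation shows that the spray is `2 Γ(y,y)`. Hence `Γ`
is symmetric and `L` is constant along horizontal directions: `∂ₓL(v) = ∂_yL(Γ(v,y))`
(`horizontally_constant`). Dividing by `L` and clearing denominators gives, for every `u`, an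
identity of cubic polynomials in `y`: `(1 + m) b(y) (∇ᵤa)(y,y) = 2m a(y,y) (∇ᵤb)(y)`.

On `ker b` the left side vanishes. Since `n > 2`, this hyperplane is not totally isotropic, so `∇ᵤb`
must vanish on it: `∇ᵤb = λ(u) b` and `(1 + m) ∇ᵤa = 2m λ(u) a`. As `b` is closed, `∇b` is symmetric
and `λ` is a multiple of `b`. The outcome (`exists_isWeylAt`) is a Weyl structure with one scalar
`c`: `∇b = (1 + m) c b⊗b` and `∇a = 2m c b⊗a`. Nondegeneracy of the fundamental tensor excludes `m =
-1`, and, because `b` is null, also `m = 1`.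

Everything now depends on whether `c b` is closed. The antisymmetric part of the Ricci tensor is the
curl of `Γⁱᵢₖ`. For a Levi-Civita connection this trace is `∂ₖ log √|det g|`, which is closed, so
metrizability implies symmetry of Ricci. For the Weyl structure, `½ tr(a⁻¹∂ₖa) = Γⁱᵢₖ + n m c bₖ`,
so Ricci is symmetric exactly when `dc ∧ b = 0`.

For the normal form, write `b = du` and let `V` be dual to `-b`. Nullity gives `du(V) = 0`, so `u`
and `V` can be straightened together, with `V = ∂ᵥ` (`exists_straightening`, which rests on a smooth
local flow). Then `a(∂ᵥ,·) = -du`, and the Weyl equations give `∂ᵥa = 2(m - 1) c du²`. If `dc ∧ du =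
0`, the function `φ = 2(m - 1) c` depends on `u` alone, and integration in `v` over a ball yields
the adapted form. Conversely, in an adapted chart `φ = 2(m - 1) c`; the factor `s = exp(m/(1-m) ∫φ)`
satisfies `ds = -2m c s b`, which cancels `∇a = 2m c b⊗a`. Thus `∇(s a) = 0`, and `∇` is the
Levi-Civita connection of `s a`. -/

namespace Kropina

open Set Filter Topology

/-! ### Local diffeomorphisms from the inverse function theorem -/

/-- The inverse function theorem, in the form that gives a diffeomorphism between open sets. -/
theorem exists_smooth_openPartialHomeomorph {E F : Type*} [NormedAddCommGroup E] [NormedSpace ℝ E]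
    [CompleteSpace E] [NormedAddCommGroup F] [NormedSpace ℝ F] {f : E → F} {f' : E ≃L[ℝ] F} {a : E}
    (hf : ∀ᶠ x in 𝓝 a, ContDiffAt ℝ ∞ f x) (hf' : HasFDerivAt f (f' : E →L[ℝ] F) a) :
    ∃ Φ : OpenPartialHomeomorph E F, a ∈ Φ.source ∧ (∀ x ∈ Φ.source, Φ x = f x) ∧
      (∀ x ∈ Φ.source, ContDiffAt ℝ ∞ Φ x) ∧ ∀ y ∈ Φ.target, ContDiffAt ℝ ∞ Φ.symm y := by
  have hfa := hf.self_of_nhds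
  let Φ := hfa.toOpenPartialHomeomorph f hf' (by simp)
  have ha : a ∈ Φ.source := hfa.mem_toOpenPartialHomeomorph_source hf' (by simp)
  have hev : ∀ᶠ x in 𝓝 a, ContDiffAt ℝ ∞ f x ∧
      fderiv ℝ f x ∈ range ((↑) : (E ≃L[ℝ] F) → E →L[ℝ] F) := by
    refine hf.and ?_
    have hc : ContinuousAt (fderiv ℝ f) a :=
      (hfa.fderiv_right (m := 0) (by simp)).continuousAt
    refine hc.eventually ?_
    rw [hf'.fderiv]
    exact ContinuousLinearEquiv.nhds f'
  obtain ⟨s, hs, hso, has⟩ := eventually_nhds_iff.1 hev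
  refine ⟨Φ.restrOpen s hso, ⟨ha, has⟩, fun _ _ => rfl, fun x hx => (hs x hx.2).1, fun y hy => ?_⟩
  have hy' : Φ.symm y ∈ s := hy.2
  obtain ⟨h1, e', he'⟩ := hs _ hy'
  refine Φ.contDiffAt_symm hy.1 (f₀' := e') ?_ h1
  rw [he']
  exact (h1.differentiableAt (by simp)).hasFDerivAt

/-! ### Smoothness of the superposition operator on spaces of curves -/

section Superposition

universe u

variable {K : Type*} [TopologicalSpace K] [CompactSpace K]

/-- Pointwise evaluation of a continuous family of continuous linear maps on a continuous curve. -/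
noncomputable def pointwiseApply (K : Type*) [TopologicalSpace K] [CompactSpace K]
    (E F : Type*) [NormedAddCommGroup E] [NormedSpace ℝ E] [NormedAddCommGroup F]
    [NormedSpace ℝ F] : C(K, E →L[ℝ] F) →L[ℝ] C(K, E) →L[ℝ] C(K, F) :=
  LinearMap.mkContinuous₂
    (LinearMap.mk₂ ℝ
      (fun (A : C(K, E →L[ℝ] F)) (h : C(K, E)) => (⟨fun t => A t (h t), by fun_prop⟩ : C(K, F)))
      (fun _ _ _ => by ext; simp) (fun _ _ _ => by ext; simp)
      (fun _ _ _ => by ext; simp) (fun _ _ _ => by ext; simp)) 1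
    (fun A h => by
      refine (ContinuousMap.norm_le _ (by positivity)).2 fun t => ?_
      simp only [LinearMap.mk₂_apply, ContinuousMap.coe_mk, one_mul]
      exact ((A t).le_opNorm _).trans
        (mul_le_mul (A.norm_coe_le_norm t) (h.norm_coe_le_norm t) (norm_nonneg _) (norm_nonneg A)))

theorem pointwiseApply_apply {E F : Type*} [NormedAddCommGroup E] [NormedSpace ℝ E]
    [NormedAddCommGroup F] [NormedSpace ℝ F] (A : C(K, E →L[ℝ] F)) (h : C(K, E)) (t : K) :
    pointwiseApply K E F A h t = A t (h t) := rfl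

/-- The mean value inequality on the segment from `γ t` to `γ' t` bounds the remainder at `t`. The
bound is uniform in `t` because `γ ↦ f' ∘ γ` is continuous for the sup norm. -/
theorem hasFDerivAt_superposition {E F : Type*} [NormedAddCommGroup E] [NormedSpace ℝ E]
    [NormedAddCommGroup F] [NormedSpace ℝ F] {f : E → F} {f' : E → E →L[ℝ] F}
    (hf : ∀ x, HasFDerivAt f (f' x) x) (hc : Continuous f) (hc' : Continuous f') (γ : C(K, E)) :
    HasFDerivAt (fun γ : C(K, E) => (⟨f, hc⟩ : C(E, F)).comp γ)
      (pointwiseApply K E F ((⟨f', hc'⟩ : C(E, E →L[ℝ] F)).comp γ)) γ := by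
  have hN : Continuous (fun γ : C(K, E) => (⟨f', hc'⟩ : C(E, E →L[ℝ] F)).comp γ) :=
    ContinuousMap.continuous_postcomp _
  refine HasFDerivAt.of_isLittleO (Asymptotics.isLittleO_iff.2 fun c hcpos => ?_)
  obtain ⟨δ, hδ, hball⟩ := (Metric.continuousAt_iff
    (f := fun γ : C(K, E) => (⟨f', hc'⟩ : C(E, E →L[ℝ] F)).comp γ)).1 hN.continuousAt c hcpos
  filter_upwards [Metric.ball_mem_nhds γ hδ] with γ' hγ'
  refine (ContinuousMap.norm_le _ (by positivity)).2 fun t => ?_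
  simp only [ContinuousMap.sub_apply, ContinuousMap.comp_apply, ContinuousMap.coe_mk,
    pointwiseApply_apply]
  have key := (convex_segment (γ t) (γ' t)).norm_image_sub_le_of_norm_hasFDerivWithin_le'
    (f := f) (f' := f') (φ := f' (γ t)) (C := c) (fun x _ => (hf x).hasFDerivWithinAt) ?_
    (left_mem_segment ℝ _ _) (right_mem_segment ℝ _ _)
  · refine key.trans (mul_le_mul_of_nonneg_left ?_ hcpos.le)
    exact (γ' - γ).norm_coe_le_norm t
  · intro x hx
    rw [segment_eq_image'] at hx
    obtain ⟨θ, hθ, rfl⟩ := hx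
    have hmem : dist (γ + θ • (γ' - γ)) γ < δ := by
      rw [dist_eq_norm, add_sub_cancel_left, norm_smul, Real.norm_of_nonneg hθ.1]
      rw [Metric.mem_ball, dist_eq_norm] at hγ'
      nlinarith [norm_nonneg (γ' - γ), hθ.2]
    have := (hball hmem).le
    rw [← dist_eq_norm]
    exact (ContinuousMap.dist_apply_le_dist t).trans this

/-- The derivative of superposition with `f` is superposition with `fderiv ℝ f` followed by a fixed
continuous linear map, so the order of differentiability goes up by induction. The induction
replaces `F` by `E →L[ℝ] F`; hence the common universe of `E` and `F`. -/
theorem contDiff_superposition_nat {E : Type u} [NormedAddCommGroup E] [NormedSpace ℝ E] (n : ℕ) :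
    ∀ {F : Type u} [NormedAddCommGroup F] [NormedSpace ℝ F] {f : E → F} (hf : ContDiff ℝ ∞ f),
      ContDiff ℝ n (fun γ : C(K, E) => (⟨f, hf.continuous⟩ : C(E, F)).comp γ) := by
  induction n with
  | zero =>
    intro F _ _ f hf
    exact contDiff_zero.2 (ContinuousMap.continuous_postcomp _)
  | succ n ih =>
    intro F _ _ f hf
    have hf' : ContDiff ℝ ∞ (fderiv ℝ f) := hf.fderiv_right (by simp)
    push_cast
    rw [contDiff_succ_iff_hasFDerivAt]
    have h1 := ih hf'
    refine ⟨fun γ => pointwiseApply K E F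
      ((⟨fderiv ℝ f, hf'.continuous⟩ : C(E, E →L[ℝ] F)).comp γ), ?_, fun γ => ?_⟩
    · exact ContDiff.continuousLinearMap_comp (pointwiseApply K E F) h1
    · exact hasFDerivAt_superposition
        (fun x => (hf.differentiable (by simp) x).hasFDerivAt) hf.continuous hf'.continuous γ

/-- Composition with a smooth map is a smooth operation on continuous curves. -/
theorem contDiff_superposition {E : Type u} [NormedAddCommGroup E] [NormedSpace ℝ E]
    {F : Type u} [NormedAddCommGroup F] [NormedSpace ℝ F] {f : E → F} (hf : ContDiff ℝ ∞ f) :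
    ContDiff ℝ ∞ (fun γ : C(K, E) => (⟨f, hf.continuous⟩ : C(E, F)).comp γ) :=
  contDiff_infty.2 fun n => contDiff_superposition_nat n hf

end Superposition

/-! ### Smooth local flows of vector fields -/

section Flow

variable {E : Type*} [NormedAddCommGroup E] [NormedSpace ℝ E] [CompleteSpace E]

open MeasureTheory intervalIntegral

/-- The primitive `t ↦ ∫₀ᵗ γ` of a continuous curve on the unit interval. -/
noncomputable def primitiveCLM (E : Type*) [NormedAddCommGroup E] [NormedSpace ℝ E]
    [CompleteSpace E] : C(unitInterval, E) →L[ℝ] C(unitInterval, E) :=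
  LinearMap.mkContinuous
    { toFun := fun γ => ⟨fun t => ∫ τ in (0 : ℝ)..t, IccExtend zero_le_one γ τ, by
        have : Continuous (fun t : ℝ => ∫ τ in (0 : ℝ)..t, IccExtend zero_le_one γ τ) :=
          intervalIntegral.continuous_primitive
            (fun _ _ => (γ.continuous.Icc_extend').intervalIntegrable _ _) 0
        exact this.comp continuous_subtype_val⟩
      map_add' := fun γ γ' => by
        ext t
        simp only [ContinuousMap.coe_mk, ContinuousMap.add_apply]
        rw [← intervalIntegral.integral_add (γ.continuous.Icc_extend'.intervalIntegrable _ _)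
          (γ'.continuous.Icc_extend'.intervalIntegrable _ _)]
        rfl
      map_smul' := fun c γ => by
        ext t
        simp only [ContinuousMap.coe_mk, ContinuousMap.smul_apply, RingHom.id_apply]
        rw [← intervalIntegral.integral_smul]
        rfl } 1
    (fun γ => by
      refine (ContinuousMap.norm_le _ (by positivity)).2 fun t => ?_
      simp only [LinearMap.coe_mk, AddHom.coe_mk, ContinuousMap.coe_mk, one_mul]
      refine (intervalIntegral.norm_integral_le_of_norm_le_const (C := ‖γ‖)
        (fun τ _ => γ.norm_coe_le_norm _)).trans ?_
      rw [sub_zero, abs_of_nonneg t.2.1]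
      exact mul_le_of_le_one_right (norm_nonneg _) t.2.2)

theorem primitiveCLM_apply (γ : C(unitInterval, E)) (t : unitInterval) :
    primitiveCLM E γ t = ∫ τ in (0 : ℝ)..t, IccExtend zero_le_one γ τ := rfl

/-- A family of integral curves of a smooth vector field which depends continuously on time and
initial value depends smoothly on them. -/
theorem contDiffAt_flow_of_contDiff {V : E → E} (hV : ContDiff ℝ ∞ V) {x₀ : E} {α : E × ℝ → E}
    (hcont : ContinuousAt α (x₀, 0)) (h0 : ∀ᶠ x in 𝓝 x₀, α (x, 0) = x)
    (hα : ∀ᶠ p in 𝓝 (x₀, (0 : ℝ)), HasDerivAt (fun t => α (p.1, t)) (V (α p)) p.2) :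
    ∀ᶠ p in 𝓝 (x₀, (0 : ℝ)), ContDiffAt ℝ ∞ α p := by
  let X := C(unitInterval, E)
  let N : X → X := fun γ => (⟨V, hV.continuous⟩ : C(E, E)).comp γ
  have hN : ContDiff ℝ ∞ N := contDiff_superposition hV
  let cst : E →L[ℝ] X := ContinuousLinearMap.const ℝ unitInterval
  -- With time rescaled to the unit interval, the curve `t ↦ α (x, s * t)` is a zero of `γ - x - s ∫
  -- V(γ)`, and `s` becomes a parameter beside `x`. Carrying `(x, s)` along makes the inverse
  -- function theorem applicable in the Banach space of curves.
  let Ψ : (E × ℝ) × X → (E × ℝ) × X :=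
    fun p => (p.1, p.2 - cst p.1.1 - p.1.2 • primitiveCLM E (N p.2))
  have hΨ : ContDiff ℝ ∞ Ψ := by
    have h1 : ContDiff ℝ ∞ (fun p : (E × ℝ) × X => N p.2) := hN.comp contDiff_snd
    have h2 : ContDiff ℝ ∞ (fun p : (E × ℝ) × X => primitiveCLM E (N p.2)) :=
      (primitiveCLM E).contDiff.comp h1
    have h3 : ContDiff ℝ ∞ (fun p : (E × ℝ) × X => cst p.1.1) :=
      cst.contDiff.comp (contDiff_fst.comp contDiff_fst)
    exact contDiff_fst.prodMk ((contDiff_snd.sub h3).sub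
      ((contDiff_snd.comp contDiff_fst).smul h2))
  let p₀ : (E × ℝ) × X := ((x₀, 0), cst x₀)
  -- At `s = 0` the integral term does not contribute to the derivative in `γ`, which is therefore
  -- the identity. The whole derivative is block triangular, hence invertible.
  let c : E × ℝ →L[ℝ] X :=
    -(cst.comp (ContinuousLinearMap.fst ℝ E ℝ) +
      (ContinuousLinearMap.snd ℝ E ℝ).smulRight (primitiveCLM E (N (cst x₀))))
  let e : ((E × ℝ) × X) ≃L[ℝ] ((E × ℝ) × X) :=
    ContinuousLinearEquiv.skewProd (.refl ℝ _) (.refl ℝ _) c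
  have hΨ' : HasFDerivAt Ψ (e : ((E × ℝ) × X) →L[ℝ] ((E × ℝ) × X)) p₀ := by
    have h1 : HasFDerivAt (fun p : (E × ℝ) × X => primitiveCLM E (N p.2))
        (fderiv ℝ (fun p : (E × ℝ) × X => primitiveCLM E (N p.2)) p₀) p₀ :=
      (((primitiveCLM E).contDiff.comp (hN.comp contDiff_snd)).differentiable
        (n := ∞) (by simp) p₀).hasFDerivAt
    have h2 : HasFDerivAt (fun p : (E × ℝ) × X => p.1.2)
        ((ContinuousLinearMap.snd ℝ E ℝ).comp (ContinuousLinearMap.fst ℝ (E × ℝ) X)) p₀ :=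
      ((ContinuousLinearMap.snd ℝ E ℝ).comp
        (ContinuousLinearMap.fst ℝ (E × ℝ) X)).hasFDerivAt
    have h3 : HasFDerivAt (fun p : (E × ℝ) × X => cst p.1.1)
        (cst.comp ((ContinuousLinearMap.fst ℝ E ℝ).comp (ContinuousLinearMap.fst ℝ (E × ℝ) X)))
        p₀ := (cst.comp ((ContinuousLinearMap.fst ℝ E ℝ).comp
          (ContinuousLinearMap.fst ℝ (E × ℝ) X))).hasFDerivAt
    refine (hasFDerivAt_fst.prodMk ((hasFDerivAt_snd.sub h3).sub (h2.smul h1))).congr_fderiv ?_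
    refine ContinuousLinearMap.ext fun p => Prod.ext ?_ ?_
    · simp [e]
    · simp only [e, c, p₀]
      simp
      abel
  obtain ⟨Φ, hΦp₀, hΦ, -, hΦsymm⟩ := exists_smooth_openPartialHomeomorph
    (Eventually.of_forall fun p => hΨ.contDiffAt (x := p)) hΨ'
  have hΨp₀ : Ψ p₀ = ((x₀, 0), 0) := by simp [Ψ, p₀]
  have hΦtarget : ∀ᶠ p in 𝓝 (x₀, (0 : ℝ)), (p, (0 : X)) ∈ Φ.target := by
    have h1 : ((x₀, (0 : ℝ)), (0 : X)) ∈ Φ.target := by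
      rw [← hΨp₀, ← hΦ p₀ hΦp₀]
      exact Φ.map_source hΦp₀
    exact (by fun_prop : Continuous fun p : E × ℝ => (p, (0 : X))).continuousAt.eventually
      (Φ.open_target.mem_nhds h1)
  have hsol : ∀ᶠ p in 𝓝 (x₀, (0 : ℝ)),
      ContDiffAt ℝ ∞ (fun p : E × ℝ => (Φ.symm (p, 0)).2 1) p := by
    filter_upwards [hΦtarget] with p hp
    have h1 : ContDiffAt ℝ ∞ (fun p : E × ℝ => Φ.symm (p, 0)) p :=
      (hΦsymm _ hp).comp p (contDiffAt_id.prodMk contDiffAt_const)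
    exact (ContinuousMap.evalCLM ℝ (1 : unitInterval)).contDiff.contDiffAt.comp _ h1.snd
  -- The right side is smooth. The two sides agree once the rescaled integral curve is so close to
  -- the constant curve that it lies in the domain where `Ψ` is injective.
  suffices hev : α =ᶠ[𝓝 (x₀, 0)] fun p : E × ℝ => (Φ.symm (p, 0)).2 1 by
    filter_upwards [hev.eventuallyEq_nhds, hsol] with p hp hp'
    exact hp'.congr_of_eventuallyEq hp
  obtain ⟨δ, hδ, hball⟩ := Metric.eventually_nhds_iff.1 (Φ.open_source.mem_nhds hΦp₀)
  have hα0 : α (x₀, 0) = x₀ := h0.self_of_nhds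
  have hnear : ∀ᶠ p in 𝓝 (x₀, (0 : ℝ)), dist (α p) x₀ < δ / 2 := by
    have := Metric.tendsto_nhds.1 hcont (δ / 2) (half_pos hδ)
    rwa [hα0] at this
  have h0' : ∀ᶠ p in 𝓝 (x₀, (0 : ℝ)), α (p.1, 0) = p.1 :=
    (continuous_fst.tendsto (x₀, (0 : ℝ))).eventually h0
  obtain ⟨η, hη, hall⟩ := Metric.eventually_nhds_iff.1 (hnear.and (h0'.and hα))
  filter_upwards [Metric.ball_mem_nhds (x₀, (0 : ℝ)) (lt_min hη hδ)] with p hp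
  obtain ⟨x, s⟩ := p
  rw [Metric.mem_ball, Prod.dist_eq, max_lt_iff] at hp
  obtain ⟨hpx, hps⟩ := hp
  simp only [Real.dist_eq, sub_zero, lt_min_iff] at hpx hps
  have hmem : ∀ t : ℝ, t ∈ Icc (0 : ℝ) 1 → dist (x, s * t) (x₀, (0 : ℝ)) < η := by
    intro t ht
    rw [Prod.dist_eq, max_lt_iff]
    refine ⟨hpx.1, ?_⟩
    rw [Real.dist_eq, sub_zero, abs_mul, abs_of_nonneg ht.1]
    nlinarith [abs_nonneg s, ht.2, hps.1]
  have hder : ∀ t ∈ Icc (0 : ℝ) 1,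
      HasDerivAt (fun τ => α (x, s * τ)) (s • V (α (x, s * t))) t := by
    intro t ht
    have h1 := (hall (hmem t ht)).2.2
    have h2 : HasDerivAt (fun τ : ℝ => s * τ) s t := by simpa using (hasDerivAt_id t).const_mul s
    exact HasDerivAt.scomp t h1 h2
  have hcontI : ContinuousOn (fun τ => α (x, s * τ)) (Icc 0 1) := fun t ht =>
    (hder t ht).continuousAt.continuousWithinAt
  let γ : X := ⟨fun t => α (x, s * t), continuousOn_iff_continuous_domRestrict.1 hcontI⟩
  have hγ : Ψ ((x, s), γ) = ((x, s), 0) := by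
    refine Prod.ext rfl (ContinuousMap.ext fun t => ?_)
    have hsub : uIcc (0 : ℝ) t ⊆ Icc 0 1 := by
      rw [uIcc_of_le t.2.1]
      exact Icc_subset_Icc_right t.2.2
    have hint : ∫ τ in (0 : ℝ)..t, s • V (α (x, s * τ)) = α (x, s * t) - α (x, s * 0) :=
      intervalIntegral.integral_eq_sub_of_hasDerivAt (fun τ hτ => hder τ (hsub hτ))
        ((((hV.continuous.comp_continuousOn hcontI).const_smul s).mono hsub).intervalIntegrable)
    have hprim : primitiveCLM E (N γ) t = ∫ τ in (0 : ℝ)..t, V (α (x, s * τ)) := by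
      rw [primitiveCLM_apply]
      refine intervalIntegral.integral_congr fun τ hτ => ?_
      change IccExtend zero_le_one (N γ) τ = _
      rw [IccExtend_of_mem _ _ (hsub hτ)]
      rfl
    have h1 : α (x, s * 0) = x := by
      rw [mul_zero]
      exact (hall (hmem 0 (by simp))).2.1
    rw [intervalIntegral.integral_smul, h1] at hint
    change γ t - x - s • primitiveCLM E (N γ) t = 0
    rw [hprim, hint]
    change α (x, s * t) - x - (α (x, s * t) - x) = 0
    rw [sub_self]
  have hclose : dist ((x, s), γ) p₀ < δ := by
    rw [Prod.dist_eq, max_lt_iff]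
    constructor
    · rw [Prod.dist_eq, max_lt_iff]
      exact ⟨hpx.2, by
        change |s - 0| < δ
        rw [sub_zero]
        exact hps.2⟩
    · refine lt_of_le_of_lt ((ContinuousMap.dist_le (half_pos hδ).le).2 fun t => ?_)
        (half_lt_self hδ)
      exact (hall (hmem t t.2)).1.le
  have hfin : Φ.symm (Ψ ((x, s), γ)) = ((x, s), γ) := by
    rw [← hΦ _ (hball hclose)]
    exact Φ.left_inv (hball hclose)
  rw [hγ] at hfin
  change α (x, s) = (Φ.symm ((x, s), 0)).2 1
  rw [hfin]
  change α (x, s) = α (x, s * (1 : ℝ))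
  rw [mul_one]

/-- A smooth vector field has a smooth local flow. -/
theorem exists_contDiffAt_flow [FiniteDimensional ℝ E] {V : E → E} {x₀ : E}
    (hV : ∀ᶠ x in 𝓝 x₀, ContDiffAt ℝ ∞ V x) :
    ∃ α : E × ℝ → E, (∀ᶠ p in 𝓝 (x₀, (0 : ℝ)), ContDiffAt ℝ ∞ α p) ∧ (∀ᶠ x in 𝓝 x₀, α (x, 0) = x) ∧
      ∀ᶠ p in 𝓝 (x₀, (0 : ℝ)), HasDerivAt (fun t => α (p.1, t)) (V (α p)) p.2 := by
  obtain ⟨s, hs, hVs⟩ := hV.exists_mem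
  obtain ⟨r, hr, hrs⟩ := Metric.mem_nhds_iff.1 hs
  -- The cut-off makes the field smooth everywhere without changing it on the ball of radius `r /
  -- 4`, in which the flow stays for short times.
  let χ : ContDiffBump x₀ := ⟨r / 4, r / 2, by positivity, by linarith⟩
  let W : E → E := fun x => χ x • V x
  have hW : ContDiff ℝ ∞ W := by
    refine contDiff_iff_contDiffAt.2 fun x => ?_
    by_cases hx : x ∈ Metric.ball x₀ r
    · exact χ.contDiff.contDiffAt.smul (hVs x (hrs hx))
    · have : W =ᶠ[𝓝 x] fun _ => 0 := by
        have hx' : x ∉ tsupport χ := by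
          rw [χ.tsupport_eq, Metric.mem_closedBall]
          rw [Metric.mem_ball] at hx
          change ¬ dist x x₀ ≤ r / 2
          linarith
        filter_upwards [(isClosed_tsupport χ).isOpen_compl.mem_nhds hx'] with z hz
        simp [W, image_eq_zero_of_notMem_tsupport hz]
      exact contDiffAt_const.congr_of_eventuallyEq this
  obtain ⟨ε, hε, a, R, L, K, hR, hpl⟩ := IsPicardLindelof.of_contDiffAt_one
    (x₀ := x₀) ((hW.of_le (by simp)).contDiffAt (n := 1))
  obtain ⟨α, hα, hcont⟩ :=
    (hpl 0).exists_forall_mem_closedBall_eq_hasDerivWithinAt_continuousOn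
  have hcont' : ContinuousAt α (x₀, 0) := hcont.continuousAt
    (prod_mem_nhds (Metric.closedBall_mem_nhds x₀ hR) (Icc_mem_nhds (by linarith) (by linarith)))
  have h0 : ∀ᶠ x in 𝓝 x₀, α (x, 0) = x := by
    filter_upwards [Metric.closedBall_mem_nhds x₀ hR] with x hx using (hα x hx).1
  have hder : ∀ᶠ p in 𝓝 (x₀, (0 : ℝ)), HasDerivAt (fun t => α (p.1, t)) (W (α p)) p.2 := by
    filter_upwards [prod_mem_nhds (Metric.closedBall_mem_nhds x₀ hR)
      (Ioo_mem_nhds (show 0 - ε < 0 by linarith) (show 0 < 0 + ε by linarith))] with p hp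
    exact ((hα p.1 hp.1).2 p.2 (Ioo_subset_Icc_self hp.2)).hasDerivAt
      (Icc_mem_nhds hp.2.1 hp.2.2)
  refine ⟨α, contDiffAt_flow_of_contDiff hW hcont' h0 hder, h0, ?_⟩
  have hnear : ∀ᶠ p in 𝓝 (x₀, (0 : ℝ)), α p ∈ Metric.ball x₀ (r / 4) := by
    have := hcont'.eventually (Metric.ball_mem_nhds _ (show 0 < r / 4 by positivity))
    rwa [h0.self_of_nhds] at this
  filter_upwards [hder, hnear] with p hp hp'
  have : W (α p) = V (α p) := by
    simp [W, χ.one_of_mem_closedBall (Metric.ball_subset_closedBall hp')]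
  rwa [← this]

end Flow

/-! ### Simultaneous straightening of a function and a vector field -/

section NormalForm

/-- The inverse function theorem for self-maps of a finite-dimensional space, localized to an
arbitrary neighbourhood. -/
theorem exists_local_diffeo_of_injective {E : Type*} [NormedAddCommGroup E] [NormedSpace ℝ E]
    [FiniteDimensional ℝ E] {f : E → E} {a : E} (hf : ∀ᶠ x in 𝓝 a, ContDiffAt ℝ ∞ f x)
    (hinj : ∀ w, fderiv ℝ f a w = 0 → w = 0) {P : E → Prop} (hP : ∀ᶠ x in 𝓝 a, P x) :
    ∃ Φ : OpenPartialHomeomorph E E, a ∈ Φ.source ∧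
      (∀ x ∈ Φ.source, Φ x = f x ∧ ContDiffAt ℝ ∞ Φ x ∧ P x) ∧
      ∀ y ∈ Φ.target, ContDiffAt ℝ ∞ Φ.symm y := by
  have : CompleteSpace E := FiniteDimensional.complete ℝ E
  let e : E ≃L[ℝ] E := (LinearEquiv.ofInjectiveEndo (fderiv ℝ f a : E →ₗ[ℝ] E)
    (LinearMap.ker_eq_bot.1 (LinearMap.ker_eq_bot'.2 hinj))).toContinuousLinearEquiv
  have he : (e : E →L[ℝ] E) = fderiv ℝ f a := by
    ext w
    rfl
  obtain ⟨Φ, ha, hΦ, hs, hs'⟩ := exists_smooth_openPartialHomeomorph (f' := e) hf (by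
    rw [he]
    exact (hf.self_of_nhds.differentiableAt (by simp)).hasFDerivAt)
  obtain ⟨s, hs1, hso, has⟩ := eventually_nhds_iff.1 hP
  exact ⟨Φ.restrOpen s hso, ⟨ha, has⟩, fun x hx => ⟨hΦ x hx.1, hs x hx.1, hs1 x hx.2⟩,
    fun y hy => hs' y hy.1⟩

theorem fderiv_symm_of_fderiv {E : Type*} [NormedAddCommGroup E] [NormedSpace ℝ E]
    {Φ : OpenPartialHomeomorph E E} {y : E} (hy : y ∈ Φ.target)
    (h1 : DifferentiableAt ℝ Φ (Φ.symm y)) (h2 : DifferentiableAt ℝ Φ.symm y) {v w : E}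
    (hv : fderiv ℝ Φ (Φ.symm y) v = w) : fderiv ℝ Φ.symm y w = v := by
  have hleft : (Φ.symm ∘ Φ) =ᶠ[𝓝 (Φ.symm y)] id := by
    filter_upwards [Φ.open_source.mem_nhds (Φ.map_target hy)] with z hz using Φ.left_inv hz
  have h3 : fderiv ℝ (Φ.symm ∘ Φ) (Φ.symm y) = ContinuousLinearMap.id ℝ E := by
    rw [hleft.fderiv_eq, fderiv_id]
  rw [fderiv_comp _ (by rwa [Φ.right_inv hy]) h1, Φ.right_inv hy] at h3
  have := congrArg (fun L => L v) h3
  simpa [hv] using this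

variable {d : ℕ}

/-- The coordinate projection of `Coord n`. -/
noncomputable abbrev coordProj {n : ℕ} (i : Fin n) : Coord n →L[ℝ] ℝ := EuclideanSpace.proj i

/-- Permute the coordinates by `1 ↔ j` and put zero into the slot `j`. -/
noncomputable def transversal (j : Fin (d + 2)) : Coord (d + 2) →L[ℝ] Coord (d + 2) :=
  ((EuclideanSpace.equiv (Fin (d + 2)) ℝ).symm : (Fin (d + 2) → ℝ) →L[ℝ] Coord (d + 2)).comp
    (ContinuousLinearMap.pi fun i => if i = j then 0 else coordProj (Equiv.swap 1 j i))

theorem transversal_apply (j : Fin (d + 2)) (z : Coord (d + 2)) (i : Fin (d + 2)) :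
    transversal j z i = if i = j then 0 else z (Equiv.swap 1 j i) := by
  simp only [transversal, ContinuousLinearMap.comp_apply]
  change (if i = j then (0 : Coord (d + 2) →L[ℝ] ℝ) else coordProj (Equiv.swap 1 j i)) z = _
  split_ifs <;> rfl

theorem transversal_single_one (j : Fin (d + 2)) :
    transversal j (EuclideanSpace.single 1 1) = 0 := by
  ext i
  rw [transversal_apply]
  split_ifs with h
  · rfl
  · rw [PiLp.single_apply, if_neg]
    · rfl
    · rintro h'
      exact h (by simpa using congrArg (Equiv.swap 1 j) h')

/-- Replace the coordinate in slot `0` by the function `U`, after exchanging the slots `0` and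
`i`. -/
noncomputable def replaceCoord (i : Fin (d + 2)) (U : Coord (d + 2) → ℝ) (z : Coord (d + 2)) :
    Coord (d + 2) :=
  WithLp.toLp 2 fun j => if j = 0 then U z else z (Equiv.swap 0 i j)

theorem replaceCoord_contDiffAt {i : Fin (d + 2)} {U : Coord (d + 2) → ℝ} {z : Coord (d + 2)}
    (hU : ContDiffAt ℝ ∞ U z) : ContDiffAt ℝ ∞ (replaceCoord i U) z := by
  refine contDiffAt_euclidean.2 fun j => ?_
  by_cases hj : j = 0
  · simpa [replaceCoord, hj] using hU
  · simpa [replaceCoord, hj] using (coordProj (Equiv.swap 0 i j)).contDiff.contDiffAt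

theorem fderiv_coord {n m : ℕ} {f : Coord n → Coord m} {z : Coord n} (hf : DifferentiableAt ℝ f z)
    (w : Coord n) (j : Fin m) : fderiv ℝ f z w j = fderiv ℝ (fun z => f z j) z w := by
  have := (coordProj j).hasFDerivAt.comp z hf.hasFDerivAt
  exact (congrArg (fun L => L w) this.fderiv).symm

theorem fderiv_replaceCoord {i : Fin (d + 2)} {U : Coord (d + 2) → ℝ} {z : Coord (d + 2)}
    (hU : ContDiffAt ℝ ∞ U z) (w : Coord (d + 2)) (j : Fin (d + 2)) :
    fderiv ℝ (replaceCoord i U) z w j =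
      if j = 0 then fderiv ℝ U z w else w (Equiv.swap 0 i j) := by
  rw [fderiv_coord ((replaceCoord_contDiffAt hU).differentiableAt (by simp))]
  by_cases hj : j = 0
  · simp [replaceCoord, hj]
  · simp only [replaceCoord, hj, if_false]
    exact congrArg (fun L => L w) (coordProj (Equiv.swap 0 i j)).fderiv

/-- Simultaneous straightening of a function and of a vector field that annihilates it. -/
theorem exists_straightening {x₀ : Coord (d + 2)} {u : Coord (d + 2) → ℝ}
    {V : Coord (d + 2) → Coord (d + 2)} (hu : ∀ᶠ x in 𝓝 x₀, ContDiffAt ℝ ∞ u x)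
    (hV : ∀ᶠ x in 𝓝 x₀, ContDiffAt ℝ ∞ V x) (huV : ∀ᶠ x in 𝓝 x₀, fderiv ℝ u x (V x) = 0)
    (hu0 : fderiv ℝ u x₀ ≠ 0) (hV0 : V x₀ ≠ 0) :
    ∃ Φ : OpenPartialHomeomorph (Coord (d + 2)) (Coord (d + 2)), x₀ ∈ Φ.source ∧
      (∀ x ∈ Φ.source, ContDiffAt ℝ ∞ Φ x ∧ Φ x 0 = u x) ∧
      ∀ z ∈ Φ.target, ContDiffAt ℝ ∞ Φ.symm z ∧
        fderiv ℝ Φ.symm z (EuclideanSpace.single 1 1) = V (Φ.symm z) := by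
  obtain ⟨α, hα, hα0, hαd⟩ := exists_contDiffAt_flow hV
  -- Since `V x₀ j ≠ 0`, the hyperplane through `x₀` on which slot `j` is fixed is transverse to
  -- `V`. The flow box starts on it, and the swap of `1` and `j` frees slot `1` for the time.
  obtain ⟨j, hj⟩ : ∃ j, V x₀ j ≠ 0 := by
    by_contra! h
    exact hV0 (by ext j; exact h j)
  let q : Coord (d + 2) → Coord (d + 2) × ℝ := fun z => (x₀ + transversal j z, z 1)
  have hq : ContDiff ℝ ∞ q :=
    (contDiff_const.add (transversal j).contDiff).prodMk (coordProj 1).contDiff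
  have hq0 : q 0 = (x₀, 0) := by simp [q]
  have hqt : Tendsto q (𝓝 0) (𝓝 (x₀, 0)) := hq0 ▸ hq.continuous.tendsto 0
  let Θ : Coord (d + 2) → Coord (d + 2) := fun z => α (q z)
  have hΘ0 : Θ 0 = x₀ := by
    simp only [Θ, hq0]
    exact hα0.self_of_nhds
  have hΘ : ∀ᶠ z in 𝓝 0, ContDiffAt ℝ ∞ Θ z := by
    filter_upwards [hqt.eventually hα] with z hz using hz.comp z hq.contDiffAt
  have hΘt : Tendsto Θ (𝓝 0) (𝓝 x₀) := by
    have := hΘ.self_of_nhds.continuousAt.tendsto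
    rwa [hΘ0] at this
  have hΘ1 : ∀ᶠ z in 𝓝 0, fderiv ℝ Θ z (EuclideanSpace.single 1 1) = V (Θ z) := by
    filter_upwards [hqt.eventually hαd, hΘ] with z hz hz'
    have hline : HasDerivAt (fun t : ℝ => z + t • EuclideanSpace.single (1 : Fin (d + 2)) (1 : ℝ))
        (EuclideanSpace.single 1 1) 0 := by
      simpa using ((hasDerivAt_id (0 : ℝ)).smul_const
        (EuclideanSpace.single (1 : Fin (d + 2)) (1 : ℝ))).const_add z
    have h1 : HasDerivAt
        (fun t : ℝ => Θ (z + t • EuclideanSpace.single (1 : Fin (d + 2)) (1 : ℝ)))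
        (fderiv ℝ Θ z (EuclideanSpace.single 1 1)) 0 := by
      have h0 : HasFDerivAt Θ (fderiv ℝ Θ z)
          (z + (0 : ℝ) • EuclideanSpace.single (1 : Fin (d + 2)) (1 : ℝ)) := by
        rw [zero_smul, add_zero]
        exact (hz'.differentiableAt (by simp)).hasFDerivAt
      exact h0.comp_hasDerivAt (0 : ℝ) hline
    have h2 : HasDerivAt
        (fun t : ℝ => Θ (z + t • EuclideanSpace.single (1 : Fin (d + 2)) (1 : ℝ)))
        (V (Θ z)) 0 := by
      have h3 : HasDerivAt (fun t : ℝ => α ((q z).1, z 1 + t)) (V (α (q z))) 0 := by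
        have h4 : HasDerivAt (fun t : ℝ => z 1 + t) 1 0 := (hasDerivAt_id (0 : ℝ)).const_add _
        have h5 : HasDerivAt (fun t => α ((q z).1, t)) (V (α (q z))) (z 1 + 0) := by
          rw [add_zero]
          exact hz
        have h6 := h5.scomp (0 : ℝ) h4
        rwa [one_smul] at h6
      refine h3.congr_of_eventuallyEq (Eventually.of_forall fun t => ?_)
      simp only [Θ, q, map_add, map_smul, transversal_single_one, smul_zero, add_zero]
      congr 2
      simp
    exact h1.unique h2
  -- At the origin the derivative of the flow box is the inclusion of the hyperplane in the
  -- directions with slot `1` zero, and `V x₀` in direction `1`. Component `j` of the latter is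
  -- nonzero, that of the former is zero.
  have hΘinj : ∀ w, fderiv ℝ Θ 0 w = 0 → w = 0 := by
    intro w hw
    have hdiff := hΘ.self_of_nhds.differentiableAt (by simp)
    have hzero : ∀ w' : Coord (d + 2), w' 1 = 0 → fderiv ℝ Θ 0 w' = transversal j w' := by
      intro w' hw'
      have hline : HasDerivAt (fun t : ℝ => t • w') w' 0 := by
        simpa using (hasDerivAt_id (0 : ℝ)).smul_const w'
      have h1 : HasDerivAt (fun t : ℝ => Θ (t • w')) (fderiv ℝ Θ 0 w') 0 := by
        have h0 : HasFDerivAt Θ (fderiv ℝ Θ 0) ((0 : ℝ) • w') := by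
          rw [zero_smul]
          exact hdiff.hasFDerivAt
        exact h0.comp_hasDerivAt (0 : ℝ) hline
      have h2 : HasDerivAt (fun t : ℝ => Θ (t • w')) (transversal j w') 0 := by
        have h3 : HasDerivAt (fun t : ℝ => x₀ + transversal j (t • w')) (transversal j w') 0 :=
          ((transversal j).hasFDerivAt.comp_hasDerivAt (0 : ℝ) hline).const_add x₀
        refine h3.congr_of_eventuallyEq ?_
        have h4 : Tendsto (fun t : ℝ => x₀ + transversal j (t • w')) (𝓝 0) (𝓝 x₀) := by
          simpa using h3.continuousAt.tendsto
        filter_upwards [h4.eventually hα0] with t ht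
        simp only [Θ, q]
        rw [PiLp.smul_apply, hw', smul_zero]
        exact ht
      exact h1.unique h2
    set w' := w - w 1 • EuclideanSpace.single (1 : Fin (d + 2)) (1 : ℝ) with hw'
    have hw1 : w' 1 = 0 := by simp [hw']
    have hdec : w = w' + w 1 • EuclideanSpace.single (1 : Fin (d + 2)) (1 : ℝ) := by simp [hw']
    rw [hdec, map_add, map_smul, hzero w' hw1, hΘ1.self_of_nhds, hΘ0] at hw
    have hc : ∀ i, transversal j w' i + w 1 * V x₀ i = 0 := fun i => by
      have := congrArg (fun v : Coord (d + 2) => v i) hw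
      simpa using this
    have hw10 : w 1 = 0 := by
      have := hc j
      rw [transversal_apply, if_pos rfl, zero_add] at this
      exact (mul_eq_zero.1 this).resolve_right hj
    ext k
    by_cases hk : k = 1
    · rw [hk]
      exact hw10
    · have := hc (Equiv.swap 1 j k)
      rw [transversal_apply, if_neg, Equiv.swap_apply_self, hw10, zero_mul, add_zero] at this
      · rw [hdec, hw10]
        simpa using this
      · intro h
        exact hk (by simpa using congrArg (Equiv.swap 1 j) h)
  have hU : ∀ᶠ z in 𝓝 0, ContDiffAt ℝ ∞ (u ∘ Θ) z := by
    filter_upwards [hΘ, hΘt.eventually hu] with z hz hz' using hz'.comp z hz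
  have hU1 : ∀ᶠ z in 𝓝 0, fderiv ℝ (u ∘ Θ) z (EuclideanSpace.single 1 1) = 0 := by
    filter_upwards [hΘ, hΘ1, hΘt.eventually (hu.and huV)] with z h1 h2 h3
    rw [fderiv_comp _ (h3.1.differentiableAt (by simp)) (h1.differentiableAt (by simp)),
      ContinuousLinearMap.comp_apply, h2, h3.2]
  obtain ⟨Φ₁, h01, hΦ₁, hΦ₁s⟩ := exists_local_diffeo_of_injective hΘ hΘinj
    (hΘ1.and (hU.and hU1))
  have hdU : fderiv ℝ (u ∘ Θ) 0 ≠ 0 := by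
    intro h
    refine hu0 ?_
    rw [fderiv_comp _ (by rw [hΘ0]; exact hu.self_of_nhds.differentiableAt (by simp))
      (hΘ.self_of_nhds.differentiableAt (by simp)), hΘ0] at h
    have hsurj := LinearMap.surjective_of_injective (f := (fderiv ℝ Θ 0).toLinearMap)
      (LinearMap.ker_eq_bot.1 (LinearMap.ker_eq_bot'.2 hΘinj))
    ext w
    obtain ⟨w', rfl⟩ := hsurj w
    exact congrArg (fun L => L w') h
  obtain ⟨i, hi⟩ : ∃ i, fderiv ℝ (u ∘ Θ) 0 (EuclideanSpace.single i 1) ≠ 0 := by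
    by_contra! h
    refine hdU (ContinuousLinearMap.coe_injective
      ((EuclideanSpace.basisFun (Fin (d + 2)) ℝ).toBasis.ext fun i => ?_))
    simpa using h i
  -- `u` is constant along the flow, so the coordinate that makes way for it is not the time. Thus
  -- the second change of coordinates keeps the field of slot `1`.
  have hi1 : i ≠ 1 := by
    rintro rfl
    exact hi hU1.self_of_nhds
  have hswap1 : Equiv.swap 0 i 1 = 1 := Equiv.swap_apply_of_ne_of_ne (by simp) hi1.symm
  have hKinj : ∀ w, fderiv ℝ (replaceCoord i (u ∘ Θ)) 0 w = 0 → w = 0 := by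
    intro w hw
    have hc : ∀ j, (if j = 0 then fderiv ℝ (u ∘ Θ) 0 w else w (Equiv.swap 0 i j)) = 0 := by
      intro j
      rw [← fderiv_replaceCoord hU.self_of_nhds, hw]
      rfl
    have hne : ∀ k, k ≠ i → w k = 0 := by
      intro k hk
      have := hc (Equiv.swap 0 i k)
      rwa [if_neg, Equiv.swap_apply_self] at this
      intro h
      exact hk (by simpa using congrArg (Equiv.swap 0 i) h)
    have hw' : w = w i • EuclideanSpace.single i (1 : ℝ) := by
      ext k
      by_cases hk : k = i
      · simp [hk]
      · simp [hne k hk, hk]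
    have h0 := hc 0
    rw [if_pos rfl, hw', map_smul, smul_eq_mul] at h0
    rw [hw', (mul_eq_zero.1 h0).resolve_right hi, zero_smul]
  obtain ⟨Φ₂, h02, hΦ₂, hΦ₂s⟩ := exists_local_diffeo_of_injective
    (f := replaceCoord i (u ∘ Θ)) (hU.mono fun z hz => replaceCoord_contDiffAt hz) hKinj
    (P := fun z => ContDiffAt ℝ ∞ (u ∘ Θ) z ∧
      fderiv ℝ (u ∘ Θ) z (EuclideanSpace.single 1 1) = 0) (hU.and hU1)
  refine ⟨Φ₁.symm.trans Φ₂, ?_, fun x hx => ?_, fun z hz => ?_⟩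
  · have h1 : Φ₁ 0 = x₀ := by rw [(hΦ₁ 0 h01).1, hΘ0]
    have h2 : x₀ ∈ Φ₁.target := h1 ▸ Φ₁.map_source h01
    refine (Φ₁.symm.trans_source Φ₂).symm ▸ ⟨h2, ?_⟩
    rw [mem_preimage, ← h1, Φ₁.left_inv h01]
    exact h02
  · rw [OpenPartialHomeomorph.trans_source] at hx
    obtain ⟨hx1, hx2⟩ := hx
    refine ⟨(hΦ₂ _ hx2).2.1.comp x (hΦ₁s x hx1), ?_⟩
    rw [OpenPartialHomeomorph.trans_apply, (hΦ₂ _ hx2).1]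
    simp only [replaceCoord, if_true, Function.comp_apply]
    rw [← (hΦ₁ _ (Φ₁.map_target hx1)).1, Φ₁.right_inv hx1]
  · rw [OpenPartialHomeomorph.trans_target] at hz
    obtain ⟨hz1, hz2⟩ := hz
    have hz2' : Φ₂.symm z ∈ Φ₁.source := hz2
    have hd1 := (hΦ₁ _ hz2').2.1
    have hd2 := hΦ₂s z hz1
    have hs2 := Φ₂.map_target hz1
    refine ⟨hd1.comp z hd2, ?_⟩
    have heq1 : (Φ₁ : Coord (d + 2) → Coord (d + 2)) =ᶠ[𝓝 (Φ₂.symm z)] Θ := by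
      filter_upwards [Φ₁.open_source.mem_nhds hz2'] with y hy using (hΦ₁ y hy).1
    have heq2 : (Φ₂ : Coord (d + 2) → Coord (d + 2)) =ᶠ[𝓝 (Φ₂.symm z)]
        replaceCoord i (u ∘ Θ) := by
      filter_upwards [Φ₂.open_source.mem_nhds hs2] with y hy using (hΦ₂ y hy).1
    -- The new coordinate `u ∘ Θ` does not change in direction `1`, and the swap of `0` and `i`
    -- fixes `1`.
    have hK1 : fderiv ℝ Φ₂ (Φ₂.symm z) (EuclideanSpace.single 1 1) =
        EuclideanSpace.single 1 1 := by
      rw [heq2.fderiv_eq]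
      ext k
      rw [fderiv_replaceCoord (hΦ₂ _ hs2).2.2.1, (hΦ₂ _ hs2).2.2.2]
      by_cases hk : k = 0
      · simp [hk]
      · simp only [hk, if_false, PiLp.single_apply]
        congr 1
        rw [← hswap1, (Equiv.swap 0 i).apply_eq_iff_eq, hswap1]
    change fderiv ℝ (Φ₁ ∘ Φ₂.symm) z _ = V (Φ₁ (Φ₂.symm z))
    rw [fderiv_comp _ (hd1.differentiableAt (by simp)) (hd2.differentiableAt (by simp)),
      ContinuousLinearMap.comp_apply,
      fderiv_symm_of_fderiv hz1 ((hΦ₂ _ hs2).2.1.differentiableAt (by simp))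
        (hd2.differentiableAt (by simp)) hK1, heq1.fderiv_eq, (hΦ₁ _ hz2').2.2.1,
      heq1.self_of_nhds]

end NormalForm

/-! ### Connection coefficients as a bilinear map; partial derivatives -/

section Bilinear

variable {n : ℕ}

/-- The bilinear map `(v, w) ↦ Γⁱⱼₖ vʲ wᵏ eᵢ`. -/
noncomputable def connBilin (Γ : Fin n → Fin n → Fin n → ℝ) :
    Coord n →L[ℝ] Coord n →L[ℝ] Coord n :=
  ∑ i, ∑ j, ∑ k, Γ i j k •
    (coordProj j).smulRight ((coordProj k).smulRight (EuclideanSpace.single i (1 : ℝ)))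

theorem connBilin_apply (Γ : Fin n → Fin n → Fin n → ℝ) (v w : Coord n) (i : Fin n) :
    connBilin Γ v w i = ∑ j, ∑ k, Γ i j k * v j * w k := by
  have h1 : connBilin Γ v w = ∑ i, ∑ j, ∑ k, (Γ i j k * v j * w k) •
      EuclideanSpace.single i (1 : ℝ) := by
    simp only [connBilin, sum_apply, smul_apply,
      ContinuousLinearMap.smulRight_apply, smul_smul, PiLp.proj_apply]
  rw [h1]
  simp only [WithLp.ofLp_sum, Finset.sum_apply, PiLp.smul_apply, PiLp.single_apply, smul_eq_mul]
  rw [Finset.sum_eq_single i]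
  · simp
  · intro b _ hb
    simp [hb.symm]
  · simp

theorem connBilin_symm {Γ : Fin n → Fin n → Fin n → ℝ} (hΓ : ∀ i j k, Γ i j k = Γ i k j)
    (v w : Coord n) : connBilin Γ v w = connBilin Γ w v := by
  ext i
  rw [connBilin_apply, connBilin_apply, Finset.sum_comm]
  exact Finset.sum_congr rfl fun j _ => Finset.sum_congr rfl fun k _ => by
    rw [hΓ i k j]
    ring

theorem coord_eq_sum (v : Coord n) : v = ∑ i, v i • EuclideanSpace.single i (1 : ℝ) := by
  have := (EuclideanSpace.basisFun (Fin n) ℝ).sum_repr v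
  simpa using this.symm

theorem fderiv_eq_sum_pd {f : Coord n → ℝ} (x v : Coord n) :
    fderiv ℝ f x v = ∑ i, v i * pd i f x := by
  conv_lhs => rw [coord_eq_sum v]
  simp [pd, map_sum]

theorem Filter.EventuallyEq.pd_eq {f g : Coord n → ℝ} {x : Coord n} (h : f =ᶠ[𝓝 x] g)
    (i : Fin n) : pd i f x = pd i g x := by
  rw [pd, pd, h.fderiv_eq]

/-- The entries of the inverse of a matrix of smooth functions are smooth. -/
theorem contDiffAt_matrix_inv {E : Type*} [NormedAddCommGroup E] [NormedSpace ℝ E]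
    {g : E → Matrix (Fin n) (Fin n) ℝ} {x : E} {N : WithTop ℕ∞}
    (hg : ∀ i j, ContDiffAt ℝ N (fun y => g y i j) x) (hdet : (g x).det ≠ 0) (i j : Fin n) :
    ContDiffAt ℝ N (fun y => (g y)⁻¹ i j) x := by
  have hdetC : ∀ {A : E → Matrix (Fin n) (Fin n) ℝ},
      (∀ i j, ContDiffAt ℝ N (fun y => A y i j) x) → ContDiffAt ℝ N (fun y => (A y).det) x := by
    intro A hA
    simp only [Matrix.det_apply]
    refine ContDiffAt.sum fun σ _ => ?_
    exact (contDiffAt_prod fun k _ => hA (σ k) k).const_smul _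
  have hadj : ContDiffAt ℝ N (fun y => (g y).adjugate i j) x := by
    simp only [Matrix.adjugate_apply]
    refine hdetC fun k l => ?_
    by_cases hk : k = j
    · subst hk
      simpa [Matrix.updateRow_apply] using contDiffAt_const
    · simpa [Matrix.updateRow_apply, hk] using hg k l
  simp only [Matrix.inv_def, Ring.inverse_eq_inv', Matrix.smul_apply, smul_eq_mul]
  exact ((hdetC hg).inv hdet).mul hadj

end Bilinear

/-! ### The spray of a homogeneous Lagrangian -/

section Horizontal

variable {n : ℕ}

/-- The tensor `½ ∂²L/∂yⁱ∂yʲ`. -/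
noncomputable def hessTensor (L : Coord n → Coord n → ℝ) (x y : Coord n) :
    Matrix (Fin n) (Fin n) ℝ :=
  Matrix.of fun i j => (1 / 2) * pd i (fun y' => pd j (L x) y') y

/-- The covector `yˡ ∂²L/∂xˡ∂yᵏ - ∂L/∂xᵏ`. -/
noncomputable def sprayCovector (L : Coord n → Coord n → ℝ) (x y : Coord n) (k : Fin n) : ℝ :=
  (∑ l, y l * pd l (fun x' => pd k (L x') y) x) - pd k (fun x' => L x' y) x

/-- The vector `gⁱᵏ (yˡ ∂²L/∂xˡ∂yᵏ - ∂L/∂xᵏ)`. -/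
noncomputable def sprayVector (L : Coord n → Coord n → ℝ) (x y : Coord n) (i : Fin n) : ℝ :=
  ∑ k, (hessTensor L x y)⁻¹ i k * sprayCovector L x y k

variable {L : Coord n → Coord n → ℝ} {Ω : Set (Coord n × Coord n)}

theorem eventually_mem_right (hΩ : IsOpen Ω) {x y : Coord n} (hp : (x, y) ∈ Ω) :
    ∀ᶠ y' in 𝓝 y, (x, y') ∈ Ω :=
  (by fun_prop : Continuous fun y' : Coord n => (x, y')).continuousAt.eventually
    (hΩ.mem_nhds hp)

theorem eventually_mem_left (hΩ : IsOpen Ω) {x y : Coord n} (hp : (x, y) ∈ Ω) :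
    ∀ᶠ x' in 𝓝 x, (x', y) ∈ Ω :=
  (by fun_prop : Continuous fun x' : Coord n => (x', y)).continuousAt.eventually
    (hΩ.mem_nhds hp)

theorem pd_right {f : Coord n × Coord n → ℝ} {x y : Coord n} (hf : DifferentiableAt ℝ f (x, y))
    (k : Fin n) : pd k (fun y' => f (x, y')) y =
      fderiv ℝ f (x, y) (0, EuclideanSpace.single k 1) := by
  have := hf.hasFDerivAt.comp y (hasFDerivAt_prodMk_right x y)
  exact congrArg (fun L => L (EuclideanSpace.single k 1)) this.fderiv

theorem pd_left {f : Coord n × Coord n → ℝ} {x y : Coord n} (hf : DifferentiableAt ℝ f (x, y))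
    (k : Fin n) : pd k (fun x' => f (x', y)) x =
      fderiv ℝ f (x, y) (EuclideanSpace.single k 1, 0) := by
  have := HasFDerivAt.comp (f := fun x' => (x', y)) x hf.hasFDerivAt (hasFDerivAt_prodMk_left x y)
  exact congrArg (fun L => L (EuclideanSpace.single k 1)) this.fderiv

theorem contDiffAt_fderiv_uncurry {p : Coord n × Coord n}
    (hL : ContDiffAt ℝ ∞ (Function.uncurry L) p) :
    ContDiffAt ℝ ∞ (fderiv ℝ (Function.uncurry L)) p :=
  hL.fderiv_right (by simp)

theorem fderiv_fderiv_comm {f : Coord n × Coord n → ℝ} {p : Coord n × Coord n}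
    (hf : ContDiffAt ℝ ∞ f p) (v w : Coord n × Coord n) :
    fderiv ℝ (fderiv ℝ f) p v w = fderiv ℝ (fderiv ℝ f) p w v :=
  (hf.isSymmSndFDerivAt (by
    rw [minSmoothness_of_isRCLikeNormedField]
    exact WithTop.coe_le_coe.2 (le_top (a := (2 : ℕ∞))))) v w

theorem fderiv_fderiv_apply {f : Coord n × Coord n → ℝ} {p : Coord n × Coord n}
    (hf : ContDiffAt ℝ ∞ f p) (v w : Coord n × Coord n) :
    fderiv ℝ (fun q => fderiv ℝ f q w) p v = fderiv ℝ (fderiv ℝ f) p v w := by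
  have h1 : DifferentiableAt ℝ (fderiv ℝ f) p :=
    (hf.fderiv_right (m := ∞) (by simp)).differentiableAt (by simp)
  rw [fderiv_clm_apply h1 (differentiableAt_const _)]
  simp

/-- Iterated partial derivatives are replaced by the second Fréchet derivative on the product, where
symmetry and the chain rule are at hand. -/
theorem hessTensor_eq (hΩ : IsOpen Ω) (hL : ∀ p ∈ Ω, ContDiffAt ℝ ∞ (Function.uncurry L) p)
    {x y : Coord n} (hp : (x, y) ∈ Ω) (i j : Fin n) :
    hessTensor L x y i j = (1 / 2) * fderiv ℝ (fderiv ℝ (Function.uncurry L)) (x, y)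
      (0, EuclideanSpace.single i 1) (0, EuclideanSpace.single j 1) := by
  have h1 : (fun y' => pd j (L x) y') =ᶠ[𝓝 y]
      fun y' => fderiv ℝ (Function.uncurry L) (x, y') (0, EuclideanSpace.single j 1) := by
    filter_upwards [eventually_mem_right hΩ hp] with y' hy'
    exact pd_right ((hL _ hy').differentiableAt (by simp)) j
  have h2 : DifferentiableAt ℝ
      (fun q => fderiv ℝ (Function.uncurry L) q (0, EuclideanSpace.single j 1)) (x, y) :=
    ((contDiffAt_fderiv_uncurry (hL _ hp)).clm_apply contDiffAt_const).differentiableAt (by simp)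
  rw [hessTensor, Matrix.of_apply, h1.pd_eq, pd_right h2, fderiv_fderiv_apply (hL _ hp)]

theorem sprayCovector_eq (hΩ : IsOpen Ω) (hL : ∀ p ∈ Ω, ContDiffAt ℝ ∞ (Function.uncurry L) p)
    {x y : Coord n} (hp : (x, y) ∈ Ω) (k : Fin n) :
    sprayCovector L x y k = fderiv ℝ (fderiv ℝ (Function.uncurry L)) (x, y)
      (y, 0) (0, EuclideanSpace.single k 1) -
      fderiv ℝ (Function.uncurry L) (x, y) (EuclideanSpace.single k 1, 0) := by
  have h1 : (fun x' => pd k (L x') y) =ᶠ[𝓝 x]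
      fun x' => fderiv ℝ (Function.uncurry L) (x', y) (0, EuclideanSpace.single k 1) := by
    filter_upwards [eventually_mem_left hΩ hp] with x' hx'
    exact pd_right ((hL _ hx').differentiableAt (by simp)) k
  have h2 : DifferentiableAt ℝ
      (fun q => fderiv ℝ (Function.uncurry L) q (0, EuclideanSpace.single k 1)) (x, y) :=
    ((contDiffAt_fderiv_uncurry (hL _ hp)).clm_apply contDiffAt_const).differentiableAt (by simp)
  have h3 : pd k (fun x' => L x' y) x =
      fderiv ℝ (Function.uncurry L) (x, y) (EuclideanSpace.single k 1, 0) :=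
    pd_left (f := Function.uncurry L) ((hL _ hp).differentiableAt (by simp)) k
  rw [sprayCovector, h3]
  congr 1
  have h4 : ∀ l, pd l (fun x' => pd k (L x') y) x =
      fderiv ℝ (fderiv ℝ (Function.uncurry L)) (x, y) (EuclideanSpace.single l 1, 0)
        (0, EuclideanSpace.single k 1) := fun l => by
    rw [h1.pd_eq, pd_left h2, fderiv_fderiv_apply (hL _ hp)]
  simp only [h4]
  have h5 : ((y, (0 : Coord n)) : Coord n × Coord n) =
      ∑ l, y l • (EuclideanSpace.single l (1 : ℝ), (0 : Coord n)) := by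
    refine Prod.ext ?_ ?_
    · rw [Prod.fst_sum]
      exact coord_eq_sum y
    · simp [Prod.snd_sum]
  conv_rhs => rw [h5]
  simp only [map_sum, sum_apply, map_smul, smul_apply, smul_eq_mul]

/-- The derivatives of a function that is homogeneous of degree two in the fibre variable. -/
theorem fderiv_scale (hΩ : IsOpen Ω) (hL : ∀ p ∈ Ω, ContDiffAt ℝ ∞ (Function.uncurry L) p)
    {c : ℝ} (hcone : ∀ p ∈ Ω, (p.1, c • p.2) ∈ Ω)
    (hhom : ∀ p ∈ Ω, L p.1 (c • p.2) = c ^ 2 * L p.1 p.2) {x y : Coord n} (hp : (x, y) ∈ Ω) :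
    (∀ v w, fderiv ℝ (Function.uncurry L) (x, c • y) (v, c • w) =
      c ^ 2 * fderiv ℝ (Function.uncurry L) (x, y) (v, w)) ∧
    ∀ v w v' w', fderiv ℝ (fderiv ℝ (Function.uncurry L)) (x, c • y) (v, c • w) (v', c • w') =
      c ^ 2 * fderiv ℝ (fderiv ℝ (Function.uncurry L)) (x, y) (v, w) (v', w') := by
  -- Both formulas come from differentiating `L ∘ T = c² L`, once and twice, for the fibre scaling
  -- `T`.
  let T : Coord n × Coord n →L[ℝ] Coord n × Coord n :=
    (ContinuousLinearMap.fst ℝ _ _).prod (c • ContinuousLinearMap.snd ℝ _ _)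
  have hT : ∀ p : Coord n × Coord n, T p = (p.1, c • p.2) := fun _ => rfl
  have h1 : ∀ p ∈ Ω, ∀ v, fderiv ℝ (Function.uncurry L) (T p) (T v) =
      c ^ 2 * fderiv ℝ (Function.uncurry L) p v := by
    intro p hp v
    have hev : (Function.uncurry L ∘ T) =ᶠ[𝓝 p] fun q => c ^ 2 * Function.uncurry L q := by
      filter_upwards [hΩ.mem_nhds hp] with q hq using hhom q hq
    have h2 := hev.fderiv_eq (𝕜 := ℝ)
    rw [fderiv_comp (f := T) p ((hL (T p) (hcone p hp)).differentiableAt (by simp)) T.differentiableAt,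
      T.fderiv, fderiv_const_mul ((hL p hp).differentiableAt (by simp))] at h2
    exact congrArg (fun L => L v) h2
  refine ⟨fun v w => h1 (x, y) hp (v, w), fun v w v' w' => ?_⟩
  have hev : (fun q => fderiv ℝ (Function.uncurry L) (T q) (T (v', w'))) =ᶠ[𝓝 (x, y)]
      fun q => c ^ 2 * fderiv ℝ (Function.uncurry L) q (v', w') := by
    filter_upwards [hΩ.mem_nhds hp] with q hq using h1 q hq _
  have h2 := congrArg (fun A : _ →L[ℝ] ℝ => A (v, w)) hev.fderiv_eq
  have hd : ∀ p ∈ Ω, ∀ u, DifferentiableAt ℝ (fun q => fderiv ℝ (Function.uncurry L) q u) p :=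
    fun p hp u => ((contDiffAt_fderiv_uncurry (hL _ hp)).clm_apply
      contDiffAt_const).differentiableAt (by simp)
  have h3 : fderiv ℝ (fun q => fderiv ℝ (Function.uncurry L) (T q) (T (v', w'))) (x, y) =
      (fderiv ℝ (fun q => fderiv ℝ (Function.uncurry L) q (T (v', w'))) (T (x, y))).comp T := by
    have := fderiv_comp (x, y) (hd _ (hcone _ hp) (T (v', w'))) T.differentiableAt
    rwa [T.fderiv] at this
  rw [h3, fderiv_const_mul (hd _ hp _)] at h2
  simp only [ContinuousLinearMap.comp_apply, smul_apply, smul_eq_mul] at h2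
  rw [fderiv_fderiv_apply (hL _ hp), fderiv_fderiv_apply (hL (T (x, y)) (hcone _ hp))] at h2
  exact h2

/-- The fibre Hessian is homogeneous of degree zero and the spray covector of degree two. -/
theorem sprayVector_scale (hΩ : IsOpen Ω) (hL : ∀ p ∈ Ω, ContDiffAt ℝ ∞ (Function.uncurry L) p)
    {c : ℝ} (hc : 0 < c) (hcone : ∀ p ∈ Ω, (p.1, c • p.2) ∈ Ω)
    (hhom : ∀ p ∈ Ω, L p.1 (c • p.2) = c ^ 2 * L p.1 p.2) {x y : Coord n} (hp : (x, y) ∈ Ω)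
    (i : Fin n) : sprayVector L x (c • y) i = c ^ 2 * sprayVector L x y i := by
  obtain ⟨h1, h2⟩ := fderiv_scale hΩ hL hcone hhom hp
  have hc' : c ≠ 0 := hc.ne'
  have hg : hessTensor L x (c • y) = hessTensor L x y := by
    ext i j
    have := h2 0 (EuclideanSpace.single i 1) 0 (EuclideanSpace.single j 1)
    rw [show ((0 : Coord n), c • EuclideanSpace.single i (1 : ℝ)) =
      c • ((0 : Coord n), EuclideanSpace.single i (1 : ℝ)) by simp,
      show ((0 : Coord n), c • EuclideanSpace.single j (1 : ℝ)) =
      c • ((0 : Coord n), EuclideanSpace.single j (1 : ℝ)) by simp] at this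
    simp only [map_smul, smul_apply, smul_eq_mul] at this
    rw [hessTensor_eq hΩ hL (hcone _ hp), hessTensor_eq hΩ hL hp]
    congr 1
    refine mul_left_cancel₀ (pow_ne_zero 2 hc') ?_
    linarith
  have he : ∀ k, sprayCovector L x (c • y) k = c ^ 2 * sprayCovector L x y k := by
    intro k
    rw [sprayCovector_eq hΩ hL (hcone _ hp), sprayCovector_eq hΩ hL hp, mul_sub]
    congr 1
    · have := h2 y 0 0 (EuclideanSpace.single k 1)
      rw [show ((0 : Coord n), c • EuclideanSpace.single k (1 : ℝ)) =
        c • ((0 : Coord n), EuclideanSpace.single k (1 : ℝ)) by simp, smul_zero] at this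
      rw [show ((c • y, (0 : Coord n)) : Coord n × Coord n) = c • (y, 0) by simp]
      simp only [map_smul, smul_apply, smul_eq_mul] at this ⊢
      exact this
    · simpa using h1 (EuclideanSpace.single k 1) 0
  simp only [sprayVector, hg, he, Finset.mul_sum]
  exact Finset.sum_congr rfl fun k _ => by ring

theorem sprayVector_differentiableAt (hΩ : IsOpen Ω)
    (hL : ∀ p ∈ Ω, ContDiffAt ℝ ∞ (Function.uncurry L) p) {x y : Coord n} (hp : (x, y) ∈ Ω)
    (hdet : (hessTensor L x y).det ≠ 0) (i : Fin n) :
    DifferentiableAt ℝ (fun y' => sprayVector L x y' i) y := by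
  have hpr : ContDiffAt ℝ ∞ (fun y' : Coord n => (x, y')) y := by fun_prop
  have hD : ContDiffAt ℝ ∞ (fun y' => fderiv ℝ (Function.uncurry L) (x, y')) y :=
    (contDiffAt_fderiv_uncurry (hL _ hp)).comp y hpr
  have hDD : ContDiffAt ℝ ∞ (fun y' => fderiv ℝ (fderiv ℝ (Function.uncurry L)) (x, y')) y :=
    ((contDiffAt_fderiv_uncurry (hL _ hp)).fderiv_right (m := ∞) (by simp)).comp y hpr
  have hg : ∀ i j, ContDiffAt ℝ ∞ (fun y' => hessTensor L x y' i j) y := by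
    intro i j
    have h1 : ContDiffAt ℝ ∞ (fun y' => (1 / 2) *
        fderiv ℝ (fderiv ℝ (Function.uncurry L)) (x, y')
        (0, EuclideanSpace.single i 1) (0, EuclideanSpace.single j 1)) y :=
      contDiffAt_const.mul ((hDD.clm_apply contDiffAt_const).clm_apply contDiffAt_const)
    refine h1.congr_of_eventuallyEq ?_
    filter_upwards [eventually_mem_right hΩ hp] with y' hy' using hessTensor_eq hΩ hL hy' i j
  have he : ∀ k, ContDiffAt ℝ ∞ (fun y' => sprayCovector L x y' k) y := by
    intro k
    have h1 : ContDiffAt ℝ ∞ (fun y' => fderiv ℝ (fderiv ℝ (Function.uncurry L)) (x, y')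
        (y', 0) (0, EuclideanSpace.single k 1) -
        fderiv ℝ (Function.uncurry L) (x, y') (EuclideanSpace.single k 1, 0)) y :=
      ((hDD.clm_apply (contDiffAt_id.prodMk contDiffAt_const)).clm_apply contDiffAt_const).sub
        (hD.clm_apply contDiffAt_const)
    refine h1.congr_of_eventuallyEq ?_
    filter_upwards [eventually_mem_right hΩ hp] with y' hy' using sprayCovector_eq hΩ hL hy' k
  have : ContDiffAt ℝ ∞ (fun y' => sprayVector L x y' i) y :=
    ContDiffAt.sum fun k _ => (contDiffAt_matrix_inv hg hdet i k).mul (he k)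
  exact this.differentiableAt (by simp)

/-- Euler's relation for a function with `φ (c y) = c² φ y`. -/
theorem euler_of_scale {φ : Coord n → ℝ} {y : Coord n} (hφ : DifferentiableAt ℝ φ y)
    (hscale : ∀ c : ℝ, 0 < c → φ (c • y) = c ^ 2 * φ y) : fderiv ℝ φ y y = 2 * φ y := by
  have hline : HasDerivAt (fun c : ℝ => c • y) y 1 := by
    simpa using (hasDerivAt_id (1 : ℝ)).smul_const y
  have h0 : HasFDerivAt φ (fderiv ℝ φ y) ((1 : ℝ) • y) := by
    rw [one_smul]
    exact hφ.hasFDerivAt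
  have h1 : HasDerivAt (fun c : ℝ => φ (c • y)) (fderiv ℝ φ y y) 1 :=
    h0.comp_hasDerivAt (1 : ℝ) hline
  have h2 : HasDerivAt (fun c : ℝ => c ^ 2 * φ y) (2 * φ y) 1 := by
    simpa using (hasDerivAt_pow 2 (1 : ℝ)).mul_const (φ y)
  refine h1.unique (h2.congr_of_eventuallyEq ?_)
  filter_upwards [lt_mem_nhds (zero_lt_one (α := ℝ))] with c hc using hscale c hc

theorem eq_zero_of_linear_eq_zero_on_open {U : Set (Coord n)} (hU : IsOpen U) (hne : U.Nonempty)
    {ℓ : Fin n → ℝ} (h : ∀ y ∈ U, ∑ k, ℓ k * y k = 0) (k : Fin n) : ℓ k = 0 := by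
  obtain ⟨y, hy⟩ := hne
  have hev : (fun y : Coord n => ∑ k, ℓ k * y k) =ᶠ[𝓝 y] fun _ => 0 := by
    filter_upwards [hU.mem_nhds hy] with z hz using h z hz
  let T : Coord n →L[ℝ] ℝ := ∑ k, ℓ k • coordProj k
  have hT : ∀ z, T z = ∑ k, ℓ k * z k := fun z => by simp [T, sum_apply]
  have h1 : (T : Coord n → ℝ) =ᶠ[𝓝 y] fun _ => 0 := by
    filter_upwards [hev] with z hz
    rw [hT]
    exact hz
  have h2 := h1.fderiv_eq (𝕜 := ℝ)
  rw [T.fderiv, fderiv_fun_const] at h2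
  have h3 := congrArg (fun A : Coord n →L[ℝ] ℝ => A (EuclideanSpace.single k 1)) h2
  simp only [hT] at h3
  simpa using h3

end Horizontal

/-! ### Berwald type implies horizontal constancy -/

section Horizontal

variable {n : ℕ} {L : Coord n → Coord n → ℝ} {Ω : Set (Coord n × Coord n)}

theorem euler_of_homogeneous (hL : ∀ p ∈ Ω, ContDiffAt ℝ ∞ (Function.uncurry L) p)
    (hhom : ∀ p ∈ Ω, ∀ c : ℝ, 0 < c → L p.1 (c • p.2) = c ^ 2 * L p.1 p.2)
    {p : Coord n × Coord n} (hp : p ∈ Ω) :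
    fderiv ℝ (Function.uncurry L) p (0, p.2) = 2 * Function.uncurry L p := by
  obtain ⟨x, y⟩ := p
  have hd := ((hL _ hp).differentiableAt (by simp)).hasFDerivAt.comp y
    (hasFDerivAt_prodMk_right x y)
  have h1 := euler_of_scale (φ := L x) hd.differentiableAt (hhom _ hp)
  have h2 : fderiv ℝ (L x) y = _ := hd.fderiv
  rw [h2] at h1
  exact h1

/-- The derivative of Euler's relation. -/
theorem euler_second (hΩ : IsOpen Ω) (hL : ∀ p ∈ Ω, ContDiffAt ℝ ∞ (Function.uncurry L) p)
    (hhom : ∀ p ∈ Ω, ∀ c : ℝ, 0 < c → L p.1 (c • p.2) = c ^ 2 * L p.1 p.2)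
    {x y : Coord n} (hp : (x, y) ∈ Ω) (v w : Coord n) :
    fderiv ℝ (fderiv ℝ (Function.uncurry L)) (x, y) (v, w) (0, y) +
      fderiv ℝ (Function.uncurry L) (x, y) (0, w) =
      2 * fderiv ℝ (Function.uncurry L) (x, y) (v, w) := by
  have hev : (fun p : Coord n × Coord n => fderiv ℝ (Function.uncurry L) p (0, p.2)) =ᶠ[𝓝 (x, y)]
      fun p => 2 * Function.uncurry L p := by
    filter_upwards [hΩ.mem_nhds hp] with p hp using euler_of_homogeneous hL hhom hp
  have h1 := congrArg (fun A : _ →L[ℝ] ℝ => A (v, w)) (hev.fderiv_eq (𝕜 := ℝ))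
  have hd := ((contDiffAt_fderiv_uncurry (hL _ hp)).differentiableAt (by simp))
  have hproj : HasFDerivAt (fun p : Coord n × Coord n => ((0 : Coord n), p.2))
      ((0 : Coord n × Coord n →L[ℝ] Coord n).prod (ContinuousLinearMap.snd ℝ _ _)) (x, y) :=
    (hasFDerivAt_const _ _).prodMk hasFDerivAt_snd
  rw [fderiv_const_mul ((hL _ hp).differentiableAt (by simp)),
    (hd.hasFDerivAt.clm_apply hproj).fderiv] at h1
  simpa [add_comm] using h1

/-- If the Cartan nonlinear connection is linear in the fibre variable, then its coefficients are
symmetric and the function is horizontally constant. -/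
theorem horizontally_constant (hΩ : IsOpen Ω)
    (hL : ∀ p ∈ Ω, ContDiffAt ℝ ∞ (Function.uncurry L) p)
    (hcone : ∀ p ∈ Ω, ∀ c : ℝ, 0 < c → (p.1, c • p.2) ∈ Ω)
    (hhom : ∀ p ∈ Ω, ∀ c : ℝ, 0 < c → L p.1 (c • p.2) = c ^ 2 * L p.1 p.2)
    (hdet : ∀ p ∈ Ω, (hessTensor L p.1 p.2).det ≠ 0) {x : Coord n} (hne : ∃ y, (x, y) ∈ Ω)
    {Γ : Fin n → Fin n → Fin n → ℝ}
    (hlin : ∀ y, (x, y) ∈ Ω → ∀ i j,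
      (1 / 4) * pd j (fun y' => sprayVector L x y' i) y = ∑ k, Γ i j k * y k) :
    (∀ i j k, Γ i j k = Γ i k j) ∧ ∀ y, (x, y) ∈ Ω → ∀ v,
      fderiv ℝ (Function.uncurry L) (x, y) (v, 0) =
        fderiv ℝ (Function.uncurry L) (x, y) (0, connBilin Γ v y) := by
  set U : Set (Coord n) := {y | (x, y) ∈ Ω} with hU
  have hUo : IsOpen U := hΩ.preimage (by fun_prop : Continuous fun y : Coord n => (x, y))
  -- Contract the linear formula for `∂ⱼSⁱ` with `yʲ`: Euler's relation turns the left side into `2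
  -- Sⁱ`, and the right side is `4 Γ(y,y)ⁱ`.
  have hS : ∀ y ∈ U, ∀ i, sprayVector L x y i = 2 * connBilin Γ y y i := by
    intro y hy i
    have h1 := euler_of_scale (sprayVector_differentiableAt hΩ hL hy (hdet _ hy) i)
      (fun c hc => sprayVector_scale hΩ hL hc (fun p hp => hcone p hp c hc)
        (fun p hp => hhom p hp c hc) hy i)
    rw [fderiv_eq_sum_pd] at h1
    have h2 : ∀ j, pd j (fun y' => sprayVector L x y' i) y = 4 * ∑ k, Γ i j k * y k := by
      intro j
      rw [← hlin y hy]
      ring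
    simp only [h2] at h1
    have h3 : ∑ j, y j * (4 * ∑ k, Γ i j k * y k) = 4 * connBilin Γ y y i := by
      rw [connBilin_apply, Finset.mul_sum]
      refine Finset.sum_congr rfl fun j _ => ?_
      rw [Finset.mul_sum, Finset.mul_sum, Finset.mul_sum]
      exact Finset.sum_congr rfl fun k _ => by ring
    linarith
  -- Differentiating `S = 2 Γ(y,y)` again produces the symmetrized coefficients. Comparison with the
  -- given linear formula shows that `Γ(eⱼ,y)` and `Γ(y,eⱼ)` agree on an open set of `y`.
  have hsymm : ∀ i j k, Γ i j k = Γ i k j := by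
    intro i j k
    rw [← sub_eq_zero]
    refine eq_zero_of_linear_eq_zero_on_open hUo hne (ℓ := fun k => Γ i j k - Γ i k j) ?_ k
    intro y hy
    have hev : (fun y' => sprayVector L x y' i) =ᶠ[𝓝 y] fun y' => 2 * connBilin Γ y' y' i := by
      filter_upwards [hUo.mem_nhds hy] with y' hy' using hS y' hy' i
    have hder : HasFDerivAt (fun y' => connBilin Γ y' y') (connBilin Γ y + (connBilin Γ).flip y)
        y := by
      have := (connBilin Γ).hasFDerivAt_of_bilinear (hasFDerivAt_id y) (hasFDerivAt_id y)
      refine this.congr_fderiv ?_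
      ext w
      simp
    have h1 : pd j (fun y' => sprayVector L x y' i) y =
        2 * (connBilin Γ y (EuclideanSpace.single j 1) i +
          connBilin Γ (EuclideanSpace.single j 1) y i) := by
      rw [hev.pd_eq]
      have h2 : HasFDerivAt (fun y' => 2 * connBilin Γ y' y' i)
          ((2 : ℝ) • (coordProj i).comp (connBilin Γ y + (connBilin Γ).flip y)) y :=
        ((coordProj i).hasFDerivAt.comp y hder).const_mul 2
      rw [pd, h2.fderiv]
      simp [mul_add]
    have h2 := hlin y hy i j
    rw [h1, connBilin_apply, connBilin_apply] at h2
    simp only [PiLp.single_apply, mul_ite, ite_mul, mul_one, mul_zero, zero_mul,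
      Finset.sum_ite_eq', Finset.mem_univ, if_true, Finset.sum_ite_irrel,
      Finset.sum_const_zero] at h2
    simp only [sub_mul, Finset.sum_sub_distrib]
    linarith
  refine ⟨hsymm, ?_⟩
  -- This is the formula for the spray with its index lowered; the `½` in the Hessian tensor cancels
  -- the `2` in `S = 2 Γ(y,y)`.
  have hE : ∀ y ∈ U, ∀ v, fderiv ℝ (fderiv ℝ (Function.uncurry L)) (x, y) (y, 0) (0, v) -
      fderiv ℝ (Function.uncurry L) (x, y) (v, 0) =
      fderiv ℝ (fderiv ℝ (Function.uncurry L)) (x, y) (0, connBilin Γ y y) (0, v) := by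
    intro y hy
    have hbasis : ∀ k, fderiv ℝ (fderiv ℝ (Function.uncurry L)) (x, y) (y, 0)
        (0, EuclideanSpace.single k 1) -
        fderiv ℝ (Function.uncurry L) (x, y) (EuclideanSpace.single k 1, 0) =
        fderiv ℝ (fderiv ℝ (Function.uncurry L)) (x, y) (0, connBilin Γ y y)
          (0, EuclideanSpace.single k 1) := by
      intro k
      rw [← sprayCovector_eq hΩ hL hy]
      have h1 : (hessTensor L x y).mulVec (sprayVector L x y) = sprayCovector L x y := by
        have : sprayVector L x y = (hessTensor L x y)⁻¹.mulVec (sprayCovector L x y) := rfl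
        rw [this, Matrix.mulVec_mulVec, Matrix.mul_nonsing_inv _ (hdet _ hy).isUnit,
          Matrix.one_mulVec]
      have h2 : ((0 : Coord n), connBilin Γ y y) =
          ∑ i, connBilin Γ y y i • ((0 : Coord n), EuclideanSpace.single i (1 : ℝ)) := by
        refine Prod.ext ?_ ?_
        · simp [Prod.fst_sum]
        · rw [Prod.snd_sum]
          exact coord_eq_sum _
      rw [← congrFun h1 k, h2]
      simp only [Matrix.mulVec, dotProduct, map_sum, sum_apply, map_smul, smul_apply, smul_eq_mul]
      refine Finset.sum_congr rfl fun i _ => ?_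
      rw [hessTensor_eq hΩ hL hy, hS y hy, fderiv_fderiv_comm (hL _ hy)]
      ring
    let A : Coord n →L[ℝ] ℝ :=
      (fderiv ℝ (fderiv ℝ (Function.uncurry L)) (x, y) (y, 0)).comp (.inr ℝ _ _) -
      (fderiv ℝ (Function.uncurry L) (x, y)).comp (.inl ℝ _ _) -
      (fderiv ℝ (fderiv ℝ (Function.uncurry L)) (x, y) (0, connBilin Γ y y)).comp (.inr ℝ _ _)
    have hA : A = 0 := by
      refine ContinuousLinearMap.coe_injective
        ((EuclideanSpace.basisFun (Fin n) ℝ).toBasis.ext fun k => ?_)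
      have := hbasis k
      simpa [A, sub_eq_zero] using this
    intro v
    have := congrArg (fun A : Coord n →L[ℝ] ℝ => A v) hA
    simpa [A, sub_eq_zero] using this
  -- Taking `v = y` and reducing both second derivatives by Euler's relation shows that `L` is
  -- constant along its spray.
  have hH : ∀ y ∈ U, fderiv ℝ (Function.uncurry L) (x, y) (y, -connBilin Γ y y) = 0 := by
    intro y hy
    have h1 := hE y hy y
    have h2 := euler_second hΩ hL hhom hy y 0
    have h3 := euler_second hΩ hL hhom hy 0 (connBilin Γ y y)
    have h4 : fderiv ℝ (Function.uncurry L) (x, y) (y, -connBilin Γ y y) =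
        fderiv ℝ (Function.uncurry L) (x, y) (y, 0) -
        fderiv ℝ (Function.uncurry L) (x, y) (0, connBilin Γ y y) := by
      rw [← map_sub]
      simp
    have h5 : fderiv ℝ (Function.uncurry L) (x, y) ((0 : Coord n), (0 : Coord n)) = 0 :=
      map_zero _
    rw [h4]
    linarith
  intro y hy v
  -- Differentiate the constancy along the spray in the fibre direction `v`. The second-order terms
  -- are `∂ₓL(v)` by `hE`, so twice the claim remains.
  have hev : (fun y' => fderiv ℝ (Function.uncurry L) (x, y') (y', -connBilin Γ y' y')) =ᶠ[𝓝 y]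
      fun _ => 0 := by
    filter_upwards [hUo.mem_nhds hy] with y' hy' using hH y' hy'
  have hder : HasFDerivAt (fun y' => connBilin Γ y' y') (connBilin Γ y + (connBilin Γ).flip y)
      y := by
    have := (connBilin Γ).hasFDerivAt_of_bilinear (hasFDerivAt_id y) (hasFDerivAt_id y)
    refine this.congr_fderiv ?_
    ext w
    simp
  have hD := ((contDiffAt_fderiv_uncurry (hL _ hy)).differentiableAt (by simp)).hasFDerivAt.comp y
    (hasFDerivAt_prodMk_right x y)
  have htot := (hD.clm_apply ((hasFDerivAt_id y).prodMk hder.neg)).fderiv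
  have h1 := congrArg (fun A : Coord n →L[ℝ] ℝ => A v) (htot.symm.trans (hev.fderiv_eq (𝕜 := ℝ)))
  have h2 := hE y hy v
  simp only [fderiv_fun_const, Pi.zero_apply, zero_apply, add_apply,
    ContinuousLinearMap.comp_apply, ContinuousLinearMap.flip_apply, ContinuousLinearMap.prod_apply,
    ContinuousLinearMap.inr_apply, neg_apply, Pi.neg_apply, Function.comp_apply, id_eq,
    ContinuousLinearMap.id_apply] at h1
  rw [connBilin_symm hsymm y v] at h1
  have h3 : ((v, -(connBilin Γ v y + connBilin Γ v y)) : Coord n × Coord n) =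
      (v, 0) - (2 : ℝ) • ((0 : Coord n), connBilin Γ v y) := by
    simp [two_smul]
  have h4 : ((y, -connBilin Γ y y) : Coord n × Coord n) = (y, 0) - (0, connBilin Γ y y) := by simp
  rw [h3, h4, map_sub, map_sub, map_smul, smul_eq_mul,
    fderiv_fderiv_comm (hL _ hy) (0, v) (y, 0),
    fderiv_fderiv_comm (hL _ hy) (0, v) (0, connBilin Γ y y)] at h1
  linarith

end Horizontal

/-! ### Tensors in charts and their change of coordinates -/

section Charts

variable {n : ℕ} {M : Type*} [TopologicalSpace M] [ChartedSpace (Coord n) M]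

/-- The metric in a chart, as a bilinear form on the coordinate space. -/
noncomputable def metricForm (a : TwoTensor n M) (e : OpenPartialHomeomorph M (Coord n))
    (x : Coord n) : Coord n →L[ℝ] Coord n →L[ℝ] ℝ :=
  ∑ i, ∑ j, comp2 a e i j x • (coordProj i).smulRight (coordProj j)

/-- The 1-form in a chart, as a linear form on the coordinate space. -/
noncomputable def linForm (b : OneForm n M) (e : OpenPartialHomeomorph M (Coord n))
    (x : Coord n) : Coord n →L[ℝ] ℝ :=
  ∑ i, comp1 b e i x • coordProj i

/-- The map `y ↦ yⁱ ∂ᵢ` as a continuous linear map. -/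
noncomputable def coordMap (e : OpenPartialHomeomorph M (Coord n)) (x : Coord n) :
    Coord n →L[ℝ] TangentSpace (𝓡 n) (e.symm x) :=
  mfderiv (𝓡 n) (𝓡 n) e.symm x

theorem coordVec_eq_sum (e : OpenPartialHomeomorph M (Coord n)) (x y : Coord n) :
    coordVec e x y = ∑ i, y i • coordVec e x (EuclideanSpace.single i 1) := by
  have h : coordMap e x y = ∑ i, y i • coordMap e x (EuclideanSpace.single i 1) := by
    conv_lhs => rw [coord_eq_sum y]
    rw [map_sum]
    exact Finset.sum_congr rfl fun i _ => map_smul _ _ _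
  exact h

theorem metricForm_apply (a : TwoTensor n M) (e : OpenPartialHomeomorph M (Coord n))
    (x y z : Coord n) :
    metricForm a e x y z = a (e.symm x) (coordVec e x y) (coordVec e x z) := by
  rw [coordVec_eq_sum e x y, coordVec_eq_sum e x z]
  simp only [metricForm, sum_apply, smul_apply, ContinuousLinearMap.smulRight_apply, map_sum,
    map_smul, LinearMap.sum_apply, LinearMap.smul_apply, smul_eq_mul, PiLp.proj_apply,
    Finset.mul_sum, comp2]
  rw [Finset.sum_comm]
  exact Finset.sum_congr rfl fun i _ => Finset.sum_congr rfl fun j _ => by ring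

theorem linForm_apply (b : OneForm n M) (e : OpenPartialHomeomorph M (Coord n))
    (x y : Coord n) : linForm b e x y = b (e.symm x) (coordVec e x y) := by
  rw [coordVec_eq_sum e x y]
  simp only [linForm, sum_apply, smul_apply, map_sum, map_smul, smul_eq_mul, PiLp.proj_apply,
    comp1]
  exact Finset.sum_congr rfl fun i _ => by ring

theorem metricForm_single (a : TwoTensor n M) (e : OpenPartialHomeomorph M (Coord n))
    (x : Coord n) (i j : Fin n) :
    metricForm a e x (EuclideanSpace.single i 1) (EuclideanSpace.single j 1) = comp2 a e i j x :=
  metricForm_apply a e x _ _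

theorem linForm_single (b : OneForm n M) (e : OpenPartialHomeomorph M (Coord n))
    (x : Coord n) (i : Fin n) :
    linForm b e x (EuclideanSpace.single i 1) = comp1 b e i x :=
  linForm_apply b e x _

theorem metricForm_contDiffAt {a : TwoTensor n M} {e : OpenPartialHomeomorph M (Coord n)}
    {x : Coord n} (h : ∀ i j, ContDiffAt ℝ ∞ (comp2 a e i j) x) :
    ContDiffAt ℝ ∞ (metricForm a e) x := by
  refine ContDiffAt.sum fun i _ => ContDiffAt.sum fun j _ => ?_
  exact ContDiffAt.continuousLinearMap_comp ((ContinuousLinearMap.id ℝ ℝ).smulRight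
    ((coordProj i).smulRight (coordProj (n := n) j))) (h i j)

theorem linForm_contDiffAt {b : OneForm n M} {e : OpenPartialHomeomorph M (Coord n)}
    {x : Coord n} (h : ∀ i, ContDiffAt ℝ ∞ (comp1 b e i) x) :
    ContDiffAt ℝ ∞ (linForm b e) x :=
  ContDiffAt.sum fun i _ => (h i).smul contDiffAt_const

theorem mdifferentiable_of_mem_charts {e : OpenPartialHomeomorph M (Coord n)}
    (he : e ∈ charts n M) : e.MDifferentiable (𝓡 n) (𝓡 n) :=
  ⟨(contMDiffOn_of_mem_maximalAtlas he).mdifferentiableOn (by simp),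
    (contMDiffOn_symm_of_mem_maximalAtlas he).mdifferentiableOn (by simp)⟩

theorem coordVec_bijective {e : OpenPartialHomeomorph M (Coord n)} (he : e ∈ charts n M)
    {x : Coord n} (hx : x ∈ e.target) : Function.Bijective (coordVec e x) := by
  have hm := mdifferentiable_of_mem_charts he
  exact (hm.symm.mfderiv hx).bijective

/-- Under the identification of the tangent bundle of the model space with a product, `bundlePoint
e` is the tangent map of `e.symm`, which is continuous over the target. -/
theorem isOpen_bundlePoint_preimage [IsManifold (𝓡 n) ∞ M]
    {e : OpenPartialHomeomorph M (Coord n)}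
    (he : e ∈ charts n M) {A : Set (TangentBundle (𝓡 n) M)} (hA : IsOpen A) :
    IsOpen {p : Coord n × Coord n | p.1 ∈ e.target ∧ bundlePoint e p.1 p.2 ∈ A} := by
  have : IsManifold (𝓡 n) 1 M := IsManifold.of_le (n := ∞) (by simp)
  have h1 := (contMDiffOn_symm_of_mem_maximalAtlas he).continuousOn_tangentMapWithin (by simp)
    e.open_target.uniqueMDiffOn
  have h2 : ContinuousOn (fun p : Coord n × Coord n => bundlePoint e p.1 p.2)
      (e.target ×ˢ univ) := by
    have h3 : Continuous (fun p : Coord n × Coord n =>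
        (⟨p.1, p.2⟩ : TangentBundle (𝓡 n) (Coord n))) :=
      (tangentBundleModelSpaceHomeomorph (𝓡 n)).symm.continuous
    refine (h1.comp h3.continuousOn fun p hp => hp.1).congr fun p hp => ?_
    simp only [Function.comp_apply, tangentMapWithin, bundlePoint, coordVec]
    rw [mfderivWithin_of_isOpen e.open_target hp.1]
  have h3 := h2.isOpen_inter_preimage (e.open_target.prod isOpen_univ) hA
  convert h3 using 1
  ext p
  simp

/-- The transition map between two charts. -/
theorem transition_contDiffAt {e e' : OpenPartialHomeomorph M (Coord n)} (he : e ∈ charts n M)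
    (he' : e' ∈ charts n M) {x : Coord n} (hx : x ∈ e'.target) (hx' : e'.symm x ∈ e.source) :
    ContDiffAt ℝ ∞ (fun z => e (e'.symm z)) x := by
  have h1 := (contMDiffOn_symm_of_mem_maximalAtlas he').contMDiffAt (e'.open_target.mem_nhds hx)
  have h2 := (contMDiffOn_of_mem_maximalAtlas he).contMDiffAt (e.open_source.mem_nhds hx')
  exact (h2.comp x h1).contDiffAt

/-- The chain rule. The two vectors have base points that are equal only propositionally; reading
both in `Coord n`, which is every tangent space by definition, makes the equation typecheck. -/
theorem coordVec_transition {e e' : OpenPartialHomeomorph M (Coord n)} (he : e ∈ charts n M)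
    (he' : e' ∈ charts n M) {x : Coord n} (hx : x ∈ e'.target) (hx' : e'.symm x ∈ e.source)
    (y : Coord n) : (coordVec e' x y : Coord n) =
      (coordVec e (e (e'.symm x)) (fderiv ℝ (fun z => e (e'.symm z)) x y) : Coord n) := by
  have hev : e'.symm =ᶠ[𝓝 x] e.symm ∘ fun z => e (e'.symm z) := by
    have hc : ContinuousAt e'.symm x := e'.symm.continuousAt hx
    filter_upwards [hc.eventually (e.open_source.mem_nhds hx')] with z hz
    exact (e.left_inv hz).symm
  have h1 : MDifferentiableAt (𝓡 n) (𝓡 n) e.symm (e (e'.symm x)) :=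
    (mdifferentiable_of_mem_charts he).symm.mdifferentiableAt (e.map_source hx')
  have h2 : MDifferentiableAt (𝓡 n) (𝓡 n) (fun z => e (e'.symm z)) x :=
    ((transition_contDiffAt he he' hx hx').differentiableAt (by simp)).mdifferentiableAt
  have h3 : coordMap e' x = mfderiv (𝓡 n) (𝓡 n) (e.symm ∘ fun z => e (e'.symm z)) x :=
    hev.mfderiv_eq
  have h4 : (coordMap e' x : Coord n →L[ℝ] Coord n) =
      (coordMap e (e (e'.symm x)) : Coord n →L[ℝ] Coord n).comp
        (fderiv ℝ (fun z => e (e'.symm z)) x) := by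
    refine h3.trans ((mfderiv_comp x h1 h2).trans ?_)
    rw [mfderiv_eq_fderiv]
    rfl
  exact DFunLike.congr_fun h4 y

theorem metricForm_transition (a : TwoTensor n M) {e e' : OpenPartialHomeomorph M (Coord n)}
    (he : e ∈ charts n M)
    (he' : e' ∈ charts n M) {x : Coord n} (hx : x ∈ e'.target) (hx' : e'.symm x ∈ e.source)
    (y z : Coord n) : metricForm a e' x y z = metricForm a e (e (e'.symm x))
      (fderiv ℝ (fun z => e (e'.symm z)) x y) (fderiv ℝ (fun z => e (e'.symm z)) x z) := by
  -- Moves the tensor between equal base points while its arguments stay in `Coord n`.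
  have h : ∀ (p q : M) (_ : p = q) (v w : Coord n),
      (a p : Coord n →ₗ[ℝ] Coord n →ₗ[ℝ] ℝ) v w = (a q : Coord n →ₗ[ℝ] Coord n →ₗ[ℝ] ℝ) v w := by
    rintro p q rfl v w
    rfl
  rw [metricForm_apply, metricForm_apply]
  have h1 := h (e'.symm x) (e.symm (e (e'.symm x))) (e.left_inv hx').symm
    (coordVec e' x y) (coordVec e' x z)
  rw [coordVec_transition he he' hx hx' y, coordVec_transition he he' hx hx' z] at h1
  refine Eq.trans ?_ h1
  rw [coordVec_transition he he' hx hx' y, coordVec_transition he he' hx hx' z]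

theorem linForm_transition (b : OneForm n M) {e e' : OpenPartialHomeomorph M (Coord n)}
    (he : e ∈ charts n M)
    (he' : e' ∈ charts n M) {x : Coord n} (hx : x ∈ e'.target) (hx' : e'.symm x ∈ e.source)
    (y : Coord n) : linForm b e' x y = linForm b e (e (e'.symm x))
      (fderiv ℝ (fun z => e (e'.symm z)) x y) := by
  have h : ∀ (p q : M) (_ : p = q) (v : Coord n),
      (b p : Coord n →ₗ[ℝ] ℝ) v = (b q : Coord n →ₗ[ℝ] ℝ) v := by
    rintro p q rfl v
    rfl
  rw [linForm_apply, linForm_apply]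
  change (b (e'.symm x) : Coord n →ₗ[ℝ] ℝ) (coordVec e' x y : Coord n) = _
  rw [coordVec_transition he he' hx hx' y]
  exact h _ _ (e.left_inv hx').symm _

theorem metricForm_nondegenerate {U : Set M} (ha : IsPseudoRiemannianOn a U) (he : e ∈ charts n M)
    {x : Coord n} (hx : x ∈ e.target) (hxU : e.symm x ∈ U) {v : Coord n}
    (h : ∀ w, metricForm a e x v w = 0) : v = 0 := by
  have hb := coordVec_bijective he hx
  have h0 : coordVec e x v = 0 := by
    refine ha.nondegenerate _ hxU _ fun w => ?_
    obtain ⟨w', rfl⟩ := hb.2 w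
    rw [← metricForm_apply]
    exact h w'
  refine hb.1 (h0.trans ?_)
  exact (map_zero (coordMap e x)).symm

theorem fderiv_metricForm_single {a : TwoTensor n M} {e : OpenPartialHomeomorph M (Coord n)} {x : Coord n} (h : DifferentiableAt ℝ (metricForm a e) x)
    (u : Coord n) (i j : Fin n) :
    fderiv ℝ (metricForm a e) x u (EuclideanSpace.single i 1) (EuclideanSpace.single j 1) =
      fderiv ℝ (comp2 a e i j) x u := by
  have h1 : (comp2 a e i j) = fun x =>
      metricForm a e x (EuclideanSpace.single i 1) (EuclideanSpace.single j 1) := by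
    ext x
    exact (metricForm_single a e x i j).symm
  have h2 := ((h.hasFDerivAt.clm_apply
    (hasFDerivAt_const (EuclideanSpace.single i (1 : ℝ)) x)).clm_apply
    (hasFDerivAt_const (EuclideanSpace.single j (1 : ℝ)) x)).fderiv
  rw [h1, h2]
  simp

theorem fderiv_linForm_single {b : OneForm n M} {e : OpenPartialHomeomorph M (Coord n)} {x : Coord n} (h : DifferentiableAt ℝ (linForm b e) x)
    (u : Coord n) (i : Fin n) :
    fderiv ℝ (linForm b e) x u (EuclideanSpace.single i 1) = fderiv ℝ (comp1 b e i) x u := by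
  have h1 : (comp1 b e i) = fun x => linForm b e x (EuclideanSpace.single i 1) := by
    ext x
    exact (linForm_single b e x i).symm
  have h2 := (h.hasFDerivAt.clm_apply
    (hasFDerivAt_const (EuclideanSpace.single i (1 : ℝ)) x)).fderiv
  rw [h1, h2]
  simp

theorem bundlePoint_smul (e : OpenPartialHomeomorph M (Coord n)) (x y : Coord n) (c : ℝ) :
    bundlePoint e x (c • y) =
      (⟨e.symm x, c • coordVec e x y⟩ : TangentBundle (𝓡 n) M) := by
  have : coordVec e x (c • y) = c • coordVec e x y := map_smul (coordMap e x) c y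
  rw [← this]
  rfl

end Charts

/-! ### Linear algebra of the cubic identity -/

section Algebra

variable {n : ℕ}

theorem exists_dual_vector {G : Coord n →L[ℝ] Coord n →L[ℝ] ℝ}
    (hnd : ∀ v, (∀ w, G v w = 0) → v = 0) (β : Coord n →L[ℝ] ℝ) : ∃ V, ∀ w, G V w = β w := by
  let T : Coord n →ₗ[ℝ] Module.Dual ℝ (Coord n) :=
    { toFun := fun v => (G v : Coord n →ₗ[ℝ] ℝ)
      map_add' := fun v w => by ext; simp
      map_smul' := fun c v => by ext; simp }
  have hinj : Function.Injective T := LinearMap.ker_eq_bot.1 (LinearMap.ker_eq_bot'.2 fun v hv =>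
    hnd v fun w => DFunLike.congr_fun hv w)
  have hsurj : Function.Surjective T :=
    (LinearMap.injective_iff_surjective_of_finrank_eq_finrank
      (Subspace.dual_finrank_eq (K := ℝ) (V := Coord n)).symm).1 hinj
  obtain ⟨V, hV⟩ := hsurj (β : Coord n →ₗ[ℝ] ℝ)
  exact ⟨V, fun w => DFunLike.congr_fun hV w⟩

theorem bilin_eq_zero_of_diag {n : ℕ} {r : Coord n →L[ℝ] Coord n →L[ℝ] ℝ}
    (hr : ∀ v w, r v w = r w v) {S : Submodule ℝ (Coord n)} (h : ∀ v ∈ S, r v v = 0)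
    {v w : Coord n} (hv : v ∈ S) (hw : w ∈ S) : r v w = 0 := by
  have h1 := h _ (S.add_mem hv hw)
  simp only [map_add, add_apply, h v hv, h w hw, hr w v] at h1
  linarith

/-- In dimension greater than two, no hyperplane is totally isotropic. -/
theorem exists_ker_not_isotropic (hn : 2 < n) {G : Coord n →L[ℝ] Coord n →L[ℝ] ℝ}
    (hsymm : ∀ v w, G v w = G w v) (hnd : ∀ v, (∀ w, G v w = 0) → v = 0)
    {β : Coord n →L[ℝ] ℝ} {z : Coord n} (hz : β z ≠ 0) : ∃ y, β y = 0 ∧ G y y ≠ 0 := by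
  by_contra! h
  obtain ⟨V, hV⟩ := exists_dual_vector hnd β
  -- If `ker β` is totally isotropic, then for `y` in it `G y` vanishes on `ker β` and is a multiple
  -- of `β`, so `y` is a multiple of the dual vector. A hyperplane inside a line forces `n ≤ 2`.
  have hker : (β : Coord n →ₗ[ℝ] ℝ).ker ≤ Submodule.span ℝ {V} := by
    intro y hy
    have hy' : β y = 0 := hy
    refine Submodule.mem_span_singleton.2 ⟨G y z / β z, ?_⟩
    refine (sub_eq_zero.1 (hnd _ fun w => ?_)).symm
    have h1 : G y (w - (β w / β z) • z) = 0 :=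
      bilin_eq_zero_of_diag hsymm (S := (β : Coord n →ₗ[ℝ] ℝ).ker) (fun v hv => h v hv) hy (by
        change β _ = 0
        rw [map_sub, map_smul, smul_eq_mul, div_mul_cancel₀ _ hz, sub_self])
    rw [map_sub, map_smul, smul_eq_mul, sub_eq_zero] at h1
    rw [map_sub, map_smul, sub_apply, smul_apply, hV, h1]
    simp only [smul_eq_mul]
    ring
  have h1 := (β : Coord n →ₗ[ℝ] ℝ).finrank_range_add_finrank_ker
  have h2 := Submodule.finrank_mono hker
  have hV0 : V ≠ 0 := by
    rintro rfl
    exact hz (by simpa using (hV z).symm)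
  rw [finrank_span_singleton hV0] at h2
  have h4 := Submodule.finrank_le (β : Coord n →ₗ[ℝ] ℝ).range
  simp only [Module.finrank_self, finrank_euclideanSpace, Fintype.card_fin] at h1 h4
  omega

/-- If `(1 + m) β q = 2 m G ℓ` as cubic forms, with a nondegenerate quadratic form `G`, then `ℓ` is
a multiple of `β`. -/
theorem proportional_of_cubic_eq (hn : 2 < n) {G q : Coord n →L[ℝ] Coord n →L[ℝ] ℝ}
    (hsymm : ∀ v w, G v w = G w v) (hnd : ∀ v, (∀ w, G v w = 0) → v = 0)
    (hq : ∀ v w, q v w = q w v) {β ℓ : Coord n →L[ℝ] ℝ} {z : Coord n} (hz : β z ≠ 0)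
    {s t : ℝ} (ht : t ≠ 0) {U : Set (Coord n)} (hU : IsOpen U) (hne : U.Nonempty)
    (h : ∀ y ∈ U, s * (β y * q y y) = t * (G y y * ℓ y)) :
    ∃ lam : ℝ, (∀ v, ℓ v = lam * β v) ∧ ∀ v w, s * q v w = t * lam * G v w := by
  have hall : ∀ y, s * (β y * q y y) = t * (G y y * ℓ y) := by
    have h1 : AnalyticOnNhd ℝ (fun y => s * (β y * q y y)) univ := by
      refine contDiff_omega_iff_analyticOnNhd.1 ?_
      fun_prop
    have h2 : AnalyticOnNhd ℝ (fun y => t * (G y y * ℓ y)) univ := by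
      refine contDiff_omega_iff_analyticOnNhd.1 ?_
      fun_prop
    obtain ⟨y₀, hy₀⟩ := hne
    have := h1.eq_of_eventuallyEq h2 (z₀ := y₀)
      (by filter_upwards [hU.mem_nhds hy₀] with y hy using h y hy)
    exact fun y => congrFun this y
  obtain ⟨y₀, hy₀, hG₀⟩ := exists_ker_not_isotropic hn hsymm hnd hz
  have hker : ∀ y, β y = 0 → G y y * ℓ y = 0 := by
    intro y hy
    have := hall y
    rw [hy, zero_mul, mul_zero] at this
    exact (mul_eq_zero.1 this.symm).resolve_left ht
  have hℓ₀ : ℓ y₀ = 0 := (mul_eq_zero.1 (hker y₀ hy₀)).resolve_left hG₀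
  have hℓ : ∀ y, β y = 0 → ℓ y = 0 := by
    intro y hy
    by_contra hne
    -- On the line `y + c y₀` inside `ker β` the value of `ℓ` is the nonzero constant `ℓ y`, so `G`
    -- vanishes there. Its second difference at `c = -1, 0, 1` is `2 G(y₀,y₀)`, which contradicts
    -- the choice of `y₀`.
    have key : ∀ c : ℝ, G (y + c • y₀) (y + c • y₀) = 0 := by
      intro c
      have h1 := hker (y + c • y₀) (by simp [hy, hy₀])
      refine (mul_eq_zero.1 h1).resolve_right ?_
      simpa [hℓ₀] using hne
    have h0 := key 0
    have h1 := key 1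
    have h2 := key (-1)
    simp only [map_add, map_smul, add_apply, smul_apply, smul_eq_mul] at h0 h1 h2
    apply hG₀
    linarith
  set lam := ℓ z / β z with hlam
  have hl : ∀ v, ℓ v = lam * β v := by
    intro v
    have h1 := hℓ (v - (β v / β z) • z) (by
      rw [map_sub, map_smul, smul_eq_mul, div_mul_cancel₀ _ hz, sub_self])
    rw [map_sub, map_smul, smul_eq_mul, sub_eq_zero] at h1
    rw [h1, hlam]
    ring
  refine ⟨lam, hl, ?_⟩
  let r : Coord n →L[ℝ] Coord n →L[ℝ] ℝ := s • q - (t * lam) • G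
  have hr : ∀ v w, r v w = s * q v w - t * lam * G v w := fun v w => by simp [r]
  have hr1 : ∀ v, β v ≠ 0 → r v v = 0 := by
    intro v hv
    have h1 := hall v
    rw [hl v] at h1
    rw [hr]
    refine mul_left_cancel₀ hv ?_
    linear_combination h1
  -- Off `ker β` one can divide by `β`. For `v` in the kernel, `z + c v` stays off it, and a second
  -- difference in `c` gives `r v v = 0`.
  have hr2 : ∀ v, r v v = 0 := by
    intro v
    by_cases hv : β v = 0
    · have key : ∀ c : ℝ, r (z + c • v) (z + c • v) = 0 := fun c => hr1 _ (by simpa [hv] using hz)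
      have h0 := key 0
      have h1 := key 1
      have h2 := key (-1)
      simp only [map_add, map_smul, add_apply, smul_apply, smul_eq_mul] at h0 h1 h2
      linarith
    · exact hr1 v hv
  intro v w
  have hrs : ∀ v w, r v w = r w v := fun v w => by rw [hr, hr, hq v w, hsymm v w]
  have := bilin_eq_zero_of_diag hrs (S := ⊤) (fun v _ => hr2 v) (v := v) (w := w) trivial trivial
  rw [hr] at this
  linarith

end Algebra

/-! ### The logarithm of the Kropina function in a chart -/

section LogForm

variable {n : ℕ} {M : Type*} [TopologicalSpace M] [ChartedSpace (Coord n) M]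
  [IsManifold (𝓡 n) ∞ M] {a : TwoTensor n M} {b : OneForm n M} {m : ℝ}
  {A : Set (TangentBundle (𝓡 n) M)} {F : TangentBundle (𝓡 n) M → ℝ}
  {e : OpenPartialHomeomorph M (Coord n)}

/-- The conic set `A` in the coordinates induced by the chart `e`. -/
def coordCone (A : Set (TangentBundle (𝓡 n) M)) (e : OpenPartialHomeomorph M (Coord n)) :
    Set (Coord n × Coord n) :=
  {p | p.1 ∈ e.target ∧ bundlePoint e p.1 p.2 ∈ A}

/-- The function `(1 + m) log α² - 2 m log |β|` in the coordinates induced by the chart `e`. -/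
noncomputable def logForm (a : TwoTensor n M) (b : OneForm n M) (m : ℝ)
    (e : OpenPartialHomeomorph M (Coord n)) (p : Coord n × Coord n) : ℝ :=
  (1 + m) * Real.log (metricForm a e p.1 p.2 p.2) - 2 * m * Real.log (linForm b e p.1 p.2)

theorem metricForm_pos (hF : IsKropinaSpace a b m A F) {p : Coord n × Coord n}
    (hp : p ∈ coordCone A e) : 0 < metricForm a e p.1 p.2 p.2 := by
  rw [metricForm_apply]
  exact hF.alpha_pos _ hp.2

theorem linForm_ne_zero (hF : IsKropinaSpace a b m A F) {p : Coord n × Coord n}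
    (hp : p ∈ coordCone A e) : linForm b e p.1 p.2 ≠ 0 := by
  rw [linForm_apply]
  rcases hF.beta_defined _ hp.2 with h | h
  · exact h.ne'
  · exact h.1

/-- Squaring removes the sign of `β^(-m)`, and `Real.log` ignores the sign of its argument, so one
formula covers `β > 0` as well as `β < 0` with `m` an integer. -/
theorem sqCoord_eq_exp (hF : IsKropinaSpace a b m A F) {p : Coord n × Coord n}
    (hp : p ∈ coordCone A e) :
    Function.uncurry (sqCoord F e) p = Real.exp (logForm a b m e p) := by
  obtain ⟨x, y⟩ := p
  have hQ := metricForm_pos hF hp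
  have hβ := linForm_ne_zero hF hp
  have hdef := hF.beta_defined _ hp.2
  have heq := hF.eq _ hp.2
  change F (bundlePoint e x y) ^ 2 = _
  rw [heq]
  change (Real.sqrt (a (e.symm x) (coordVec e x y) (coordVec e x y)) ^ (1 + m) *
    (b (e.symm x) (coordVec e x y)) ^ (-m)) ^ 2 = _
  change 0 < b (e.symm x) (coordVec e x y) ∨ (b (e.symm x) (coordVec e x y) ≠ 0 ∧ _) at hdef
  rw [← metricForm_apply, ← linForm_apply]
  rw [← linForm_apply] at hdef
  simp only at hQ hβ
  set Q := metricForm a e x y y with hQdef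
  set β := linForm b e x y with hβdef
  have h1 : 0 < Real.sqrt Q ^ (1 + m) := Real.rpow_pos_of_pos (Real.sqrt_pos.2 hQ) _
  have h2 : β ^ (-m) ≠ 0 ∧ Real.log (β ^ (-m)) = -m * Real.log β := by
    rcases hdef with h | ⟨h, k, hk⟩
    · exact ⟨(Real.rpow_pos_of_pos h _).ne', Real.log_rpow h _⟩
    · have : β ^ (-m) = β ^ (-k) := by
        rw [hk, ← Int.cast_neg, Real.rpow_intCast]
      rw [this]
      refine ⟨zpow_ne_zero _ h, ?_⟩
      rw [Real.log_zpow, hk]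
      push_cast
      ring
  rw [← Real.exp_log (show 0 < (Real.sqrt Q ^ (1 + m) * β ^ (-m)) ^ 2 by
    have := mul_ne_zero h1.ne' h2.1
    positivity)]
  congr 1
  rw [Real.log_pow, Real.log_mul h1.ne' h2.1, h2.2, Real.log_rpow (Real.sqrt_pos.2 hQ),
    Real.log_sqrt hQ.le, logForm, ← hQdef, ← hβdef]
  push_cast
  ring

theorem metricForm_contDiffAt_of (hF : IsKropinaSpace a b m A F) (he : e ∈ charts n M)
    {x : Coord n} (hx : x ∈ e.target) : ContDiffAt ℝ ∞ (metricForm a e) x :=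
  metricForm_contDiffAt fun i j => by
    have h := hF.metric.smooth e he i j
    rw [preimage_univ, inter_univ] at h
    exact h.contDiffAt (e.open_target.mem_nhds hx)

theorem linForm_contDiffAt_of (hF : IsKropinaSpace a b m A F) (he : e ∈ charts n M)
    {x : Coord n} (hx : x ∈ e.target) : ContDiffAt ℝ ∞ (linForm b e) x :=
  linForm_contDiffAt fun i =>
    (hF.smooth_form e he i).contDiffAt (e.open_target.mem_nhds hx)

theorem metricForm_symm (hF : IsKropinaSpace a b m A F) (x v w : Coord n) :
    metricForm a e x v w = metricForm a e x w v := by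
  rw [metricForm_apply, metricForm_apply]
  exact hF.metric.symm _ trivial _ _

theorem isOpen_coordCone (hF : IsKropinaSpace a b m A F) (he : e ∈ charts n M) :
    IsOpen (coordCone A e) :=
  isOpen_bundlePoint_preimage he hF.finsler.isOpen

theorem coordCone_nonempty_fibre (hF : IsKropinaSpace a b m A F) (he : e ∈ charts n M)
    {x : Coord n} (hx : x ∈ e.target) : ∃ y, (x, y) ∈ coordCone A e := by
  obtain ⟨Y, hY⟩ := hF.finsler.nonempty_fibre (e.symm x)
  obtain ⟨y, rfl⟩ := (coordVec_bijective he hx).2 Y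
  exact ⟨y, hx, hY⟩

/-- The differential of `logForm`. -/
theorem hasFDerivAt_logForm (hF : IsKropinaSpace a b m A F) (he : e ∈ charts n M)
    {x y : Coord n} (hp : (x, y) ∈ coordCone A e) (v w : Coord n) :
    fderiv ℝ (logForm a b m e) (x, y) (v, w) =
      (1 + m) * ((fderiv ℝ (metricForm a e) x v y y + 2 * metricForm a e x y w) /
        metricForm a e x y y) -
      2 * m * ((fderiv ℝ (linForm b e) x v y + linForm b e x w) / linForm b e x y) := by
  have hG := ((metricForm_contDiffAt_of hF he hp.1).differentiableAt (by simp)).hasFDerivAt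
  have hβ := ((linForm_contDiffAt_of hF he hp.1).differentiableAt (by simp)).hasFDerivAt
  have hG1 : HasFDerivAt (fun p : Coord n × Coord n => metricForm a e p.1)
    _ (x, y) := HasFDerivAt.comp (g := metricForm a e) (x, y) hG hasFDerivAt_fst
  have hβ1 : HasFDerivAt (fun p : Coord n × Coord n => linForm b e p.1)
    _ (x, y) := HasFDerivAt.comp (g := linForm b e) (x, y) hβ hasFDerivAt_fst
  have hG2 := ((hG1.clm_apply hasFDerivAt_snd).clm_apply hasFDerivAt_snd).log
    (metricForm_pos hF hp).ne'
  have hβ2 := (hβ1.clm_apply hasFDerivAt_snd).log (linForm_ne_zero hF hp)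
  have h := ((hG2.const_mul (1 + m)).sub (hβ2.const_mul (2 * m))).fderiv
  have h' : fderiv ℝ (logForm a b m e) (x, y) = _ := h
  rw [h']
  simp
  rw [metricForm_symm hF x w y]
  ring

theorem contDiffAt_logForm (hF : IsKropinaSpace a b m A F) (he : e ∈ charts n M)
    {p : Coord n × Coord n} (hp : p ∈ coordCone A e) : ContDiffAt ℝ ∞ (logForm a b m e) p := by
  have hG : ContDiffAt ℝ ∞ (fun p : Coord n × Coord n => metricForm a e p.1) p :=
    ContDiffAt.comp (g := metricForm a e) p (metricForm_contDiffAt_of hF he hp.1) contDiffAt_fst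
  have hβ : ContDiffAt ℝ ∞ (fun p : Coord n × Coord n => linForm b e p.1) p :=
    ContDiffAt.comp (g := linForm b e) p (linForm_contDiffAt_of hF he hp.1) contDiffAt_fst
  exact (contDiffAt_const.mul (((hG.clm_apply contDiffAt_snd).clm_apply contDiffAt_snd).log
    (metricForm_pos hF hp).ne')).sub (contDiffAt_const.mul
    ((hβ.clm_apply contDiffAt_snd).log (linForm_ne_zero hF hp)))

theorem sqCoord_eventuallyEq (hF : IsKropinaSpace a b m A F) (he : e ∈ charts n M)
    {p : Coord n × Coord n} (hp : p ∈ coordCone A e) :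
    Function.uncurry (sqCoord F e) =ᶠ[𝓝 p] fun q => Real.exp (logForm a b m e q) := by
  filter_upwards [(isOpen_coordCone hF he).mem_nhds hp] with q hq using sqCoord_eq_exp hF hq

theorem contDiffAt_sqCoord (hF : IsKropinaSpace a b m A F) (he : e ∈ charts n M)
    {p : Coord n × Coord n} (hp : p ∈ coordCone A e) :
    ContDiffAt ℝ ∞ (Function.uncurry (sqCoord F e)) p :=
  (contDiffAt_logForm hF he hp).exp.congr_of_eventuallyEq (sqCoord_eventuallyEq hF he hp)

theorem fderiv_sqCoord (hF : IsKropinaSpace a b m A F) (he : e ∈ charts n M)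
    {p : Coord n × Coord n} (hp : p ∈ coordCone A e) (v : Coord n × Coord n) :
    fderiv ℝ (Function.uncurry (sqCoord F e)) p v =
      Function.uncurry (sqCoord F e) p * fderiv ℝ (logForm a b m e) p v := by
  rw [(sqCoord_eventuallyEq hF he hp).fderiv_eq, sqCoord_eq_exp hF hp,
    (((contDiffAt_logForm hF he hp).differentiableAt (by simp)).hasFDerivAt.exp).fderiv]
  simp

end LogForm

/-! ### The Weyl structure of a Berwald Kropina space -/

section Weyl

variable {n : ℕ}

/-- At the point `x`, the torsion-free connection `B` satisfies `∇β = (1 + m) c β ⊗ β` and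
`∇G = 2 m c β ⊗ G`. -/
structure IsWeylAt (G : Coord n → Coord n →L[ℝ] Coord n →L[ℝ] ℝ) (β : Coord n → Coord n →L[ℝ] ℝ)
    (B : Coord n →L[ℝ] Coord n →L[ℝ] Coord n) (m c : ℝ) (x : Coord n) : Prop where
  symm : ∀ v w, B v w = B w v
  form : ∀ v w, fderiv ℝ β x v w = β x (B v w) + (1 + m) * c * β x v * β x w
  metric : ∀ u v w, fderiv ℝ G x u v w =
    G x (B u v) w + G x v (B u w) + 2 * m * c * β x u * G x v w

/-- For each fixed `u` the cubic identity makes `∇ᵤβ` proportional to `β` and `∇ᵤG` to `G`. The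
symmetry of `∇β` then determines how the factor depends on `u`. -/
theorem exists_weyl_coefficient (hn : 2 < n) {G : Coord n →L[ℝ] Coord n →L[ℝ] ℝ}
    {G' : Coord n →L[ℝ] Coord n →L[ℝ] Coord n →L[ℝ] ℝ} {β : Coord n →L[ℝ] ℝ}
    {β' : Coord n →L[ℝ] Coord n →L[ℝ] ℝ} {B : Coord n →L[ℝ] Coord n →L[ℝ] Coord n} {m : ℝ}
    (hG : ∀ v w, G v w = G w v) (hnd : ∀ v, (∀ w, G v w = 0) → v = 0)
    (hG' : ∀ u v w, G' u v w = G' u w v) (hβ' : ∀ v w, β' v w = β' w v)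
    (hB : ∀ v w, B v w = B w v) {y₀ : Coord n} (hβ : β y₀ ≠ 0) (h1m : 1 + m ≠ 0) (hm : m ≠ 0)
    {U : Set (Coord n)} (hU : IsOpen U) (hne : U.Nonempty)
    (hcubic : ∀ u, ∀ y ∈ U, (1 + m) * (β y * (G' u y y - G (B u y) y - G y (B u y))) =
      2 * m * (G y y * (β' u y - β (B u y)))) :
    ∃ c, (∀ v w, β' v w = β (B v w) + (1 + m) * c * β v * β w) ∧
      ∀ u v w, G' u v w = G (B u v) w + G v (B u w) + 2 * m * c * β u * G v w := by
  have key : ∀ u, ∃ lam : ℝ, (∀ v, β' u v - β (B u v) = lam * β v) ∧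
      ∀ v w, (1 + m) * (G' u v w - G (B u v) w - G v (B u w)) = 2 * m * lam * G v w := by
    intro u
    let q : Coord n →L[ℝ] Coord n →L[ℝ] ℝ := G' u - G.comp (B u) - (G.flip.comp (B u)).flip
    have hq : ∀ v w, q v w = G' u v w - G (B u v) w - G v (B u w) := fun v w => by simp [q]
    let ℓ : Coord n →L[ℝ] ℝ := β' u - β.comp (B u)
    have hℓ : ∀ v, ℓ v = β' u v - β (B u v) := fun _ => rfl
    obtain ⟨lam, hl1, hl2⟩ := proportional_of_cubic_eq hn (q := q) (ℓ := ℓ) hG hnd (fun v w => by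
        rw [hq, hq, hG', hG (B u v), hG v]
        ring) hβ (mul_ne_zero two_ne_zero hm) hU hne (fun y hy => by
        rw [hq, hℓ]
        exact hcubic u y hy)
    exact ⟨lam, fun v => (hℓ v).symm.trans (hl1 v), fun v w => by rw [← hq]; exact hl2 v w⟩
  choose lam hl1 hl2 using key
  -- Symmetry of `∇β` on the pair `(u, y₀)` reads `lam u * β y₀ = lam y₀ * β u`.
  have hlam : ∀ u, lam u = lam y₀ / β y₀ * β u := by
    intro u
    have h1 := hl1 u y₀
    have h2 := hl1 y₀ u
    rw [hβ', hB u y₀, h2] at h1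
    rw [div_mul_eq_mul_div, eq_div_iff hβ, h1]
  -- Normalized so that `lam = (1 + m) c β`, which removes the denominator from both equations.
  refine ⟨lam y₀ / β y₀ / (1 + m), fun v w => ?_, fun u v w => ?_⟩
  · have h1 := hl1 v w
    rw [hlam v] at h1
    rw [mul_div_cancel₀ _ h1m]
    linarith
  · have h1 := hl2 u v w
    rw [hlam u] at h1
    refine mul_left_cancel₀ h1m ?_
    generalize lam y₀ / β y₀ = c at h1 ⊢
    have h2 : (1 + m) * (2 * m * (c / (1 + m)) * β u * G v w) = 2 * m * c * β u * G v w := by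
      field_simp
    linear_combination h1 - h2

variable {M : Type*} [TopologicalSpace M] [ChartedSpace (Coord n) M]
  [IsManifold (𝓡 n) ∞ M] {a : TwoTensor n M} {b : OneForm n M} {m : ℝ}
  {A : Set (TangentBundle (𝓡 n) M)} {F : TangentBundle (𝓡 n) M → ℝ}
  {e : OpenPartialHomeomorph M (Coord n)}

theorem fderiv_linForm_symm (hF : IsKropinaSpace a b m A F) (hclosed : IsClosedOneForm b)
    (he : e ∈ charts n M) {x : Coord n} (hx : x ∈ e.target) (v w : Coord n) :
    fderiv ℝ (linForm b e) x v w = fderiv ℝ (linForm b e) x w v := by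
  have hd := (linForm_contDiffAt_of hF he hx).differentiableAt (by simp)
  have h1 : fderiv ℝ (linForm b e) x = (fderiv ℝ (linForm b e) x).flip := by
    refine ContinuousLinearMap.coe_injective
      ((EuclideanSpace.basisFun (Fin n) ℝ).toBasis.ext fun i => ?_)
    refine ContinuousLinearMap.coe_injective
      ((EuclideanSpace.basisFun (Fin n) ℝ).toBasis.ext fun j => ?_)
    simpa [fderiv_linForm_single hd, pd] using hclosed e he x hx i j
  exact DFunLike.congr_fun (DFunLike.congr_fun h1 v) w

theorem fderiv_metricForm_symm (hF : IsKropinaSpace a b m A F)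
    (he : e ∈ charts n M) {x : Coord n} (hx : x ∈ e.target) (u v w : Coord n) :
    fderiv ℝ (metricForm a e) x u v w = fderiv ℝ (metricForm a e) x u w v := by
  have hd := (metricForm_contDiffAt_of hF he hx).differentiableAt (by simp)
  have h1 : fderiv ℝ (metricForm a e) x u = (fderiv ℝ (metricForm a e) x u).flip := by
    refine ContinuousLinearMap.coe_injective
      ((EuclideanSpace.basisFun (Fin n) ℝ).toBasis.ext fun i => ?_)
    refine ContinuousLinearMap.coe_injective
      ((EuclideanSpace.basisFun (Fin n) ℝ).toBasis.ext fun j => ?_)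
    have h2 : comp2 a e i j = comp2 a e j i := by
      ext x
      rw [← metricForm_single, ← metricForm_single, metricForm_symm hF]
    simp [fderiv_metricForm_single hd, h2]
  exact DFunLike.congr_fun (DFunLike.congr_fun h1 v) w

/-- The Hessian of `F²` in the fibre directions. -/
theorem fderiv_fderiv_sqCoord (hF : IsKropinaSpace a b m A F) (he : e ∈ charts n M)
    {x y : Coord n} (hp : (x, y) ∈ coordCone A e) (v w : Coord n) :
    fderiv ℝ (fderiv ℝ (Function.uncurry (sqCoord F e))) (x, y) (0, w) (0, v) =
      Function.uncurry (sqCoord F e) (x, y) *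
      ((2 * (1 + m) * metricForm a e x y w / metricForm a e x y y -
          2 * m * linForm b e x w / linForm b e x y) *
        (2 * (1 + m) * metricForm a e x y v / metricForm a e x y y -
          2 * m * linForm b e x v / linForm b e x y) +
        (2 * (1 + m) * (metricForm a e x w v / metricForm a e x y y -
          2 * metricForm a e x y v * metricForm a e x y w / metricForm a e x y y ^ 2) +
        2 * m * linForm b e x v * linForm b e x w / linForm b e x y ^ 2)) := by
  have hL := contDiffAt_sqCoord hF he hp
  have hQ := (metricForm_pos hF hp).ne'
  have hβ := linForm_ne_zero hF hp
  simp only at hQ hβ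
  have hd : DifferentiableAt ℝ
      (fun q => fderiv ℝ (Function.uncurry (sqCoord F e)) q (0, v)) (x, y) :=
    ((contDiffAt_fderiv_uncurry hL).clm_apply contDiffAt_const).differentiableAt (by simp)
  have h0 : fderiv ℝ (fderiv ℝ (Function.uncurry (sqCoord F e))) (x, y) (0, w) (0, v) =
      fderiv ℝ (fun y' => fderiv ℝ (Function.uncurry (sqCoord F e)) (x, y') (0, v)) y w := by
    rw [← fderiv_fderiv_apply hL]
    exact congrArg (fun A : Coord n →L[ℝ] ℝ => A w)
      (hd.hasFDerivAt.comp y (hasFDerivAt_prodMk_right x y)).fderiv.symm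
  have hev : (fun y' => fderiv ℝ (Function.uncurry (sqCoord F e)) (x, y') (0, v)) =ᶠ[𝓝 y]
      fun y' => Function.uncurry (sqCoord F e) (x, y') *
        (2 * (1 + m) * (metricForm a e x y' v / metricForm a e x y' y') -
          2 * m * (linForm b e x v / linForm b e x y')) := by
    filter_upwards [eventually_mem_right (isOpen_coordCone hF he) hp] with y' hy'
    rw [fderiv_sqCoord hF he hy', hasFDerivAt_logForm hF he hy']
    simp only [map_zero, zero_apply, zero_add]
    ring
  have h1 : HasFDerivAt (fun y' => Function.uncurry (sqCoord F e) (x, y')) _ y :=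
    (hL.differentiableAt (by simp)).hasFDerivAt.comp y (hasFDerivAt_prodMk_right x y)
  have h2 : HasFDerivAt (fun y' => metricForm a e x y' v) ((metricForm a e x).flip v) y :=
    ((metricForm a e x).flip v).hasFDerivAt
  have h3 : HasFDerivAt (fun y' => metricForm a e x y' y')
      (metricForm a e x y + (metricForm a e x).flip y) y := by
    refine ((metricForm a e x).hasFDerivAt_of_bilinear (hasFDerivAt_id y)
      (hasFDerivAt_id y)).congr_fderiv ?_
    ext w
    simp
  have h4 : HasFDerivAt (fun y' => linForm b e x y') (linForm b e x) y :=
    (linForm b e x).hasFDerivAt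
  have h3' : HasFDerivAt (fun y' => (metricForm a e x y' y')⁻¹) _ y :=
    HasDerivAt.comp_hasFDerivAt (h₂ := fun t : ℝ => t⁻¹) (f := fun y' => metricForm a e x y' y') y
      (hasDerivAt_inv hQ) h3
  have h4' : HasFDerivAt (fun y' => (linForm b e x y')⁻¹) _ y :=
    HasDerivAt.comp_hasFDerivAt (h₂ := fun t : ℝ => t⁻¹) (f := fun y' => linForm b e x y') y
      (hasDerivAt_inv hβ) h4
  have h5 := h1.mul (((h2.mul h3').const_mul (2 * (1 + m))).sub
    ((h4'.const_mul (linForm b e x v)).const_mul (2 * m)))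
  have h6 := fderiv_sqCoord hF he hp (0, w)
  rw [hasFDerivAt_logForm hF he hp] at h6
  rw [h0, hev.fderiv_eq]
  simp only [div_eq_mul_inv]
  refine (congrArg (fun A : Coord n →L[ℝ] ℝ => A w) h5.fderiv).trans ?_
  simp [h6, metricForm_symm hF x w y]
  field_simp
  ring

/-- Nondegeneracy of the fundamental tensor in coordinate-free form. -/
theorem sqCoord_hessian_nondegenerate (hF : IsKropinaSpace a b m A F) (he : e ∈ charts n M)
    {x y : Coord n} (hp : (x, y) ∈ coordCone A e) {w : Coord n}
    (h : ∀ v, fderiv ℝ (fderiv ℝ (Function.uncurry (sqCoord F e))) (x, y) (0, w) (0, v) = 0) :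
    w = 0 := by
  have hL : ∀ p ∈ coordCone A e, ContDiffAt ℝ ∞ (Function.uncurry (sqCoord F e)) p :=
    fun p hp => contDiffAt_sqCoord hF he hp
  have hdet : (hessTensor (sqCoord F e) x y).det ≠ 0 := hF.finsler.nondegenerate e he x hp.1 y hp.2
  by_contra hw
  refine hdet (Matrix.exists_mulVec_eq_zero_iff.1 ⟨w, ?_, ?_⟩)
  · intro h0
    exact hw (by ext i; exact congrFun h0 i)
  · ext i
    have h1 : ((0 : Coord n), w) =
        ∑ j, w j • ((0 : Coord n), EuclideanSpace.single j (1 : ℝ)) := by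
      refine Prod.ext ?_ ?_
      · simp [Prod.fst_sum]
      · rw [Prod.snd_sum]
        exact coord_eq_sum w
    have h2 := h (EuclideanSpace.single i 1)
    rw [fderiv_fderiv_comm (hL _ hp), h1, map_sum] at h2
    simp only [map_smul, smul_eq_mul] at h2
    simp only [Matrix.mulVec, dotProduct, Pi.zero_apply,
      hessTensor_eq (isOpen_coordCone hF he) hL hp]
    have h3 : ∀ s : Fin n → ℝ, ∑ j, w j * s j = 0 → ∑ j, 1 / 2 * s j * w j = 0 := by
      intro s hs
      rw [← mul_zero (1 / 2 : ℝ), ← hs, Finset.mul_sum]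
      exact Finset.sum_congr rfl fun j _ => by ring
    exact h3 _ h2

theorem metricForm_nondegenerate_of (hF : IsKropinaSpace a b m A F) (he : e ∈ charts n M)
    {x : Coord n} (hx : x ∈ e.target) (v : Coord n) (h : ∀ w, metricForm a e x v w = 0) : v = 0 :=
  metricForm_nondegenerate hF.metric he hx trivial h

/-- For `m = -1` one has `F² = β²`, whose fibre Hessian annihilates `ker β`; a non-isotropic vector
of the kernel is in particular nonzero. -/
theorem one_add_ne_zero_of_kropina (hn : 2 < n) (hF : IsKropinaSpace a b m A F)
    (he : e ∈ charts n M) {x : Coord n} (hx : x ∈ e.target) : 1 + m ≠ 0 := by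
  intro hm
  obtain ⟨y, hp⟩ := coordCone_nonempty_fibre hF he hx
  obtain ⟨w, hw, hG⟩ := exists_ker_not_isotropic hn (metricForm_symm hF x)
    (metricForm_nondegenerate_of hF he hx) (linForm_ne_zero hF hp)
  have h0 : w = 0 := sqCoord_hessian_nondegenerate hF he hp fun v => by
    rw [fderiv_fderiv_sqCoord hF he hp, hw, hm]
    simp
  rw [h0] at hG
  exact hG (by simp)

/-- For `m = 1` one has `F² = α⁴/β²`. With `V` dual to `b`, nullity puts `w = V - (2β/α²) y` into
the kernel of the fibre Hessian, and `w ≠ 0` because `β(w) = -2β²/α²`. -/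
theorem one_sub_ne_zero_of_kropina (hF : IsKropinaSpace a b m A F)
    (hnull : IsNull a b) (he : e ∈ charts n M) {x : Coord n} (hx : x ∈ e.target) : 1 - m ≠ 0 := by
  intro hm
  have hm1 : m = 1 := by linarith
  obtain ⟨y, hp⟩ := coordCone_nonempty_fibre hF he hx
  obtain ⟨V, hV⟩ := exists_dual_vector (metricForm_nondegenerate_of hF he hx) (linForm b e x)
  have hVV : linForm b e x V = 0 := by
    rw [← hV, metricForm_apply]
    refine hnull _ _ fun W => ?_
    obtain ⟨w, rfl⟩ := (coordVec_bijective he hx).2 W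
    rw [← metricForm_apply, ← linForm_apply, hV]
  have hQ := (metricForm_pos hF hp).ne'
  have hβ := linForm_ne_zero hF hp
  simp only at hQ hβ
  set w := V - (2 * linForm b e x y / metricForm a e x y y) • y with hw
  have hGw : ∀ v, metricForm a e x w v = linForm b e x v -
      2 * linForm b e x y / metricForm a e x y y * metricForm a e x y v := fun v => by
    simp [hw, hV]
  have hGy : metricForm a e x y w = -linForm b e x y := by
    rw [metricForm_symm hF, hGw]
    field_simp
    ring
  have hβw : linForm b e x w = -2 * linForm b e x y ^ 2 / metricForm a e x y y := by
    simp only [hw, map_sub, map_smul, hVV, smul_eq_mul]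
    ring
  have h0 : w = 0 := sqCoord_hessian_nondegenerate hF he hp fun v => by
    rw [fderiv_fderiv_sqCoord hF he hp, hGy, hβw, hGw, hm1]
    field_simp
    ring
  rw [h0, map_zero, eq_comm, div_eq_zero_iff] at hβw
  rcases hβw with h | h
  · exact hβ (by simpa using h)
  · exact hQ h

theorem coordCone_smul (hF : IsKropinaSpace a b m A F) {p : Coord n × Coord n}
    (hp : p ∈ coordCone A e) {c : ℝ} (hc : 0 < c) : (p.1, c • p.2) ∈ coordCone A e := by
  refine ⟨hp.1, ?_⟩
  rw [bundlePoint_smul]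
  exact hF.finsler.conic _ hp.2 c hc

theorem sqCoord_smul (hF : IsKropinaSpace a b m A F) {p : Coord n × Coord n}
    (hp : p ∈ coordCone A e) {c : ℝ} (hc : 0 < c) :
    sqCoord F e p.1 (c • p.2) = c ^ 2 * sqCoord F e p.1 p.2 := by
  have h1 := hF.finsler.homogeneous _ hp.2 c hc
  rw [sqCoord, bundlePoint_smul, sqCoord, ← mul_pow]
  exact congrArg (· ^ 2) h1

theorem sqCoord_horizontally_constant (hF : IsKropinaSpace a b m A F)
    {Γ : ConnectionCoeffs n M} (hΓ : IsBerwaldWithConnection A F Γ) (he : e ∈ charts n M)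
    {x : Coord n} (hx : x ∈ e.target) :
    (∀ i j k, Γ e x i j k = Γ e x i k j) ∧ ∀ y, (x, y) ∈ coordCone A e → ∀ v,
      fderiv ℝ (Function.uncurry (sqCoord F e)) (x, y) (v, 0) =
        fderiv ℝ (Function.uncurry (sqCoord F e)) (x, y) (0, connBilin (Γ e x) v y) :=
  horizontally_constant (L := sqCoord F e) (Ω := coordCone A e) (x := x)
    (Γ := Γ e x) (isOpen_coordCone hF he) (fun _ hp => contDiffAt_sqCoord hF he hp)
    (fun _ hp _ hc => coordCone_smul hF hp hc) (fun _ hp _ hc => sqCoord_smul hF hp hc)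
    (fun p hp => hF.finsler.nondegenerate e he p.1 hp.1 p.2 hp.2)
    (coordCone_nonempty_fibre hF he hx)
    (fun y hy i j => hΓ.linear e he x hx y hy.2 i j)

/-- Horizontal constancy divided by `F²` concerns `log F²`, whose derivatives are rational in `y`;
multiplication by `α²β` clears the denominators. -/
theorem cubic_of_horizontally_constant (hF : IsKropinaSpace a b m A F) (he : e ∈ charts n M)
    {x y : Coord n} (hp : (x, y) ∈ coordCone A e) {u w : Coord n}
    (h : fderiv ℝ (Function.uncurry (sqCoord F e)) (x, y) (u, 0) =
        fderiv ℝ (Function.uncurry (sqCoord F e)) (x, y) (0, w)) :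
    (1 + m) * (linForm b e x y * (fderiv ℝ (metricForm a e) x u y y -
        metricForm a e x w y - metricForm a e x y w)) =
      2 * m * (metricForm a e x y y * (fderiv ℝ (linForm b e) x u y - linForm b e x w)) := by
  have hQ := (metricForm_pos hF hp).ne'
  have hβ := linForm_ne_zero hF hp
  rw [fderiv_sqCoord hF he hp, fderiv_sqCoord hF he hp] at h
  have h2 := mul_left_cancel₀ (by
    rw [sqCoord_eq_exp hF hp]
    exact (Real.exp_pos _).ne') h
  rw [hasFDerivAt_logForm hF he hp, hasFDerivAt_logForm hF he hp] at h2
  rw [metricForm_symm hF x w y]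
  simp only [map_zero, zero_apply, zero_add, mul_zero, add_zero] at h2 hQ hβ
  generalize metricForm a e x y y = Q at *
  generalize linForm b e x y = β at *
  generalize metricForm a e x y w = r at *
  generalize linForm b e x w = s at *
  generalize fderiv ℝ (metricForm a e) x u y y = t at *
  generalize fderiv ℝ (linForm b e) x u y = l at *
  field_simp at h2
  linear_combination h2

/-- The Weyl structure of an `m`-Kropina space of Berwald type. -/
theorem exists_isWeylAt (hn : 2 < n) (hm : m ≠ 0) (hF : IsKropinaSpace a b m A F)
    (hclosed : IsClosedOneForm b) {Γ : ConnectionCoeffs n M}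
    (hΓ : IsBerwaldWithConnection A F Γ) (he : e ∈ charts n M) {x : Coord n}
    (hx : x ∈ e.target) :
    ∃ c, IsWeylAt (metricForm a e) (linForm b e) (connBilin (Γ e x)) m c x := by
  obtain ⟨hsymm, hhor⟩ := sqCoord_horizontally_constant hF hΓ he hx
  have hBs := connBilin_symm hsymm
  obtain ⟨y₀, hy₀⟩ := coordCone_nonempty_fibre hF he hx
  have hU : IsOpen {y | (x, y) ∈ coordCone A e} :=
    (isOpen_coordCone hF he).preimage (by fun_prop : Continuous fun y : Coord n => (x, y))
  obtain ⟨c, h1, h2⟩ := exists_weyl_coefficient hn (metricForm_symm hF x)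
    (metricForm_nondegenerate_of hF he hx) (fderiv_metricForm_symm hF he hx)
    (fderiv_linForm_symm hF hclosed he hx) hBs (linForm_ne_zero hF hy₀)
    (one_add_ne_zero_of_kropina hn hF he hx) hm hU ⟨y₀, hy₀⟩
    (fun u y hy => cubic_of_horizontally_constant hF he hy (hhor y hy u))
  exact ⟨c, hBs, h1, h2⟩

end Weyl

/-! ### The logarithmic derivative of the determinant is closed -/

section Trace

variable {n : ℕ}

/-- The trace `½ tr (g⁻¹ ∂ₖ g)`. -/
noncomputable def logDetDeriv (g : Coord n → Matrix (Fin n) (Fin n) ℝ) (k : Fin n) (x : Coord n) :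
    ℝ :=
  (1 / 2) * ∑ i, ∑ j, (g x)⁻¹ i j * pd k (fun x' => g x' j i) x

theorem pd_contDiffAt {f : Coord n → ℝ} {x : Coord n} (hf : ContDiffAt ℝ ∞ f x) (k : Fin n) :
    ContDiffAt ℝ ∞ (pd k f) x :=
  (hf.fderiv_right (m := ∞) (by simp)).clm_apply contDiffAt_const

theorem pd_comm {f : Coord n → ℝ} {x : Coord n} (hf : ContDiffAt ℝ ∞ f x) (k l : Fin n) :
    pd k (pd l f) x = pd l (pd k f) x := by
  have h1 : DifferentiableAt ℝ (fderiv ℝ f) x :=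
    (hf.fderiv_right (m := ∞) (by simp)).differentiableAt (by simp)
  have h2 : ∀ k l : Fin n, pd k (pd l f) x =
      fderiv ℝ (fderiv ℝ f) x (EuclideanSpace.single k 1) (EuclideanSpace.single l 1) := by
    intro k l
    have := (h1.hasFDerivAt.clm_apply (hasFDerivAt_const (EuclideanSpace.single l (1 : ℝ)) x)).fderiv
    rw [pd]
    refine (congrArg (fun A : Coord n →L[ℝ] ℝ => A (EuclideanSpace.single k 1)) this).trans ?_
    simp
  rw [h2, h2]
  refine (hf.isSymmSndFDerivAt ?_) _ _
  rw [minSmoothness_of_isRCLikeNormedField]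
  exact WithTop.coe_le_coe.2 (le_top (a := (2 : ℕ∞)))

theorem pd_mul {f g : Coord n → ℝ} {x : Coord n} (hf : DifferentiableAt ℝ f x)
    (hg : DifferentiableAt ℝ g x) (k : Fin n) :
    pd k (fun x => f x * g x) x = f x * pd k g x + pd k f x * g x := by
  rw [pd, fderiv_fun_mul hf hg]
  simp [pd, mul_comm]

theorem pd_sum {ι : Type*} {s : Finset ι} {f : ι → Coord n → ℝ} {x : Coord n}
    (hf : ∀ i ∈ s, DifferentiableAt ℝ (f i) x) (k : Fin n) :
    pd k (fun x => ∑ i ∈ s, f i x) x = ∑ i ∈ s, pd k (f i) x := by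
  rw [pd, fderiv_fun_sum hf]
  simp [pd, sum_apply]

theorem pd_const (c : ℝ) (k : Fin n) (x : Coord n) : pd k (fun _ => c) x = 0 := by
  simp [pd]

theorem pd_const_mul {f : Coord n → ℝ} {x : Coord n} (hf : DifferentiableAt ℝ f x) (c : ℝ)
    (k : Fin n) : pd k (fun x => c * f x) x = c * pd k f x := by
  rw [pd, fderiv_const_mul hf]
  simp [pd]

/-- Differentiate `g⁻¹ g = 1` and solve for the derivative of the inverse. -/
theorem pd_matrix_inv {g : Coord n → Matrix (Fin n) (Fin n) ℝ} {x : Coord n}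
    (hg : ∀ i j, ContDiffAt ℝ ∞ (fun x => g x i j) x) (hdet : ∀ᶠ x in 𝓝 x, (g x).det ≠ 0)
    (k : Fin n) : (Matrix.of fun i j => pd k (fun x => (g x)⁻¹ i j) x) =
      -((g x)⁻¹ * (Matrix.of fun i j => pd k (fun x => g x i j) x) * (g x)⁻¹) := by
  have hh : ∀ i j, DifferentiableAt ℝ (fun x => (g x)⁻¹ i j) x := fun i j =>
    (contDiffAt_matrix_inv hg hdet.self_of_nhds i j).differentiableAt (by simp)
  have hd : ∀ i j, DifferentiableAt ℝ (fun x => g x i j) x := fun i j =>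
    (hg i j).differentiableAt (by simp)
  have h1 : (Matrix.of fun i j => pd k (fun x => (g x)⁻¹ i j) x) * g x +
      (g x)⁻¹ * (Matrix.of fun i j => pd k (fun x => g x i j) x) = 0 := by
    ext i j
    have hev : (fun x => ∑ r, (g x)⁻¹ i r * g x r j) =ᶠ[𝓝 x]
        fun _ => (1 : Matrix (Fin n) (Fin n) ℝ) i j := by
      filter_upwards [hdet] with z hz
      rw [← Matrix.mul_apply, Matrix.nonsing_inv_mul _ hz.isUnit]
    have h2 := hev.pd_eq k
    rw [pd_const, pd_sum fun r _ => (hh i r).fun_mul (hd r j)] at h2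
    simp only [pd_mul (hh i _) (hd _ j)] at h2
    simp only [Matrix.add_apply, Matrix.mul_apply, Matrix.of_apply, Matrix.zero_apply]
    rw [← h2, Finset.sum_add_distrib, add_comm]
  have h3 := congrArg (· * (g x)⁻¹) (eq_neg_of_add_eq_zero_left h1)
  simp only [Matrix.mul_assoc, Matrix.mul_nonsing_inv _ hdet.self_of_nhds.isUnit, Matrix.mul_one,
    neg_mul] at h3
  rw [h3, Matrix.mul_assoc]

/-- The covector field `½ tr (g⁻¹ ∂ₖ g)` is closed. -/
theorem logDetDeriv_closed {g : Coord n → Matrix (Fin n) (Fin n) ℝ} {x : Coord n}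
    (hg : ∀ i j, ContDiffAt ℝ ∞ (fun x => g x i j) x) (hdet : ∀ᶠ x in 𝓝 x, (g x).det ≠ 0)
    (k l : Fin n) : pd l (logDetDeriv g k) x = pd k (logDetDeriv g l) x := by
  have hh : ∀ i j, DifferentiableAt ℝ (fun x => (g x)⁻¹ i j) x := fun i j =>
    (contDiffAt_matrix_inv hg hdet.self_of_nhds i j).differentiableAt (by simp)
  have hp : ∀ k i j, DifferentiableAt ℝ (pd k (fun x' => g x' i j)) x := fun k i j =>
    (pd_contDiffAt (hg i j) k).differentiableAt (by simp)
  -- The first term is symmetric in `k` and `l` because the trace is cyclic, the second because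
  -- partial derivatives commute. No derivative of the determinant itself is needed.
  have key : ∀ k l : Fin n, pd l (logDetDeriv g k) x = (1 / 2) *
      (-Matrix.trace ((g x)⁻¹ * (Matrix.of fun i j => pd l (fun x => g x i j) x) * (g x)⁻¹ *
        (Matrix.of fun i j => pd k (fun x => g x i j) x)) +
        ∑ i, ∑ j, (g x)⁻¹ i j * pd l (pd k (fun x' => g x' j i)) x) := by
    intro k l
    change pd l (fun x => (1 / 2) * ∑ i, ∑ j, (g x)⁻¹ i j * pd k (fun x' => g x' j i) x) x = _
    have hs : ∀ i, DifferentiableAt ℝ (fun x => ∑ j, (g x)⁻¹ i j * pd k (fun x' => g x' j i) x) x :=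
      fun i => DifferentiableAt.fun_sum fun j _ => (hh i j).fun_mul (hp k j i)
    rw [pd_const_mul (DifferentiableAt.fun_sum fun i _ => hs i), pd_sum fun i _ => hs i]
    congr 1
    have h1 : -Matrix.trace ((g x)⁻¹ * (Matrix.of fun i j => pd l (fun x => g x i j) x) *
        (g x)⁻¹ * (Matrix.of fun i j => pd k (fun x => g x i j) x)) =
        ∑ i, ∑ j, pd l (fun x => (g x)⁻¹ i j) x * pd k (fun x => g x j i) x := by
      rw [← Matrix.trace_neg, ← Matrix.neg_mul, ← pd_matrix_inv hg hdet l]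
      rfl
    rw [h1, ← Finset.sum_add_distrib]
    refine Finset.sum_congr rfl fun i _ => ?_
    rw [pd_sum fun j _ => (hh i j).fun_mul (hp k j i), ← Finset.sum_add_distrib]
    refine Finset.sum_congr rfl fun j _ => ?_
    rw [pd_mul (hh i j) (hp k j i)]
    ring
  rw [key, key]
  congr 2
  · rw [Matrix.mul_assoc, Matrix.trace_mul_comm, ← Matrix.mul_assoc]
  · exact Finset.sum_congr rfl fun i _ => Finset.sum_congr rfl fun j _ => by
      rw [pd_comm (hg j i)]

theorem connBilin_single_single (Γ : Fin n → Fin n → Fin n → ℝ) (j k : Fin n) :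
    connBilin Γ (EuclideanSpace.single j 1) (EuclideanSpace.single k 1) =
      ∑ r, Γ r j k • EuclideanSpace.single r (1 : ℝ) := by
  rw [coord_eq_sum (connBilin Γ _ _)]
  refine Finset.sum_congr rfl fun r _ => ?_
  rw [connBilin_apply]
  simp [PiLp.single_apply]

end Trace

/-! ### Ricci symmetry, traces and the Levi-Civita connection -/

section Connection

variable {n : ℕ} {M : Type*} [TopologicalSpace M] [ChartedSpace (Coord n) M]

/-- The matrix of the components of a 2-tensor. -/
noncomputable def compMatrix (g : TwoTensor n M) (e : OpenPartialHomeomorph M (Coord n))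
    (x : Coord n) : Matrix (Fin n) (Fin n) ℝ :=
  Matrix.of fun i j => comp2 g e i j x

theorem compMatrix_det_ne_zero {g : TwoTensor n M} {e : OpenPartialHomeomorph M (Coord n)}
    {x : Coord n} (hnd : ∀ v, (∀ w, metricForm g e x v w = 0) → v = 0) :
    (compMatrix g e x).det ≠ 0 := by
  intro h0
  obtain ⟨v, hv, hv0⟩ := Matrix.exists_vecMul_eq_zero_iff.2 h0
  refine hv ?_
  have h1 : (WithLp.toLp 2 v : Coord n) = 0 := by
    refine hnd _ fun w => ?_
    have h2 : metricForm g e x (WithLp.toLp 2 v) = 0 := by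
      refine ContinuousLinearMap.coe_injective
        ((EuclideanSpace.basisFun (Fin n) ℝ).toBasis.ext fun j => ?_)
      have h3 := congrFun hv0 j
      rw [coord_eq_sum (WithLp.toLp 2 v : Coord n)]
      simpa [Matrix.vecMul, dotProduct, compMatrix, sum_apply, metricForm_single] using h3
    rw [h2]
    rfl
  ext i
  exact congrFun (congrArg WithLp.ofLp h1) i

/-- The antisymmetric part of the affine Ricci tensor of a torsion-free connection. -/
theorem affineRicci_sub {Γ : ConnectionCoeffs n M} {e : OpenPartialHomeomorph M (Coord n)}
    (hs : ∀ x ∈ e.target, ∀ i j k, Γ e x i j k = Γ e x i k j)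
    (hΓ : ∀ i j k, ContDiffOn ℝ ∞ (fun x => Γ e x i j k) e.target) {x : Coord n}
    (hx : x ∈ e.target) (l k : Fin n) :
    affineRicci Γ e x l k - affineRicci Γ e x k l =
      pd l (fun x' => ∑ i, Γ e x' i i k) x - pd k (fun x' => ∑ i, Γ e x' i i l) x := by
  have hd : ∀ i j k, DifferentiableAt ℝ (fun x => Γ e x i j k) x := fun i j k =>
    ((hΓ i j k).contDiffAt (e.open_target.mem_nhds hx)).differentiableAt (by simp)
  have h1 : ∀ i, pd i (fun x' => Γ e x' i k l) x = pd i (fun x' => Γ e x' i l k) x := by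
    intro i
    refine Filter.EventuallyEq.pd_eq ?_ i
    filter_upwards [e.open_target.mem_nhds hx] with x' hx' using hs x' hx' i k l
  -- All quadratic terms and the divergence term are symmetric in `k` and `l`; only the curl of the
  -- trace survives.
  have h2 : ∑ i, ∑ r, Γ e x i r k * Γ e x r i l = ∑ i, ∑ r, Γ e x i r l * Γ e x r i k := by
    rw [Finset.sum_comm]
    exact Finset.sum_congr rfl fun i _ => Finset.sum_congr rfl fun r _ => mul_comm _ _
  have h3 : ∑ i, ∑ r, Γ e x i r i * Γ e x r k l = ∑ i, ∑ r, Γ e x i r i * Γ e x r l k :=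
    Finset.sum_congr rfl fun i _ => Finset.sum_congr rfl fun r _ => by rw [hs x hx r k l]
  rw [pd_sum fun i _ => hd i i k, pd_sum fun i _ => hd i i l]
  simp only [affineRicci, affineCurvature, Finset.sum_add_distrib, Finset.sum_sub_distrib, h1, h2,
    h3]
  ring

theorem hasSymmetricRicci_iff {Γ : ConnectionCoeffs n M}
    (hs : ∀ e ∈ charts n M, ∀ x ∈ e.target, ∀ i j k, Γ e x i j k = Γ e x i k j)
    (hΓ : ∀ e ∈ charts n M, ∀ i j k, ContDiffOn ℝ ∞ (fun x => Γ e x i j k) e.target) :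
    HasSymmetricRicci Γ ↔ ∀ e ∈ charts n M, ∀ x ∈ e.target, ∀ k l,
      pd l (fun x' => ∑ i, Γ e x' i i k) x = pd k (fun x' => ∑ i, Γ e x' i i l) x := by
  refine forall₄_congr fun e he x hx => ⟨fun h k l => ?_, fun h l k => ?_⟩
  · have := affineRicci_sub (hs e he) (hΓ e he) hx l k
    rw [h l k, sub_self] at this
    linarith
  · have := affineRicci_sub (hs e he) (hΓ e he) hx l k
    rw [h k l, sub_self] at this
    linarith

/-- Contracted with the symmetric inverse metric, two of the three derivative terms cancel. -/
theorem trace_christoffel {g : TwoTensor n M} {U : Set M} (hg : IsPseudoRiemannianOn g U)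
    {e : OpenPartialHomeomorph M (Coord n)} (hU : IsOpen U) {x : Coord n}
    (hx : x ∈ e.target) (hxU : e.symm x ∈ U) (k : Fin n) :
    ∑ i, christoffel g e x i i k = logDetDeriv (compMatrix g e) k x := by
  have hopen : ∀ᶠ x' in 𝓝 x, x' ∈ e.target ∩ e.symm ⁻¹' U :=
    (e.isOpen_inter_preimage_symm hU).mem_nhds ⟨hx, hxU⟩
  have hsymm : ∀ i j, comp2 g e i j =ᶠ[𝓝 x] comp2 g e j i := by
    intro i j
    filter_upwards [hopen] with x' hx' using hg.symm _ hx'.2 _ _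
  have hsymm' : (compMatrix g e x).transpose = compMatrix g e x := by
    ext i j
    exact (hsymm j i).self_of_nhds
  have hinv : ∀ i j, (compMatrix g e x)⁻¹ i j = (compMatrix g e x)⁻¹ j i := by
    intro i j
    have := Matrix.transpose_nonsing_inv (compMatrix g e x)
    rw [hsymm'] at this
    exact congrFun (congrFun this j) i
  change ∑ i, (1 / 2) * ∑ l, (compMatrix g e x)⁻¹ i l *
    (pd i (comp2 g e k l) x + pd k (comp2 g e i l) x - pd l (comp2 g e i k) x) = _
  rw [← Finset.mul_sum, logDetDeriv]
  congr 1
  have h1 : ∑ i, ∑ l, (compMatrix g e x)⁻¹ i l * pd l (comp2 g e i k) x =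
      ∑ i, ∑ l, (compMatrix g e x)⁻¹ i l * pd i (comp2 g e k l) x := by
    rw [Finset.sum_comm]
    refine Finset.sum_congr rfl fun i _ => Finset.sum_congr rfl fun l _ => ?_
    rw [hinv, (hsymm l k).pd_eq]
  have h2 : ∀ i l, pd k (fun x' => compMatrix g e x' l i) x = pd k (comp2 g e i l) x := by
    intro i l
    rw [(hsymm i l).pd_eq]
    rfl
  simp only [mul_sub, mul_add, Finset.sum_sub_distrib, Finset.sum_add_distrib, h1, h2]
  ring

theorem logDetDeriv_closed_of_isPseudoRiemannianOn {g : TwoTensor n M} {U : Set M}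
    (hg : IsPseudoRiemannianOn g U) {e : OpenPartialHomeomorph M (Coord n)} (he : e ∈ charts n M)
    (hU : IsOpen U) {x : Coord n} (hx : x ∈ e.target) (hxU : e.symm x ∈ U) (k l : Fin n) :
    pd l (logDetDeriv (compMatrix g e) k) x = pd k (logDetDeriv (compMatrix g e) l) x := by
  have ho := e.isOpen_inter_preimage_symm hU
  refine logDetDeriv_closed (fun i j => (hg.smooth e he i j).contDiffAt (ho.mem_nhds ⟨hx, hxU⟩))
    ?_ k l
  filter_upwards [ho.mem_nhds ⟨hx, hxU⟩] with x' hx'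
  exact compMatrix_det_ne_zero fun v hv => metricForm_nondegenerate hg he hx'.1 hx'.2 hv

/-- Near each point the trace of `Γ` is the log-determinant gradient of a metric, hence closed, and
its curl is the antisymmetric part of Ricci. -/
theorem hasSymmetricRicci_of_isLocallyMetrizable {Γ : ConnectionCoeffs n M}
    (hs : ∀ e ∈ charts n M, ∀ x ∈ e.target, ∀ i j k, Γ e x i j k = Γ e x i k j)
    (hΓ : ∀ e ∈ charts n M, ∀ i j k, ContDiffOn ℝ ∞ (fun x => Γ e x i j k) e.target)
    (h : IsLocallyMetrizable Γ) : HasSymmetricRicci Γ := by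
  rw [hasSymmetricRicci_iff hs hΓ]
  intro e he x hx k l
  obtain ⟨U, hU, hxU, g, hg, hgΓ⟩ := h (e.symm x)
  have hev : ∀ k, (fun x' => ∑ i, Γ e x' i i k) =ᶠ[𝓝 x] logDetDeriv (compMatrix g e) k := by
    intro k
    filter_upwards [(e.isOpen_inter_preimage_symm hU).mem_nhds ⟨hx, hxU⟩] with x' hx'
    rw [← trace_christoffel hg hU hx'.1 hx'.2]
    exact Finset.sum_congr rfl fun i _ => hgΓ e he x' hx'.1 hx'.2 i i k
  rw [(hev k).pd_eq, (hev l).pd_eq]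
  exact logDetDeriv_closed_of_isPseudoRiemannianOn hg he hU hx hxU k l

/-- The trace of a torsion-free connection with `∇g = κ ⊗ g`. -/
theorem trace_of_weyl {g : TwoTensor n M} {e : OpenPartialHomeomorph M (Coord n)} {x : Coord n}
    {Γ : Fin n → Fin n → Fin n → ℝ} (hs : ∀ i j k, Γ i j k = Γ i k j)
    (hd : DifferentiableAt ℝ (metricForm g e) x) (hdet : (compMatrix g e x).det ≠ 0)
    {κ : Coord n → ℝ} (hw : ∀ u v w, fderiv ℝ (metricForm g e) x u v w =
      metricForm g e x (connBilin Γ u v) w + metricForm g e x v (connBilin Γ u w) +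
        κ u * metricForm g e x v w) (k : Fin n) :
    logDetDeriv (compMatrix g e) k x =
      ∑ i, Γ i i k + n / 2 * κ (EuclideanSpace.single k 1) := by
  have h1 : ∀ i j, pd k (fun x' => compMatrix g e x' j i) x =
      ∑ r, Γ r k j * compMatrix g e x r i + ∑ r, Γ r k i * compMatrix g e x j r +
        κ (EuclideanSpace.single k 1) * compMatrix g e x j i := by
    intro i j
    have := hw (EuclideanSpace.single k 1) (EuclideanSpace.single j 1) (EuclideanSpace.single i 1)
    rw [fderiv_metricForm_single hd, connBilin_single_single, connBilin_single_single] at this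
    simpa [sum_apply, metricForm_single, compMatrix, pd] using this
  have hl : ∀ i r, ∑ j, (compMatrix g e x)⁻¹ i j * compMatrix g e x j r =
      (1 : Matrix (Fin n) (Fin n) ℝ) i r := fun i r => by
    rw [← Matrix.mul_apply, Matrix.nonsing_inv_mul _ hdet.isUnit]
  have hr : ∀ r j, ∑ i, compMatrix g e x r i * (compMatrix g e x)⁻¹ i j =
      (1 : Matrix (Fin n) (Fin n) ℝ) r j := fun i r => by
    rw [← Matrix.mul_apply, Matrix.mul_nonsing_inv _ hdet.isUnit]
  -- Each of the two connection terms of `∂ₖg` contributes one copy of `Γⁱᵢₖ`, and the `κ` term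
  -- contributes `n κₖ`; the prefactor `½` gives the stated formula.
  have e1 : ∑ i, ∑ j, (compMatrix g e x)⁻¹ i j * ∑ r, Γ r k j * compMatrix g e x r i =
      ∑ i, Γ i i k := by
    have : ∀ j, ∑ i, (compMatrix g e x)⁻¹ i j * ∑ r, Γ r k j * compMatrix g e x r i = Γ j k j := by
      intro j
      have h2 : ∑ i, (compMatrix g e x)⁻¹ i j * ∑ r, Γ r k j * compMatrix g e x r i =
          ∑ r, Γ r k j * ∑ i, compMatrix g e x r i * (compMatrix g e x)⁻¹ i j := by
        simp only [Finset.mul_sum]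
        rw [Finset.sum_comm]
        exact Finset.sum_congr rfl fun i _ => Finset.sum_congr rfl fun r _ => by ring
      simp only [h2, hr, Matrix.one_apply]
      simp
    rw [Finset.sum_comm]
    exact Finset.sum_congr rfl fun j _ => (this j).trans (hs _ _ _)
  have e2 : ∑ i, ∑ j, (compMatrix g e x)⁻¹ i j * ∑ r, Γ r k i * compMatrix g e x j r =
      ∑ i, Γ i i k := by
    refine Finset.sum_congr rfl fun i _ => ?_
    have h2 : ∑ j, (compMatrix g e x)⁻¹ i j * ∑ r, Γ r k i * compMatrix g e x j r =
        ∑ r, Γ r k i * ∑ j, (compMatrix g e x)⁻¹ i j * compMatrix g e x j r := by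
      simp only [Finset.mul_sum]
      rw [Finset.sum_comm]
      exact Finset.sum_congr rfl fun i _ => Finset.sum_congr rfl fun r _ => by ring
    simp only [h2, hl, Matrix.one_apply]
    simp [hs i k i]
  have e3 : ∑ i, ∑ j, (compMatrix g e x)⁻¹ i j *
      (κ (EuclideanSpace.single k 1) * compMatrix g e x j i) =
      n * κ (EuclideanSpace.single k 1) := by
    have : ∀ i, ∑ j, (compMatrix g e x)⁻¹ i j *
        (κ (EuclideanSpace.single k 1) * compMatrix g e x j i) =
        κ (EuclideanSpace.single k 1) := by
      intro i
      have h2 : ∑ j, (compMatrix g e x)⁻¹ i j *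
          (κ (EuclideanSpace.single k 1) * compMatrix g e x j i) =
          κ (EuclideanSpace.single k 1) * ∑ j, (compMatrix g e x)⁻¹ i j * compMatrix g e x j i := by
        rw [Finset.mul_sum]
        exact Finset.sum_congr rfl fun j _ => by ring
      rw [h2, hl, Matrix.one_apply_eq, mul_one]
    simp [this]
  simp only [logDetDeriv, h1, mul_add, Finset.sum_add_distrib, e1, e2, e3]
  ring

/-- A torsion-free connection that preserves a metric is its Levi-Civita connection. -/
theorem eq_christoffel {g : TwoTensor n M} {e : OpenPartialHomeomorph M (Coord n)} {x : Coord n}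
    {Γ : Fin n → Fin n → Fin n → ℝ} (hs : ∀ i j k, Γ i j k = Γ i k j)
    (hsymm : ∀ v w, metricForm g e x v w = metricForm g e x w v)
    (hd : DifferentiableAt ℝ (metricForm g e) x) (hdet : (compMatrix g e x).det ≠ 0)
    (hw : ∀ u v w, fderiv ℝ (metricForm g e) x u v w =
      metricForm g e x (connBilin Γ u v) w + metricForm g e x v (connBilin Γ u w))
    (i j k : Fin n) : Γ i j k = christoffel g e x i j k := by
  have h1 : ∀ k i j, pd k (comp2 g e j i) x =
      ∑ r, Γ r k j * comp2 g e r i x + ∑ r, Γ r k i * comp2 g e r j x := by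
    intro k i j
    have := hw (EuclideanSpace.single k 1) (EuclideanSpace.single j 1) (EuclideanSpace.single i 1)
    rw [fderiv_metricForm_single hd, connBilin_single_single, connBilin_single_single,
      hsymm (EuclideanSpace.single j 1)] at this
    simpa [sum_apply, metricForm_single, pd] using this
  -- Koszul's combination: by symmetry of `Γ` four of the six terms cancel and the remaining two
  -- coincide.
  have h2 : ∀ l, pd j (comp2 g e k l) x + pd k (comp2 g e j l) x - pd l (comp2 g e j k) x =
      2 * ∑ r, Γ r j k * comp2 g e l r x := by
    intro l
    have h3 : ∀ r, comp2 g e l r x = comp2 g e r l x := fun r => by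
      rw [← metricForm_single, ← metricForm_single, hsymm]
    simp only [h1, h3, hs _ k j, hs _ l j, hs _ l k]
    ring
  have hl : ∀ r, ∑ l, (compMatrix g e x)⁻¹ i l * comp2 g e l r x =
      (1 : Matrix (Fin n) (Fin n) ℝ) i r := fun r => by
    rw [← Matrix.nonsing_inv_mul _ hdet.isUnit, Matrix.mul_apply]
    rfl
  change Γ i j k = (1 / 2) * ∑ l, (compMatrix g e x)⁻¹ i l *
    (pd j (comp2 g e k l) x + pd k (comp2 g e j l) x - pd l (comp2 g e j k) x)
  have h4 : ∑ l, (compMatrix g e x)⁻¹ i l *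
      (pd j (comp2 g e k l) x + pd k (comp2 g e j l) x - pd l (comp2 g e j k) x) =
      2 * ∑ r, Γ r j k * ∑ l, (compMatrix g e x)⁻¹ i l * comp2 g e l r x := by
    simp only [h2, Finset.mul_sum]
    rw [Finset.sum_comm]
    exact Finset.sum_congr rfl fun i _ => Finset.sum_congr rfl fun r _ => by ring
  rw [h4]
  simp only [hl, Matrix.one_apply]
  simp

end Connection

/-! ### Antiderivatives on open subsets of the line -/

section Antiderivative

/-- A continuous function on an open set of real numbers has an antiderivative. -/
theorem exists_antiderivative {S : Set ℝ} (hS : IsOpen S) {φ : ℝ → ℝ} (hφ : ContinuousOn φ S) :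
    ∃ Φ : ℝ → ℝ, ∀ u ∈ S, HasDerivAt Φ (φ u) u := by
  classical
  -- The open set need not be an interval. The base point is a function of the component as a set,
  -- hence constant on each component; the value `0` is never used.
  let base : Set ℝ → ℝ := fun C => if h : C.Nonempty then h.some else 0
  have hbase : ∀ {C : Set ℝ}, C.Nonempty → base C ∈ C := by
    intro C hC
    simp only [base, dif_pos hC]
    exact hC.some_mem
  refine ⟨fun u => ∫ t in base (connectedComponentIn S u)..u, φ t, fun u hu => ?_⟩
  set C := connectedComponentIn S u with hC
  have hCo : IsOpen C := hS.connectedComponentIn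
  have huC : u ∈ C := mem_connectedComponentIn hu
  have hCS : C ⊆ S := connectedComponentIn_subset S u
  have hb : base C ∈ C := hbase ⟨u, huC⟩
  have hsub : uIcc (base C) u ⊆ C :=
    isPreconnected_connectedComponentIn.ordConnected.uIcc_subset hb huC
  have h1 := intervalIntegral.integral_hasDerivAt_right
    ((hφ.mono (hsub.trans hCS)).intervalIntegrable)
    (hφ.stronglyMeasurableAtFilter hS u hu) (hφ.continuousAt (hS.mem_nhds hu))
  refine h1.congr_of_eventuallyEq ?_
  filter_upwards [hCo.mem_nhds huC] with t ht
  rw [← connectedComponentIn_eq ht]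

theorem contDiffOn_of_hasDerivAt {S : Set ℝ} (hS : IsOpen S) {φ Φ : ℝ → ℝ}
    (hφ : ContDiffOn ℝ ∞ φ S) (h : ∀ u ∈ S, HasDerivAt Φ (φ u) u) : ContDiffOn ℝ ∞ Φ S :=
  (contDiffOn_infty_iff_deriv_of_isOpen hS).2
    ⟨fun u hu => (h u hu).differentiableAt.differentiableWithinAt,
      hφ.congr fun u hu => (h u hu).deriv⟩

end Antiderivative

/-! ### Product rules for bilinear-form-valued maps -/

section ProductRules

variable {E F K : Type*} [NormedAddCommGroup E] [NormedSpace ℝ E] [NormedAddCommGroup F]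
  [NormedSpace ℝ F] [NormedAddCommGroup K] [NormedSpace ℝ K]

theorem exists_hasFDerivAt_bilinear_apply {c : E → F →L[ℝ] K →L[ℝ] ℝ}
    {c' : E →L[ℝ] F →L[ℝ] K →L[ℝ] ℝ} {u : E → F} {u' : E →L[ℝ] F} {w : E → K} {w' : E →L[ℝ] K}
    {x : E} (hc : HasFDerivAt c c' x) (hu : HasFDerivAt u u' x) (hw : HasFDerivAt w w' x) :
    ∃ L : E →L[ℝ] ℝ, HasFDerivAt (fun z => c z (u z) (w z)) L x ∧
      ∀ v, L v = c' v (u x) (w x) + c x (u' v) (w x) + c x (u x) (w' v) := by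
  refine ⟨_, (hc.clm_apply hu).clm_apply hw, fun v => ?_⟩
  simp only [add_apply, ContinuousLinearMap.flip_apply, ContinuousLinearMap.comp_apply]
  ring

theorem hasFDerivAt_smul_apply {s : E → ℝ} {s' : E →L[ℝ] ℝ} {G : E → F} {G' : E →L[ℝ] F} {x : E}
    (hs : HasFDerivAt s s' x) (hG : HasFDerivAt G G' x) :
    HasFDerivAt (fun z => s z • G z) (s x • G' + s'.smulRight (G x)) x :=
  hs.smul hG

end ProductRules

/-! ### Weyl structures under coordinate changes and along the null direction -/

section WeylTransition

variable {n : ℕ}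

/-- Weyl structures are invariant under changes of coordinates. -/
theorem IsWeylAt.transition {G G' : Coord n → Coord n →L[ℝ] Coord n →L[ℝ] ℝ}
    {β β' : Coord n → Coord n →L[ℝ] ℝ} {B' : Coord n →L[ℝ] Coord n →L[ℝ] Coord n} {m c : ℝ}
    {ψ : Coord n → Coord n} {x : Coord n} (h : IsWeylAt G' β' B' m c x)
    (hψ : ContDiffAt ℝ ∞ ψ x) (hT : Function.Bijective (fderiv ℝ ψ x))
    (hG : DifferentiableAt ℝ G (ψ x)) (hβ : DifferentiableAt ℝ β (ψ x))
    (hG' : DifferentiableAt ℝ G' x) (hβ' : DifferentiableAt ℝ β' x)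
    (hGG : ∀ᶠ z in 𝓝 x, ∀ v w, G' z v w = G (ψ z) (fderiv ℝ ψ z v) (fderiv ℝ ψ z w))
    (hββ : ∀ᶠ z in 𝓝 x, ∀ v, β' z v = β (ψ z) (fderiv ℝ ψ z v)) :
    ∃ B, IsWeylAt G β B m c (ψ x) := by
  have hψd : HasFDerivAt ψ (fderiv ℝ ψ x) x := (hψ.differentiableAt (by simp)).hasFDerivAt
  have hTd : HasFDerivAt (fderiv ℝ ψ) (fderiv ℝ (fderiv ℝ ψ) x) x :=
    ((hψ.fderiv_right (m := ∞) (by simp)).differentiableAt (by simp)).hasFDerivAt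
  set T := fderiv ℝ ψ x
  set D := fderiv ℝ (fderiv ℝ ψ) x
  have hDs : ∀ u v, D u v = D v u := fun u v => hψ.isSymmSndFDerivAt (by
    rw [minSmoothness_of_isRCLikeNormedField]
    exact WithTop.coe_le_coe.2 (le_top (a := (2 : ℕ∞)))) u v
  let S : Coord n →L[ℝ] Coord n :=
    ((LinearEquiv.ofBijective (T : Coord n →ₗ[ℝ] Coord n) hT).toContinuousLinearEquiv.symm :
      Coord n →L[ℝ] Coord n)
  have hTS : ∀ v, T (S v) = v := fun v =>
    (LinearEquiv.ofBijective (T : Coord n →ₗ[ℝ] Coord n) hT).apply_symm_apply v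
  have hb : ∀ u v, fderiv ℝ β' x u v = fderiv ℝ β (ψ x) (T u) (T v) + β (ψ x) (D u v) := by
    intro u v
    have h1 := ((hβ.hasFDerivAt.comp x hψd).clm_apply
      (hTd.clm_apply (hasFDerivAt_const v x)))
    have h2 : HasFDerivAt (fun z => β' z v) _ x :=
      hβ'.hasFDerivAt.clm_apply (hasFDerivAt_const v x)
    have h3 := h2.unique (h1.congr_of_eventuallyEq (hββ.mono fun z hz => hz v))
    have h4 := DFunLike.congr_fun h3 u
    simpa [add_comm] using h4
  have hg : ∀ u v w, fderiv ℝ G' x u v w = fderiv ℝ G (ψ x) (T u) (T v) (T w) +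
      G (ψ x) (D u v) (T w) + G (ψ x) (T v) (D u w) := by
    intro u v w
    have hGψ : HasFDerivAt (fun z => G (ψ z)) ((fderiv ℝ G (ψ x)).comp T) x :=
      HasFDerivAt.comp (G := Coord n →L[ℝ] Coord n →L[ℝ] ℝ) (g := G) x hG.hasFDerivAt hψd
    obtain ⟨L, hL, hL'⟩ := exists_hasFDerivAt_bilinear_apply hGψ
      (hTd.clm_apply (hasFDerivAt_const v x)) (hTd.clm_apply (hasFDerivAt_const w x))
    obtain ⟨L₂, hL₂, hL₂'⟩ := exists_hasFDerivAt_bilinear_apply hG'.hasFDerivAt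
      (hasFDerivAt_const v x) (hasFDerivAt_const w x)
    have h3 := hL₂.unique (hL.congr_of_eventuallyEq (hGG.mono fun z hz => hz v w))
    have h4 := DFunLike.congr_fun h3 u
    rw [hL', hL₂'] at h4
    simpa using h4
  have hβ₀ : ∀ v, β' x v = β (ψ x) (T v) := hββ.self_of_nhds
  have hG₀ : ∀ v w, G' x v w = G (ψ x) (T v) (T w) := hGG.self_of_nhds
  -- The transformation law of connection coefficients, with inhomogeneous term the second
  -- derivative of `ψ`. The scalar `c` is unchanged.
  let B : Coord n →L[ℝ] Coord n →L[ℝ] Coord n :=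
    ((ContinuousLinearMap.compL ℝ (Coord n) (Coord n) (Coord n) T).comp B' - D).bilinearComp S S
  have hB : ∀ v w, B v w = T (B' (S v) (S w)) - D (S v) (S w) := fun v w => by
    simp [B, ContinuousLinearMap.bilinearComp_apply]
  refine ⟨B, fun v w => ?_, fun v w => ?_, fun u v w => ?_⟩
  · rw [hB, hB, h.symm, hDs]
  · have h1 := h.form (S v) (S w)
    rw [hb, hβ₀, hβ₀, hβ₀, hTS, hTS] at h1
    rw [hB, map_sub]
    linarith
  · have h1 := h.metric (S u) (S v) (S w)
    rw [hg, hβ₀, hG₀, hG₀, hG₀, hTS, hTS, hTS] at h1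
    rw [hB, hB, map_sub, map_sub, sub_apply]
    linarith

/-- The derivative of the metric along the vector dual to `-β`. -/
theorem IsWeylAt.fderiv_dual {G : Coord n → Coord n →L[ℝ] Coord n →L[ℝ] ℝ}
    {β : Coord n → Coord n →L[ℝ] ℝ} {B : Coord n →L[ℝ] Coord n →L[ℝ] Coord n} {m c : ℝ}
    {x V : Coord n} (h : IsWeylAt G β B m c x) (hG : ∀ v w, G x v w = G x w v)
    (hβ : fderiv ℝ β x = 0) (hV : ∀ w, G x V w = -β x w) (hβV : β x V = 0)
    (hGV : ∀ u w, fderiv ℝ G x u V w = 0) (p q : Coord n) :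
    fderiv ℝ G x V p q = 2 * (m - 1) * c * β x p * β x q := by
  -- As `β` and `G(V,·)` have vanishing derivative, the form equation gives `β(B q p) = -(1 + m) c
  -- β(q) β(p)`, and the metric equation adds `2m c β(q) β(p)` to it.
  have key : ∀ p q, G x (B V q) p = (m - 1) * c * β x q * β x p := by
    intro p q
    have w1 := h.form q p
    have w2 := h.metric q V p
    rw [hβ] at w1
    simp only [zero_apply] at w1
    rw [hGV, hV, hV, h.symm q V] at w2
    linarith
  rw [h.metric, key q p, hG p, key p q, hβV]
  ring

end WeylTransition

/-! ### Adapted charts and the conformal metric -/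

section Adapted

/-- A chart with coordinates `(u, v, x³, …)` in which `b = du` and `a(∂ᵥ, ·) = -du`. -/
structure IsNullChart {d : ℕ} {M : Type*} [TopologicalSpace M] [ChartedSpace (Coord (d + 2)) M]
    (a : TwoTensor (d + 2) M) (b : OneForm (d + 2) M)
    (e : OpenPartialHomeomorph M (Coord (d + 2))) : Prop where
  mem : e ∈ charts (d + 2) M
  form : ∀ x ∈ e.target, ∀ y : Coord (d + 2), linForm b e x y = y 0
  metric : ∀ x ∈ e.target, ∀ y : Coord (d + 2),
    metricForm a e x (EuclideanSpace.single 1 1) y = -y 0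

variable {d : ℕ} {M : Type*} [TopologicalSpace M] [ChartedSpace (Coord (d + 2)) M]
  {a : TwoTensor (d + 2) M} {b : OneForm (d + 2) M}
  {e : OpenPartialHomeomorph M (Coord (d + 2))}
  {H : ℝ → (Fin d → ℝ) → ℝ} {φ : ℝ → ℝ} {W : ℝ → (Fin d → ℝ) → Fin d → ℝ}
  {h : ℝ → (Fin d → ℝ) → Matrix (Fin d) (Fin d) ℝ}

theorem transverse_add_smul_single (z : Coord (d + 2)) (t : ℝ) :
    transverse (z + t • EuclideanSpace.single 1 1) = transverse z := by
  ext r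
  have : (r.succ.succ : Fin (d + 2)) ≠ 1 := by
    rw [Ne, Fin.ext_iff]
    simp
  simp [transverse, this]

theorem add_smul_single_zero (z : Coord (d + 2)) (t : ℝ) :
    (z + t • EuclideanSpace.single 1 1 : Coord (d + 2)) 0 = z 0 := by
  simp

theorem add_smul_single_one (z : Coord (d + 2)) (t : ℝ) :
    (z + t • EuclideanSpace.single 1 1 : Coord (d + 2)) 1 = z 1 + t := by
  simp

theorem IsAdaptedChart.linForm_eq (hA : IsAdaptedChart a b e H φ W h) {x : Coord (d + 2)}
    (hx : x ∈ e.target) (y : Coord (d + 2)) : linForm b e x y = y 0 := by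
  rw [linForm_apply, hA.form_eq x hx]

theorem IsAdaptedChart.metricForm_diag (hA : IsAdaptedChart a b e H φ W h) {x : Coord (d + 2)}
    (hx : x ∈ e.target) (y : Coord (d + 2)) : metricForm a e x y y =
      -2 * y 0 * y 1 + (H (x 0) (transverse x) + φ (x 0) * x 1) * y 0 ^ 2
        + ∑ r, W (x 0) (transverse x) r * y 0 * transverse y r
        + ∑ r, ∑ s, h (x 0) (transverse x) r s * transverse y r * transverse y s := by
  rw [metricForm_apply, hA.metric_eq x hx]

theorem IsAdaptedChart.metricForm_single_one (hA : IsAdaptedChart a b e H φ W h)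
    {x : Coord (d + 2)} (hs : ∀ v w, metricForm a e x v w = metricForm a e x w v)
    (hx : x ∈ e.target) (z : Coord (d + 2)) :
    metricForm a e x (EuclideanSpace.single 1 1) z = -z 0 := by
  have h1 := hA.metricForm_diag hx (z + (1 : ℝ) • EuclideanSpace.single 1 1)
  have h2 := hA.metricForm_diag hx (0 + (1 : ℝ) • EuclideanSpace.single 1 1)
  rw [transverse_add_smul_single, add_smul_single_zero, add_smul_single_one] at h1 h2
  have h3 := hA.metricForm_diag hx z
  have h4 : transverse (0 : Coord (d + 2)) = 0 := rfl
  rw [h4] at h2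
  simp only [one_smul, map_add, add_apply, zero_add, PiLp.zero_apply, Pi.zero_apply, mul_zero,
    Finset.sum_const_zero, add_zero, zero_mul, ne_eq, OfNat.ofNat_ne_zero, not_false_eq_true,
    zero_pow] at h1 h2
  rw [hs z (EuclideanSpace.single 1 1)] at h1
  linarith

/-- Only `φ(u) v du²` depends on `v`, and it is affine in `v`; polarization passes from the
quadratic form to the bilinear one. -/
theorem IsAdaptedChart.fderiv_metricForm_single_one (hA : IsAdaptedChart a b e H φ W h)
    {x : Coord (d + 2)} (hd : DifferentiableAt ℝ (metricForm a e) x)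
    (hs : ∀ v w, fderiv ℝ (metricForm a e) x (EuclideanSpace.single 1 1) v w =
      fderiv ℝ (metricForm a e) x (EuclideanSpace.single 1 1) w v)
    (hx : x ∈ e.target) (p q : Coord (d + 2)) :
    fderiv ℝ (metricForm a e) x (EuclideanSpace.single 1 1) p q = φ (x 0) * p 0 * q 0 := by
  have hdiag : ∀ p, fderiv ℝ (metricForm a e) x (EuclideanSpace.single 1 1) p p =
      φ (x 0) * p 0 * p 0 := by
    intro p
    have hl : HasDerivAt (fun t : ℝ => x + t • EuclideanSpace.single (1 : Fin (d + 2)) (1 : ℝ))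
        (EuclideanSpace.single 1 1) 0 := by
      simpa using ((hasDerivAt_id (0 : ℝ)).smul_const
        (EuclideanSpace.single (1 : Fin (d + 2)) (1 : ℝ))).const_add x
    obtain ⟨L, hL, hL'⟩ := exists_hasFDerivAt_bilinear_apply hd.hasFDerivAt
      (hasFDerivAt_const p x) (hasFDerivAt_const p x)
    have hL₀ : HasFDerivAt (fun z => metricForm a e z p p) L
        (x + (0 : ℝ) • EuclideanSpace.single (1 : Fin (d + 2)) (1 : ℝ)) := by
      simpa using hL
    have h1 := hL₀.comp_hasDerivAt 0 hl
    have h2 : HasDerivAt (fun t : ℝ => metricForm a e x p p + t * (φ (x 0) * p 0 * p 0))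
        (1 * (φ (x 0) * p 0 * p 0)) 0 := ((hasDerivAt_id (0 : ℝ)).mul_const _).const_add _
    have hev : (fun t : ℝ => metricForm a e
        (x + t • EuclideanSpace.single (1 : Fin (d + 2)) (1 : ℝ)) p p) =ᶠ[𝓝 0]
        fun t => metricForm a e x p p + t * (φ (x 0) * p 0 * p 0) := by
      have hc : ContinuousAt
          (fun t : ℝ => x + t • EuclideanSpace.single (1 : Fin (d + 2)) (1 : ℝ)) 0 :=
        hl.continuousAt
      have hmem := hc.eventually (e.open_target.mem_nhds (by simpa using hx))
      filter_upwards [hmem] with t ht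
      rw [hA.metricForm_diag ht, hA.metricForm_diag hx, transverse_add_smul_single,
        add_smul_single_zero, add_smul_single_one]
      ring
    have h3 := h1.unique (h2.congr_of_eventuallyEq hev)
    rw [hL'] at h3
    simpa using h3
  let r : Coord (d + 2) →L[ℝ] Coord (d + 2) →L[ℝ] ℝ :=
    fderiv ℝ (metricForm a e) x (EuclideanSpace.single 1 1) -
      φ (x 0) • (coordProj 0).smulRight (coordProj 0)
  have hr : ∀ v w, r v w = fderiv ℝ (metricForm a e) x (EuclideanSpace.single 1 1) v w -
      φ (x 0) * v 0 * w 0 := fun v w => by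
    simp [r, mul_assoc]
  have h0 := bilin_eq_zero_of_diag (r := r) (S := ⊤) (fun v w => by rw [hr, hr, hs]; ring)
    (fun v _ => by rw [hr, hdiag]; ring) (v := p) (w := q) trivial trivial
  rw [hr] at h0
  linarith

/-- In a null chart `b` and `a(∂ᵥ,·)` have constant components, so `IsWeylAt.fderiv_dual` applies
with `V = ∂ᵥ`. -/
theorem IsNullChart.fderiv_metricForm_single_one (hN : IsNullChart a b e) {x : Coord (d + 2)}
    (hd : DifferentiableAt ℝ (metricForm a e) x)
    (hs : ∀ v w, metricForm a e x v w = metricForm a e x w v)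
    (hx : x ∈ e.target) {B : Coord (d + 2) →L[ℝ] Coord (d + 2) →L[ℝ] Coord (d + 2)} {m c : ℝ}
    (hw : IsWeylAt (metricForm a e) (linForm b e) B m c x) (p q : Coord (d + 2)) :
    fderiv ℝ (metricForm a e) x (EuclideanSpace.single 1 1) p q =
      2 * (m - 1) * c * p 0 * q 0 := by
  have hβ : fderiv ℝ (linForm b e) x = 0 := by
    have : linForm b e =ᶠ[𝓝 x] fun _ => linForm b e x := by
      filter_upwards [e.open_target.mem_nhds hx] with z hz
      ext y
      rw [hN.form z hz, hN.form x hx]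
    rw [this.fderiv_eq]
    simp
  have hG : ∀ u w, fderiv ℝ (metricForm a e) x u (EuclideanSpace.single 1 1) w = 0 := by
    intro u w
    obtain ⟨L, hL, hL'⟩ := exists_hasFDerivAt_bilinear_apply hd.hasFDerivAt
      (hasFDerivAt_const (EuclideanSpace.single (1 : Fin (d + 2)) (1 : ℝ)) x)
      (hasFDerivAt_const w x)
    have hev : (fun z => metricForm a e z (EuclideanSpace.single 1 1) w) =ᶠ[𝓝 x]
        fun _ => -w 0 := by
      filter_upwards [e.open_target.mem_nhds hx] with z hz using hN.metric z hz w
    have h2 := hL.unique ((hasFDerivAt_const (-w 0) x).congr_of_eventuallyEq hev)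
    have h3 := DFunLike.congr_fun h2 u
    rw [hL'] at h3
    simpa using h3
  have h1 := hw.fderiv_dual hs hβ (V := EuclideanSpace.single 1 1)
    (fun w => by rw [hN.metric x hx, hN.form x hx]) (by rw [hN.form x hx]; simp) hG p q
  rw [h1, hN.form x hx, hN.form x hx]

/-- The adapted form and the Weyl equations both compute `∂ᵥa(∂ᵤ,∂ᵤ)`; this ties the profile `φ` to
the Weyl coefficient. -/
theorem IsAdaptedChart.eq_of_isWeylAt (hA : IsAdaptedChart a b e H φ W h)
    {x : Coord (d + 2)} (hd : ∀ x ∈ e.target, DifferentiableAt ℝ (metricForm a e) x)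
    (hs : ∀ x ∈ e.target, ∀ v w, metricForm a e x v w = metricForm a e x w v)
    (hds : ∀ v w, fderiv ℝ (metricForm a e) x (EuclideanSpace.single 1 1) v w =
      fderiv ℝ (metricForm a e) x (EuclideanSpace.single 1 1) w v)
    (hx : x ∈ e.target) {B : Coord (d + 2) →L[ℝ] Coord (d + 2) →L[ℝ] Coord (d + 2)} {m c : ℝ}
    (hw : IsWeylAt (metricForm a e) (linForm b e) B m c x) : φ (x 0) = 2 * (m - 1) * c := by
  have hN : IsNullChart a b e :=
    ⟨hA.mem, fun x hx => hA.linForm_eq hx, fun x hx => hA.metricForm_single_one (hs x hx) hx⟩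
  have h1 := hN.fderiv_metricForm_single_one (hd x hx) (hs x hx) hx hw
    (EuclideanSpace.single 0 1) (EuclideanSpace.single 0 1)
  rw [hA.fderiv_metricForm_single_one (hd x hx) hds hx] at h1
  simpa using h1

theorem isOpen_image_coordProj {M : Type*} [TopologicalSpace M]
    (e : OpenPartialHomeomorph M (Coord (d + 2))) :
    IsOpen ((fun x : Coord (d + 2) => x 0) '' e.target) := by
  have h1 : IsOpenMap (coordProj (n := d + 2) 0) := by
    refine (coordProj (n := d + 2) 0).isOpenMap fun t => ⟨EuclideanSpace.single 0 t, ?_⟩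
    simp
  exact h1 _ e.open_target

/-- Smoothness of `x ↦ φ (x 0)` restricts to the line in the `u` direction through a point of the
target. -/
theorem IsAdaptedChart.contDiffOn_potential (hA : IsAdaptedChart a b e H φ W h) :
    ContDiffOn ℝ ∞ φ ((fun x : Coord (d + 2) => x 0) '' e.target) := by
  rintro _ ⟨x, hx, rfl⟩
  refine ContDiffAt.contDiffWithinAt ?_
  have h1 : ContDiffAt ℝ ∞
      (fun t : ℝ => x + (t - x 0) • EuclideanSpace.single (0 : Fin (d + 2)) (1 : ℝ)) (x 0) := by
    fun_prop
  have h2 := (hA.smooth_φ x hx).contDiffAt (e.open_target.mem_nhds hx)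
  have h3 := ContDiffAt.comp (x 0) (by simpa using h2) h1
  refine h3.congr_of_eventuallyEq (Eventually.of_forall fun t => ?_)
  simp

theorem IsAdaptedChart.exists_isIndefiniteIntegral (hA : IsAdaptedChart a b e H φ W h) :
    ∃ Φ, IsIndefiniteIntegral e φ Φ := by
  obtain ⟨Φ, hΦ⟩ := exists_antiderivative (isOpen_image_coordProj e)
    hA.contDiffOn_potential.continuousOn
  exact ⟨Φ, fun x hx => hΦ _ ⟨x, hx, rfl⟩⟩

theorem IsAdaptedChart.contDiffAt_integral (hA : IsAdaptedChart a b e H φ W h) {Φ : ℝ → ℝ}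
    (hΦ : IsIndefiniteIntegral e φ Φ) {x : Coord (d + 2)} (hx : x ∈ e.target) :
    ContDiffAt ℝ ∞ Φ (x 0) :=
  (contDiffOn_of_hasDerivAt (isOpen_image_coordProj e) hA.contDiffOn_potential
    (by rintro _ ⟨x, hx, rfl⟩; exact hΦ x hx)).contDiffAt
    ((isOpen_image_coordProj e).mem_nhds ⟨x, hx, rfl⟩)

/-- The conformal factor in a chart. -/
noncomputable def conformalFactor (m : ℝ) (Φ : ℝ → ℝ) (e e' : OpenPartialHomeomorph M (Coord (d + 2)))
    (x : Coord (d + 2)) : ℝ :=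
  Real.exp (m / (1 - m) * Φ (e (e'.symm x) 0))

theorem comp2_conformalMetric (a : TwoTensor (d + 2) M) (m : ℝ)
    (e e' : OpenPartialHomeomorph M (Coord (d + 2))) (Φ : ℝ → ℝ) (i j : Fin (d + 2))
    (x : Coord (d + 2)) : comp2 (conformalMetric a m e Φ) e' i j x =
      conformalFactor m Φ e e' x * comp2 a e' i j x := rfl

theorem metricForm_conformalMetric (a : TwoTensor (d + 2) M) (m : ℝ)
    (e e' : OpenPartialHomeomorph M (Coord (d + 2))) (Φ : ℝ → ℝ) (x : Coord (d + 2)) :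
    metricForm (conformalMetric a m e Φ) e' x = conformalFactor m Φ e e' x • metricForm a e' x := by
  simp only [metricForm, comp2_conformalMetric, Finset.smul_sum, smul_smul]

theorem IsAdaptedChart.conformalFactor_contDiffAt (hA : IsAdaptedChart a b e H φ W h) {Φ : ℝ → ℝ}
    (hΦ : IsIndefiniteIntegral e φ Φ) {m : ℝ} {e' : OpenPartialHomeomorph M (Coord (d + 2))}
    (he' : e' ∈ charts (d + 2) M) {x : Coord (d + 2)} (hx : x ∈ e'.target)
    (hx' : e'.symm x ∈ e.source) : ContDiffAt ℝ ∞ (conformalFactor m Φ e e') x := by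
  have h1 : ContDiffAt ℝ ∞ (fun z => e (e'.symm z) 0) x :=
    (coordProj (n := d + 2) 0).contDiff.contDiffAt.comp x
      (transition_contDiffAt hA.mem he' hx hx')
  have h2 := hA.contDiffAt_integral hΦ (e.map_source hx')
  exact (contDiffAt_const.mul (ContDiffAt.comp x h2 h1)).exp

/-- Because `b = du`, the differential of `u` in any other chart is again the coordinate expression
of `b`. -/
theorem IsAdaptedChart.hasFDerivAt_conformalFactor (hA : IsAdaptedChart a b e H φ W h) {Φ : ℝ → ℝ}
    (hΦ : IsIndefiniteIntegral e φ Φ) {m : ℝ} {e' : OpenPartialHomeomorph M (Coord (d + 2))}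
    (he' : e' ∈ charts (d + 2) M) {x : Coord (d + 2)} (hx : x ∈ e'.target)
    (hx' : e'.symm x ∈ e.source) : HasFDerivAt (conformalFactor m Φ e e')
      ((conformalFactor m Φ e e' x * (m / (1 - m) * φ (e (e'.symm x) 0))) • linForm b e' x) x := by
  have h1 := ((coordProj (n := d + 2) 0).hasFDerivAt).comp x
    ((transition_contDiffAt hA.mem he' hx hx').differentiableAt (by simp)).hasFDerivAt
  have h2 := ((((hΦ _ (e.map_source hx')).comp_hasFDerivAt x h1)).const_mul (m / (1 - m))).exp
  refine h2.congr_fderiv ?_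
  ext v
  have hv : linForm b e' x v = fderiv ℝ (fun z => e (e'.symm z)) x v 0 := by
    rw [linForm_transition b hA.mem he' hx hx', hA.linForm_eq (e.map_source hx')]
  simp [conformalFactor, mul_assoc, hv]

theorem IsAdaptedChart.isPseudoRiemannianOn_conformalMetric (hA : IsAdaptedChart a b e H φ W h)
    (ha : IsPseudoRiemannianOn a univ) {Φ : ℝ → ℝ} (hΦ : IsIndefiniteIntegral e φ Φ) (m : ℝ) :
    IsPseudoRiemannianOn (conformalMetric a m e Φ) e.source where
  symm p _ v w := congrArg _ (ha.symm p trivial v w)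
  nondegenerate p _ v hv := ha.nondegenerate p trivial v fun w =>
    (mul_eq_zero.1 (hv w)).resolve_left (Real.exp_pos _).ne'
  smooth e' he' i j x hx := by
    have h1 := hA.conformalFactor_contDiffAt hΦ (m := m) he' hx.1 hx.2
    have h2 := (ha.smooth e' he' i j).contDiffAt
      (by simpa using e'.open_target.mem_nhds hx.1)
    exact (h1.mul h2).contDiffWithinAt

/-- With `φ = 2(m - 1) c` the conformal factor `s` satisfies `ds = -2m c s b`, which cancels `∇a =
2m c b⊗a`. A torsion-free connection with `∇(s a) = 0` is the Levi-Civita connection. -/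
theorem IsAdaptedChart.isMetrizedOn_conformalMetric [IsManifold (𝓡 (d + 2)) ∞ M]
    (hA : IsAdaptedChart a b e H φ W h)
    (hdim : 2 < d + 2) {m : ℝ} (hm : m ≠ 0) {A : Set (TangentBundle (𝓡 (d + 2)) M)}
    {F : TangentBundle (𝓡 (d + 2)) M → ℝ} (hF : IsKropinaSpace a b m A F)
    (hclosed : IsClosedOneForm b) (hnull : IsNull a b) {Γ : ConnectionCoeffs (d + 2) M}
    (hΓ : IsBerwaldWithConnection A F Γ) {Φ : ℝ → ℝ} (hΦ : IsIndefiniteIntegral e φ Φ) :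
    IsMetrizedOn Γ (conformalMetric a m e Φ) e.source := by
  intro e' he' x hx hx'
  obtain ⟨c, hw⟩ := exists_isWeylAt hdim hm hF hclosed hΓ he' hx
  have hψ := transition_contDiffAt hA.mem he' hx hx'
  have hy := e.map_source hx'
  have hev : ∀ᶠ z in 𝓝 x, z ∈ e'.target ∧ e'.symm z ∈ e.source :=
    (e'.isOpen_inter_preimage_symm e.open_source).mem_nhds ⟨hx, hx'⟩
  have hT : Function.Bijective (fderiv ℝ (fun z => e (e'.symm z)) x) := by
    have h1 := coordVec_bijective he' hx
    have h2 := coordVec_bijective hA.mem hy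
    refine (Function.Bijective.of_comp_iff' h2 _).1 ?_
    have h3 : (coordVec e' x : Coord (d + 2) → Coord (d + 2)) = (coordVec e (e (e'.symm x))) ∘
        (fderiv ℝ (fun z => e (e'.symm z)) x) :=
      funext fun y => coordVec_transition hA.mem he' hx hx' y
    rw [← h3]
    exact h1
  have hd : ∀ {e : OpenPartialHomeomorph M (Coord (d + 2))}, e ∈ charts (d + 2) M →
      ∀ x ∈ e.target, DifferentiableAt ℝ (metricForm a e) x :=
    fun he x hx => (metricForm_contDiffAt_of hF he hx).differentiableAt (by simp)
  have hdl : ∀ {e : OpenPartialHomeomorph M (Coord (d + 2))}, e ∈ charts (d + 2) M →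
      ∀ x ∈ e.target, DifferentiableAt ℝ (linForm b e) x :=
    fun he x hx => (linForm_contDiffAt_of hF he hx).differentiableAt (by simp)
  -- The structure is moved to the adapted chart only to read off `c`; the transported connection
  -- `B` need not be identified with `Γ e`.
  obtain ⟨B, hB⟩ := hw.transition hψ hT (hd hA.mem _ hy) (hdl hA.mem _ hy) (hd he' x hx)
    (hdl he' x hx)
    (hev.mono fun z hz => metricForm_transition a hA.mem he' hz.1 hz.2)
    (hev.mono fun z hz => linForm_transition b hA.mem he' hz.1 hz.2)
  have hφ := hA.eq_of_isWeylAt (hd hA.mem) (fun x _ => metricForm_symm hF x)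
    (fun v w => fderiv_metricForm_symm hF hA.mem hy _ v w) hy hB
  have hs := hA.hasFDerivAt_conformalFactor hΦ (m := m) he' hx hx'
  have hm1 := one_sub_ne_zero_of_kropina hF hnull he' hx
  have hpr := hA.isPseudoRiemannianOn_conformalMetric hF.metric hΦ m
  have hfun : metricForm (conformalMetric a m e Φ) e' =
      fun z => conformalFactor m Φ e e' z • metricForm a e' z :=
    funext fun z => metricForm_conformalMetric a m e e' Φ z
  have hD := hasFDerivAt_smul_apply (F := Coord (d + 2) →L[ℝ] Coord (d + 2) →L[ℝ] ℝ) hs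
    (hd he' x hx).hasFDerivAt
  refine eq_christoffel (sqCoord_horizontally_constant hF hΓ he' hx).1 (fun v w => ?_) ?_ ?_ ?_
  · simp only [hfun, smul_apply, metricForm_symm hF x v w]
  · rw [hfun]
    exact hD.differentiableAt
  · exact compMatrix_det_ne_zero fun v hv => metricForm_nondegenerate hpr he' hx hx' hv
  · intro u v w
    rw [hfun, hD.fderiv]
    simp only [add_apply, smul_apply, ContinuousLinearMap.smulRight_apply, smul_eq_mul,
      hw.metric u v w, hφ]
    field_simp
    ring

end Adapted

/-! ### The null vector field dual to the 1-form -/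

section DualVector

variable {n : ℕ} {M : Type*} [TopologicalSpace M] [ChartedSpace (Coord n) M]
  {a : TwoTensor n M} {b : OneForm n M} {e : OpenPartialHomeomorph M (Coord n)}

/-- The vector field dual to `-b`. -/
noncomputable def negDual (a : TwoTensor n M) (b : OneForm n M)
    (e : OpenPartialHomeomorph M (Coord n)) (x : Coord n) : Coord n :=
  ∑ i, (-∑ j, comp1 b e j x * (compMatrix a e x)⁻¹ j i) • EuclideanSpace.single i (1 : ℝ)

theorem metricForm_negDual {x : Coord n} (hdet : (compMatrix a e x).det ≠ 0) (w : Coord n) :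
    metricForm a e x (negDual a b e x) w = -linForm b e x w := by
  have h : metricForm a e x (negDual a b e x) = -linForm b e x := by
    refine ContinuousLinearMap.coe_injective
      ((EuclideanSpace.basisFun (Fin n) ℝ).toBasis.ext fun k => ?_)
    have h1 : ∀ j, ∑ i, (compMatrix a e x)⁻¹ j i * comp2 a e i k x =
        (1 : Matrix (Fin n) (Fin n) ℝ) j k := fun j => by
      rw [← Matrix.nonsing_inv_mul _ hdet.isUnit, Matrix.mul_apply]
      rfl
    have h2 : ∑ i, (∑ j, comp1 b e j x * (compMatrix a e x)⁻¹ j i) * comp2 a e i k x =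
        ∑ j, comp1 b e j x * ∑ i, (compMatrix a e x)⁻¹ j i * comp2 a e i k x := by
      simp only [Finset.mul_sum, Finset.sum_mul]
      rw [Finset.sum_comm]
      exact Finset.sum_congr rfl fun i _ => Finset.sum_congr rfl fun r _ => by ring
    simp only [h1, Matrix.one_apply, mul_ite, mul_one, mul_zero, Finset.sum_ite_eq',
      Finset.mem_univ, if_true] at h2
    simp [negDual, metricForm_single, linForm_single, h2]
  rw [h]
  rfl

theorem negDual_contDiffAt {x : Coord n} (hdet : (compMatrix a e x).det ≠ 0)
    (ha : ∀ i j, ContDiffAt ℝ ∞ (comp2 a e i j) x) (hb : ∀ i, ContDiffAt ℝ ∞ (comp1 b e i) x) :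
    ContDiffAt ℝ ∞ (negDual a b e) x :=
  ContDiffAt.sum fun i _ => ((ContDiffAt.sum fun j _ => (hb j).mul
    (contDiffAt_matrix_inv (g := compMatrix a e) ha hdet j i)).neg).smul contDiffAt_const

/-- The vector `-V` is dual to `b`, so nullity gives `a(V,V) = 0`, and `a(V,V) = -b(V)`. -/
theorem linForm_eq_zero_of_isNull (hnull : IsNull a b) (he : e ∈ charts n M) {x : Coord n}
    (hx : x ∈ e.target) {V : Coord n} (hV : ∀ w, metricForm a e x V w = -linForm b e x w) :
    linForm b e x V = 0 := by
  have h1 : metricForm a e x (-V) (-V) = 0 := by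
    rw [metricForm_apply]
    refine hnull _ _ fun W => ?_
    obtain ⟨w, rfl⟩ := (coordVec_bijective he hx).2 W
    rw [← metricForm_apply, ← linForm_apply, map_neg, neg_apply, hV, neg_neg]
  rw [map_neg, map_neg, neg_apply, neg_neg, hV] at h1
  linarith

theorem contDiffOn_of_hasFDerivAt {E : Type*} [NormedAddCommGroup E] [NormedSpace ℝ E] {S : Set E}
    (hS : IsOpen S) {u : E → ℝ} {β : E → E →L[ℝ] ℝ} (hβ : ContDiffOn ℝ ∞ β S)
    (h : ∀ x ∈ S, HasFDerivAt u (β x) x) : ContDiffOn ℝ ∞ u S :=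
  (contDiffOn_infty_iff_fderiv_of_isOpen hS).2
    ⟨fun x hx => (h x hx).differentiableAt.differentiableWithinAt,
      hβ.congr fun x hx => (h x hx).fderiv⟩

end DualVector

/-! ### Null charts -/

section Straighten

variable {d : ℕ} {M : Type*} [TopologicalSpace M] [ChartedSpace (Coord (d + 2)) M]
  {a : TwoTensor (d + 2) M} {b : OneForm (d + 2) M}

/-- Composition of a chart with a local diffeomorphism, restricted to a ball. -/
theorem exists_chart_ball {n : ℕ} {M : Type*} [TopologicalSpace M] [ChartedSpace (Coord n) M]
    [IsManifold (𝓡 n) ∞ M]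
    {e₀ : OpenPartialHomeomorph M (Coord n)} (he₀ : e₀ ∈ charts n M) {p : M} (hp : p ∈ e₀.source)
    (Ψ : OpenPartialHomeomorph (Coord n) (Coord n)) (hpΨ : e₀ p ∈ Ψ.source)
    (hΨ : ∀ x ∈ Ψ.source, ContDiffAt ℝ ∞ Ψ x) (hΨ' : ∀ z ∈ Ψ.target, ContDiffAt ℝ ∞ Ψ.symm z)
    {S : Set (Coord n)} (hS : IsOpen S) (hpS : e₀ p ∈ S) (hSt : S ⊆ e₀.target) :
    ∃ e ∈ charts n M, p ∈ e.source ∧ (∃ r > 0, e.target = Metric.ball (e p) r) ∧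
      ∀ x ∈ e.target, x ∈ Ψ.target ∧ Ψ.symm x ∈ S ∧ e.symm x = e₀.symm (Ψ.symm x) := by
  have hO : IsOpen (Ψ.target ∩ Ψ.symm ⁻¹' S) := Ψ.isOpen_inter_preimage_symm hS
  obtain ⟨r, hr, hball⟩ := Metric.isOpen_iff.1 hO (Ψ (e₀ p))
    ⟨Ψ.map_source hpΨ, by simpa [Ψ.left_inv hpΨ] using hpS⟩
  set e₁ := e₀.trans Ψ with he₁
  let e := (e₁.symm.restrOpen (Metric.ball (Ψ (e₀ p)) r) Metric.isOpen_ball).symm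
  have htar : e.target = Metric.ball (Ψ (e₀ p)) r := by
    change e₁.symm.source ∩ Metric.ball (Ψ (e₀ p)) r = _
    refine inter_eq_right.2 fun z hz => ?_
    have := hball hz
    simp only [he₁, OpenPartialHomeomorph.symm_source, OpenPartialHomeomorph.trans_target]
    exact ⟨this.1, hSt this.2⟩
  have hsrc : ∀ q ∈ e.source, q ∈ e₀.source ∧ e₀ q ∈ Ψ.source := by
    intro q hq
    have h1 : q ∈ e₁.source := by
      have := e.map_source hq
      have h2 : e.symm (e q) = q := e.left_inv hq
      rw [← h2]
      exact e₁.map_target (inter_subset_left this)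
    rw [he₁, OpenPartialHomeomorph.trans_source] at h1
    exact h1
  have hmem : ∀ x ∈ e.target, x ∈ Ψ.target ∧ Ψ.symm x ∈ S ∧ e.symm x = e₀.symm (Ψ.symm x) := by
    intro x hx
    rw [htar] at hx
    exact ⟨(hball hx).1, (hball hx).2, rfl⟩
  have hep : e p = Ψ (e₀ p) := rfl
  refine ⟨e, ?_, ?_, ⟨r, hr, htar⟩, hmem⟩
  · refine e.mem_maximalAtlas_of_contMDiffOn (fun q hq => ?_) fun x hx => ?_
    · obtain ⟨h1, h2⟩ := hsrc q hq
      have h3 := (contMDiffOn_of_mem_maximalAtlas he₀).contMDiffAt (e₀.open_source.mem_nhds h1)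
      exact ((hΨ _ h2).contMDiffAt.comp q h3).contMDiffWithinAt
    · obtain ⟨h1, h2, -⟩ := hmem x hx
      have h3 := (contMDiffOn_symm_of_mem_maximalAtlas he₀).contMDiffAt
        (e₀.open_target.mem_nhds (hSt h2))
      exact (h3.comp x (hΨ' _ h1).contMDiffAt).contMDiffWithinAt
  · have h1 : Ψ (e₀ p) ∈ e.target := by
      rw [htar]
      exact Metric.mem_ball_self hr
    have h2 := e.map_target h1
    have h3 : e.symm (Ψ (e₀ p)) = p := by
      rw [(hmem _ h1).2.2, Ψ.left_inv hpΨ, e₀.left_inv hp]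
    rwa [h3] at h2

/-- Coordinates `(u, v, x³, …)` on a ball with `b = du` and `a(∂ᵥ, ·) = -du`. -/
theorem exists_chart_straightening [IsManifold (𝓡 (d + 2)) ∞ M] {m : ℝ}
    {A : Set (TangentBundle (𝓡 (d + 2)) M)} {F : TangentBundle (𝓡 (d + 2)) M → ℝ}
    (hF : IsKropinaSpace a b m A F) (hclosed : IsClosedOneForm b) (hnull : IsNull a b) (p : M) :
    ∃ e, IsNullChart a b e ∧ p ∈ e.source ∧ ∃ r > 0, e.target = Metric.ball (e p) r := by
  set e₀ := chartAt (Coord (d + 2)) p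
  have he₀ : e₀ ∈ charts (d + 2) M := IsManifold.chart_mem_maximalAtlas p
  have hp : p ∈ e₀.source := mem_chart_source _ p
  have hx₀ : e₀ p ∈ e₀.target := e₀.map_source hp
  obtain ⟨ρ, hρ, hball⟩ := Metric.isOpen_iff.1 e₀.open_target _ hx₀
  have hβs : ContDiffOn ℝ ∞ (linForm b e₀) (Metric.ball (e₀ p) ρ) := fun x hx =>
    (linForm_contDiffAt_of hF he₀ (hball hx)).contDiffWithinAt
  -- The Poincaré lemma on a ball: the closed form `b` is `du`.
  obtain ⟨u, hu⟩ := (convex_ball (e₀ p) ρ).exists_forall_hasFDerivAt_of_fderiv_symmetric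
    Metric.isOpen_ball (hβs.differentiableOn (by simp))
    fun x hx v w => fderiv_linForm_symm hF hclosed he₀ (hball hx) v w
  have hus := contDiffOn_of_hasFDerivAt Metric.isOpen_ball hβs hu
  have hdet : ∀ x ∈ e₀.target, (compMatrix a e₀ x).det ≠ 0 := fun x hx =>
    compMatrix_det_ne_zero (metricForm_nondegenerate_of hF he₀ hx)
  have hVs : ∀ x ∈ e₀.target, ContDiffAt ℝ ∞ (negDual a b e₀) x := fun x hx =>
    negDual_contDiffAt (hdet x hx)
      (fun i j => (hF.metric.smooth e₀ he₀ i j).contDiffAt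
        (by simpa using e₀.open_target.mem_nhds hx))
      fun i => (hF.smooth_form e₀ he₀ i).contDiffAt (e₀.open_target.mem_nhds hx)
  have hnear : ∀ᶠ x in 𝓝 (e₀ p), x ∈ Metric.ball (e₀ p) ρ := Metric.ball_mem_nhds _ hρ
  -- The fibre of the cone is nonempty and `b(y) ≠ 0` there, so neither `b` nor its dual vector
  -- vanishes at the point.
  have hβ0 : linForm b e₀ (e₀ p) ≠ 0 := by
    obtain ⟨y, hy⟩ := coordCone_nonempty_fibre hF he₀ hx₀
    intro h0
    exact linForm_ne_zero hF hy (by simp [h0])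
  obtain ⟨Ψ, hpΨ, hΨ, hΨ'⟩ := exists_straightening (x₀ := e₀ p) (u := u) (V := negDual a b e₀)
    (hnear.mono fun x hx => hus.contDiffAt (Metric.isOpen_ball.mem_nhds hx))
    (hnear.mono fun x hx => hVs x (hball hx))
    (hnear.mono fun x hx => by
      rw [(hu x hx).fderiv]
      exact linForm_eq_zero_of_isNull hnull he₀ (hball hx) (metricForm_negDual (hdet x (hball hx))))
    (by rwa [(hu _ hnear.self_of_nhds).fderiv])
    (fun h0 => hβ0 (by
      ext w
      have := metricForm_negDual (b := b) (hdet _ hx₀) w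
      rw [h0] at this
      simpa using this.symm))
  obtain ⟨e, he, hpe, hr, hmem⟩ := exists_chart_ball he₀ hp Ψ hpΨ (fun x hx => (hΨ x hx).1)
    (fun z hz => (hΨ' z hz).1) Metric.isOpen_ball hnear.self_of_nhds hball
  suffices key : ∀ x ∈ e.target, ∀ y : Coord (d + 2), linForm b e x y = y 0 ∧
      metricForm a e x (EuclideanSpace.single 1 1) y = -y 0 from
    ⟨e, ⟨he, fun x hx y => (key x hx y).1, fun x hx y => (key x hx y).2⟩, hpe, hr⟩
  intro x hx y
  obtain ⟨h1, h2, h3⟩ := hmem x hx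
  have hsrc : ∀ z ∈ e.target, e.symm z ∈ e₀.source := fun z hz => by
    rw [(hmem z hz).2.2]
    exact e₀.map_target (hball (hmem z hz).2.1)
  have hψ : (fun z => e₀ (e.symm z)) =ᶠ[𝓝 x] Ψ.symm := by
    filter_upwards [e.open_target.mem_nhds hx] with z hz
    rw [(hmem z hz).2.2, e₀.right_inv (hball (hmem z hz).2.1)]
  have hψx : e₀ (e.symm x) = Ψ.symm x := hψ.self_of_nhds
  have hβ : ∀ y, linForm b e x y = y 0 := by
    intro y
    rw [linForm_transition b he₀ he hx (hsrc x hx), hψ.fderiv_eq, hψx,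
      ← (hu _ h2).fderiv]
    have h4 := (hu _ h2).differentiableAt.hasFDerivAt.comp x
      ((hΨ' x h1).1.differentiableAt (by simp)).hasFDerivAt
    have h5 : HasFDerivAt (u ∘ Ψ.symm) (coordProj 0) x := by
      refine (coordProj (n := d + 2) 0).hasFDerivAt.congr_of_eventuallyEq ?_
      filter_upwards [Ψ.open_target.mem_nhds h1] with z hz
      simp only [Function.comp_apply]
      rw [← (hΨ _ (Ψ.map_target hz)).2, Ψ.right_inv hz]
      simp
    have h6 := DFunLike.congr_fun (h4.unique h5) y
    simpa using h6
  refine ⟨hβ y, ?_⟩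
  rw [← hβ y, metricForm_transition a he₀ he hx (hsrc x hx),
    linForm_transition b he₀ he hx (hsrc x hx), hψ.fderiv_eq, hψx, (hΨ' x h1).2,
    metricForm_negDual (hdet _ (hball h2))]

end Straighten

/-! ### Integration to the adapted form -/

section NormalForm

variable {d : ℕ} {M : Type*} [TopologicalSpace M] [ChartedSpace (Coord (d + 2)) M]
  {a : TwoTensor (d + 2) M} {b : OneForm (d + 2) M}
  {e : OpenPartialHomeomorph M (Coord (d + 2))}

theorem eq_of_fderiv_sub_eq_zero {E : Type*} [NormedAddCommGroup E] [NormedSpace ℝ E] {S : Set E}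
    (hS : Convex ℝ S) {f : E → ℝ} (hf : ∀ z ∈ S, DifferentiableAt ℝ f z) {x y : E} (hx : x ∈ S)
    (hy : y ∈ S) (h : ∀ z ∈ S, fderiv ℝ f z (y - x) = 0) : f y = f x := by
  obtain ⟨z, hz, hz'⟩ := domain_mvt
    (fun z hz => (hf z hz).hasFDerivAt.hasFDerivWithinAt) hS hx hy
  rw [h z (hS.segment_subset hx hy hz)] at hz'
  linarith

/-- A Euclidean ball stays stable when coordinates move towards those of the centre. This is what
allows `v`, or all coordinates but `u`, to be frozen at their central values. -/
theorem mem_ball_of_abs_le {n : ℕ} {x₀ x y : Coord n} {r : ℝ} (hx : x ∈ Metric.ball x₀ r)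
    (h : ∀ i, |y i - x₀ i| ≤ |x i - x₀ i|) : y ∈ Metric.ball x₀ r := by
  rw [mem_ball_iff_norm] at hx ⊢
  refine lt_of_le_of_lt ?_ hx
  rw [EuclideanSpace.norm_eq, EuclideanSpace.norm_eq]
  exact Real.sqrt_le_sqrt (Finset.sum_le_sum fun i _ => by
    simpa using sq_le_sq.2 (by simpa using h i))

/-- The point with coordinates `(u, v, x³, …)`, where `x = (x³, …)`. -/
noncomputable def slicePoint (u v : ℝ) (x : Fin d → ℝ) : Coord (d + 2) :=
  WithLp.toLp 2 (Fin.cons u (Fin.cons v x : Fin (d + 1) → ℝ) : Fin (d + 2) → ℝ)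

theorem slicePoint_transverse (x : Coord (d + 2)) (v : ℝ) :
    slicePoint (x 0) v (transverse x) = x + (v - x 1) • EuclideanSpace.single 1 1 := by
  ext i
  refine Fin.cases ?_ (fun j => Fin.cases ?_ (fun r => ?_) j) i
  · simp [slicePoint]
  · simp [slicePoint]
  · have : (r.succ.succ : Fin (d + 2)) ≠ 1 := by
      rw [Ne, Fin.ext_iff]
      simp
    simp [slicePoint, transverse, this]

theorem slicePoint_mem_ball {x₀ x : Coord (d + 2)} {r : ℝ} (hx : x ∈ Metric.ball x₀ r) :
    slicePoint (x 0) (x₀ 1) (transverse x) ∈ Metric.ball x₀ r := by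
  refine mem_ball_of_abs_le hx fun i => ?_
  rw [slicePoint_transverse]
  by_cases hi : i = 1
  · subst hi
    simp
  · simp [hi]

theorem add_smul_single_mem_ball {x₀ x : Coord (d + 2)} {r : ℝ} (hx : x ∈ Metric.ball x₀ r) :
    x₀ + (x 0 - x₀ 0) • EuclideanSpace.single 0 1 ∈ Metric.ball x₀ r := by
  refine mem_ball_of_abs_le hx fun i => ?_
  by_cases hi : i = 0
  · subst hi
    simp
  · simp [hi]

theorem IsNullChart.metricForm_diag (hN : IsNullChart a b e) {x : Coord (d + 2)}
    (hs : ∀ v w, metricForm a e x v w = metricForm a e x w v) (hx : x ∈ e.target)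
    (y : Coord (d + 2)) : metricForm a e x y y = -2 * y 0 * y 1 + comp2 a e 0 0 x * y 0 ^ 2
      + ∑ r : Fin d, 2 * comp2 a e 0 r.succ.succ x * y 0 * transverse y r
      + ∑ r : Fin d, ∑ s : Fin d, comp2 a e r.succ.succ s.succ.succ x * transverse y r *
        transverse y s := by
  have hsymm : ∀ i j, comp2 a e i j x = comp2 a e j i x := fun i j => by
    rw [← metricForm_single, ← metricForm_single, hs]
  have h1 : ∀ j, comp2 a e 1 j x = -(EuclideanSpace.single j (1 : ℝ) : Coord (d + 2)) 0 :=
    fun j => by rw [← metricForm_single, hN.metric x hx]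
  have h10 : comp2 a e 1 0 x = -1 := by
    rw [h1]
    simp
  have h1s : ∀ j : Fin (d + 1), comp2 a e 1 j.succ x = 0 := by
    intro j
    rw [h1]
    simp [(Fin.succ_ne_zero j).symm]
  have hexp : metricForm a e x y y = ∑ i, ∑ j, comp2 a e i j x * y i * y j := by
    simp [metricForm, sum_apply, mul_assoc]
  rw [hexp]
  simp only [Fin.sum_univ_succ, Fin.succ_zero_eq_one, h10, h1s, hsymm _ 1, hsymm _ 0,
    transverse, Finset.sum_add_distrib, zero_mul, Finset.sum_const_zero, add_zero, zero_add]
  have e1 : ∑ r : Fin d, comp2 a e 0 r.succ.succ x * y r.succ.succ * y 0 =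
      ∑ r : Fin d, comp2 a e 0 r.succ.succ x * y 0 * y r.succ.succ :=
    Finset.sum_congr rfl fun r _ => by ring
  have e2 : ∑ r : Fin d, 2 * comp2 a e 0 r.succ.succ x * y 0 * y r.succ.succ =
      2 * ∑ r : Fin d, comp2 a e 0 r.succ.succ x * y 0 * y r.succ.succ := by
    rw [Finset.mul_sum]
    exact Finset.sum_congr rfl fun r _ => by ring
  rw [e1, e2]
  ring

/-- A kernel vector `ξ` of the transverse block extends to the kernel vector `ξʳ∂ᵣ + ξʳa(∂ᵣ,∂ᵤ) ∂ᵥ`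
of `a`: the `∂ᵥ` part repairs the pairing with `∂ᵤ`, as `a(∂ᵥ,∂ᵤ) = -1`, and affects no other. -/
theorem IsNullChart.transverse_det_ne_zero (hN : IsNullChart a b e) {x : Coord (d + 2)}
    (hs : ∀ v w, metricForm a e x v w = metricForm a e x w v)
    (hnd : ∀ v, (∀ w, metricForm a e x v w = 0) → v = 0) (hx : x ∈ e.target) :
    (Matrix.of fun r s : Fin d => comp2 a e r.succ.succ s.succ.succ x).det ≠ 0 := by
  intro h0
  obtain ⟨ξ, hξ, hξ0⟩ := Matrix.exists_vecMul_eq_zero_iff.2 h0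
  have hse : ∀ i, metricForm a e x (EuclideanSpace.single i 1) (EuclideanSpace.single 1 1) =
      -(EuclideanSpace.single i (1 : ℝ) : Coord (d + 2)) 0 := fun i => by
    rw [hs, hN.metric x hx]
  let v : Coord (d + 2) := ∑ r : Fin d, ξ r • EuclideanSpace.single r.succ.succ (1 : ℝ) +
    (∑ r : Fin d, ξ r * comp2 a e r.succ.succ 0 x) • EuclideanSpace.single 1 1
  have hv : metricForm a e x v = 0 := by
    refine ContinuousLinearMap.coe_injective
      ((EuclideanSpace.basisFun (Fin (d + 2)) ℝ).toBasis.ext fun i => ?_)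
    refine Fin.cases ?_ (fun j => Fin.cases ?_ (fun s => ?_) j) i
    · simp [v, metricForm_single, hN.metric x hx]
    · simp [v, hse]
    · simpa [v, sum_apply, metricForm_single, hN.metric x hx, Matrix.vecMul, dotProduct] using
        congrFun hξ0 s
  have hv0 : v = 0 := hnd v fun w => by
    rw [hv]
    rfl
  refine hξ (funext fun r => ?_)
  have h1 : v r.succ.succ = 0 := by
    rw [hv0]
    rfl
  have h2 : (r.succ.succ : Fin (d + 2)) ≠ 1 := by
    rw [Ne, Fin.ext_iff]
    simp
  simpa [v, h2, Pi.single_apply] using h1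

/-- The potential `∂ᵥ a(∂ᵤ, ∂ᵤ)`. -/
noncomputable def nullPotential (a : TwoTensor (d + 2) M)
    (e : OpenPartialHomeomorph M (Coord (d + 2))) : Coord (d + 2) → ℝ :=
  pd 1 (comp2 a e 0 0)

/-- A null chart whose target is a ball is adapted as soon as `∂ᵥ a = φ du²` with `dφ ∧ du = 0`. -/
theorem IsNullChart.isAdaptedChart (hN : IsNullChart a b e)
    (ha : IsPseudoRiemannianOn a univ) {x₀ : Coord (d + 2)} {r : ℝ}
    (ht : e.target = Metric.ball x₀ r)
    (hd : ∀ x ∈ e.target, ∀ p q,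
      fderiv ℝ (metricForm a e) x (EuclideanSpace.single 1 1) p q =
        nullPotential a e x * p 0 * q 0)
    (hφ : ∀ x ∈ e.target, ∀ k, k ≠ 0 → pd k (nullPotential a e) x = 0) :
    ∃ H φ W h, IsAdaptedChart a b e H φ W h := by
  have hsm : ∀ i j, ∀ x ∈ e.target, ContDiffAt ℝ ∞ (comp2 a e i j) x := fun i j x hx =>
    (ha.smooth e hN.mem i j).contDiffAt (by simpa using e.open_target.mem_nhds hx)
  have hφs : ∀ x ∈ e.target, ContDiffAt ℝ ∞ (nullPotential a e) x := fun x hx =>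
    pd_contDiffAt (hsm 0 0 x hx) 1
  have hs : ∀ x v w, metricForm a e x v w = metricForm a e x w v := fun x v w => by
    rw [metricForm_apply, metricForm_apply]
    exact ha.symm _ trivial _ _
  have hconv : Convex ℝ e.target := by
    rw [ht]
    exact convex_ball _ _
  have hP : ∀ x ∈ e.target, slicePoint (x 0) (x₀ 1) (transverse x) ∈ e.target := fun x hx => by
    rw [ht] at hx ⊢
    exact slicePoint_mem_ball hx
  have hL : ∀ x ∈ e.target, x₀ + (x 0 - x₀ 0) • EuclideanSpace.single 0 1 ∈ e.target :=
    fun x hx => by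
      rw [ht] at hx ⊢
      exact add_smul_single_mem_ball hx
  -- In the convex target a function with `∂ᵥf = 0` equals its value on the slice where `v` is that
  -- of the centre, which exhibits it as a function of `u` and the transverse coordinates.
  have hslice : ∀ f : Coord (d + 2) → ℝ, (∀ x ∈ e.target, DifferentiableAt ℝ f x) →
      (∀ x ∈ e.target, pd 1 f x = 0) → ∀ x ∈ e.target,
      f (slicePoint (x 0) (x₀ 1) (transverse x)) = f x := by
    intro f hf hf1 x hx
    refine eq_of_fderiv_sub_eq_zero hconv hf hx (hP x hx) fun z hz => ?_
    rw [slicePoint_transverse, add_sub_cancel_left, map_smul]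
    exact smul_eq_zero_of_right _ (hf1 z hz)
  have hφc : ∀ x ∈ e.target,
      nullPotential a e (x₀ + (x 0 - x₀ 0) • EuclideanSpace.single 0 1) = nullPotential a e x := by
    intro x hx
    refine eq_of_fderiv_sub_eq_zero hconv
      (fun z hz => (hφs z hz).differentiableAt (by simp)) hx (hL x hx) fun z hz => ?_
    rw [fderiv_eq_sum_pd]
    refine Finset.sum_eq_zero fun k _ => ?_
    by_cases hk : k = 0
    · subst hk
      simp
    · rw [hφ z hz k hk, mul_zero]
  have hc : ∀ i j, ∀ x ∈ e.target, pd 1 (comp2 a e i j) x = nullPotential a e x *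
      (EuclideanSpace.single i (1 : ℝ) : Coord (d + 2)) 0 *
      (EuclideanSpace.single j (1 : ℝ) : Coord (d + 2)) 0 := by
    intro i j x hx
    rw [← hd x hx, fderiv_metricForm_single ((metricForm_contDiffAt
      fun i j => hsm i j x hx).differentiableAt (by simp))]
    rfl
  have hcz : ∀ i (j : Fin (d + 1)), ∀ x ∈ e.target,
      comp2 a e i j.succ (slicePoint (x 0) (x₀ 1) (transverse x)) = comp2 a e i j.succ x := by
    intro i j x hx
    refine hslice _ (fun z hz => (hsm _ _ z hz).differentiableAt (by simp)) (fun z hz => ?_) x hx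
    rw [hc _ _ z hz]
    simp [(Fin.succ_ne_zero j).symm]
  -- This is the coefficient `H`: subtracting `φ v` removes the dependence of `a(∂ᵤ,∂ᵤ)` on `v`,
  -- since `∂ᵥφ = 0`.
  let f : Coord (d + 2) → ℝ := fun z => comp2 a e 0 0 z - nullPotential a e z * z 1
  have hfs : ∀ x ∈ e.target, ContDiffAt ℝ ∞ f x := fun x hx =>
    (hsm 0 0 x hx).sub ((hφs x hx).mul (coordProj (n := d + 2) 1).contDiff.contDiffAt)
  have hf : ∀ x ∈ e.target, f (slicePoint (x 0) (x₀ 1) (transverse x)) = f x := by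
    refine hslice f (fun z hz => (hfs z hz).differentiableAt (by simp)) fun z hz => ?_
    have h1 : DifferentiableAt ℝ (nullPotential a e) z := (hφs z hz).differentiableAt (by simp)
    have h2 : DifferentiableAt ℝ (comp2 a e 0 0) z := (hsm 0 0 z hz).differentiableAt (by simp)
    have h3 : HasFDerivAt (fun z : Coord (d + 2) => z 1) (coordProj 1) z :=
      (coordProj (n := d + 2) 1).hasFDerivAt
    have h4 := (h2.hasFDerivAt.sub (h1.hasFDerivAt.mul h3)).fderiv
    have h5 : pd 1 (nullPotential a e) z = 0 := hφ z hz 1 (by simp)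
    have h6 := congrArg (fun L : Coord (d + 2) →L[ℝ] ℝ => L (EuclideanSpace.single 1 1)) h4
    refine h6.trans ?_
    have h7 : fderiv ℝ (comp2 a e 0 0) z (EuclideanSpace.single 1 1) = nullPotential a e z := rfl
    have h8 : fderiv ℝ (nullPotential a e) z (EuclideanSpace.single 1 1) = 0 := h5
    simp [h7, h8]
  -- All coefficients are values on the central slice, and `φ` on the `u`-line through the centre.
  -- The `2` in `W` counts the two equal mixed components.
  refine ⟨fun u w => f (slicePoint u (x₀ 1) w),
    fun u => nullPotential a e (x₀ + (u - x₀ 0) • EuclideanSpace.single 0 1),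
    fun u w r => 2 * comp2 a e 0 r.succ.succ (slicePoint u (x₀ 1) w),
    fun u w => Matrix.of fun r s => comp2 a e r.succ.succ s.succ.succ (slicePoint u (x₀ 1) w),
    hN.mem, ?_, ?_, ?_, ?_, ?_, ?_, ?_, ?_⟩
  · exact ContDiffOn.congr (fun x hx => (hfs x hx).contDiffWithinAt) hf
  · exact ContDiffOn.congr (fun x hx => (hφs x hx).contDiffWithinAt) hφc
  · exact fun r => ContDiffOn.congr
      (fun x hx => (contDiffAt_const.mul (hsm 0 r.succ.succ x hx)).contDiffWithinAt)
      fun x hx => congrArg (2 * ·) (hcz _ _ x hx)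
  · exact fun r s => ContDiffOn.congr
      (fun x hx => (hsm r.succ.succ s.succ.succ x hx).contDiffWithinAt) fun x hx => hcz _ _ x hx
  · intro x hx
    ext r s
    simp only [Matrix.transpose_apply, Matrix.of_apply]
    rw [← metricForm_single, ← metricForm_single, hs]
  · intro x hx
    exact hN.transverse_det_ne_zero (hs _)
      (fun v hv => metricForm_nondegenerate ha hN.mem (hP x hx) trivial hv) (hP x hx)
  · intro x hx y
    have hWx : ∀ r : Fin d, 2 * comp2 a e 0 r.succ.succ
        (slicePoint (x 0) (x₀ 1) (transverse x)) = 2 * comp2 a e 0 r.succ.succ x :=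
      fun r => congrArg (2 * ·) (hcz _ _ x hx)
    have hhx : ∀ r s : Fin d, comp2 a e r.succ.succ s.succ.succ
        (slicePoint (x 0) (x₀ 1) (transverse x)) = comp2 a e r.succ.succ s.succ.succ x :=
      fun r s => hcz _ _ x hx
    rw [← metricForm_apply, hN.metricForm_diag (hs x) hx]
    simp only [Matrix.of_apply, hf x hx, hφc x hx, hWx, hhx, f, sub_add_cancel]
  · intro x hx y
    rw [← linForm_apply, hN.form x hx]

/-- The log-determinant gradient of `a` is the trace of `Γ` plus a nonzero constant times `φ du`.
The first two are closed, hence so is `φ du`. -/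
theorem pd_nullPotential_eq_zero (hN : IsNullChart a b e) (ha : IsPseudoRiemannianOn a univ)
    {Γ : ConnectionCoeffs (d + 2) M} {m : ℝ} (hm : m ≠ 0) (hm1 : m - 1 ≠ 0)
    (hs : ∀ x ∈ e.target, ∀ i j k, Γ e x i j k = Γ e x i k j)
    (hΓ : ∀ i j k, ContDiffOn ℝ ∞ (fun x => Γ e x i j k) e.target)
    (hclosed : ∀ x ∈ e.target, ∀ k l,
      pd l (fun x' => ∑ i, Γ e x' i i k) x = pd k (fun x' => ∑ i, Γ e x' i i l) x)
    (hw : ∀ x ∈ e.target, IsWeylAt (metricForm a e) (linForm b e) (connBilin (Γ e x)) m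
      (nullPotential a e x / (2 * (m - 1))) x) {x : Coord (d + 2)} (hx : x ∈ e.target)
    {k : Fin (d + 2)} (hk : k ≠ 0) : pd k (nullPotential a e) x = 0 := by
  have hsm : ∀ i j, ∀ x ∈ e.target, ContDiffAt ℝ ∞ (comp2 a e i j) x := fun i j x hx =>
    (ha.smooth e hN.mem i j).contDiffAt (by simpa using e.open_target.mem_nhds hx)
  have hφd : DifferentiableAt ℝ (nullPotential a e) x :=
    (pd_contDiffAt (hsm 0 0 x hx) 1).differentiableAt (by simp)
  have hT : ∀ k, DifferentiableAt ℝ (fun x' => ∑ i, Γ e x' i i k) x := fun k =>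
    DifferentiableAt.fun_sum fun i _ =>
      ((hΓ i i k).contDiffAt (e.open_target.mem_nhds hx)).differentiableAt (by simp)
  -- This is `n/2 · 2m c / φ` with `c = φ / (2(m - 1))`.
  set K : ℝ := (d + 2 : ℕ) * m / (2 * (m - 1)) with hK
  have hK0 : K ≠ 0 := div_ne_zero (mul_ne_zero (Nat.cast_ne_zero.2 (by omega)) hm)
    (mul_ne_zero two_ne_zero hm1)
  have htr : ∀ l, logDetDeriv (compMatrix a e) l =ᶠ[𝓝 x] fun x' => ∑ i, Γ e x' i i l +
      (K * (EuclideanSpace.single l (1 : ℝ) : Coord (d + 2)) 0) * nullPotential a e x' := by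
    intro l
    filter_upwards [e.open_target.mem_nhds hx] with z hz
    rw [trace_of_weyl (hs z hz) ((metricForm_contDiffAt
      fun i j => hsm i j z hz).differentiableAt (by simp))
      (compMatrix_det_ne_zero fun v hv => metricForm_nondegenerate ha hN.mem hz trivial hv)
      (κ := fun u => 2 * m * (nullPotential a e z / (2 * (m - 1))) * linForm b e z u)
      (hw z hz).metric, hN.form z hz, hK]
    ring
  have hpd : ∀ k l, pd k (logDetDeriv (compMatrix a e) l) x =
      pd k (fun x' => ∑ i, Γ e x' i i l) x +
        K * (EuclideanSpace.single l (1 : ℝ) : Coord (d + 2)) 0 * pd k (nullPotential a e) x := by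
    intro k l
    rw [(htr l).pd_eq, pd, fderiv_fun_add (hT l) (hφd.const_mul _), add_apply,
      fderiv_const_mul hφd]
    rfl
  have h1 := logDetDeriv_closed_of_isPseudoRiemannianOn ha hN.mem isOpen_univ hx trivial 0 k
  rw [hpd, hpd, hclosed x hx 0 k] at h1
  have h2 : (EuclideanSpace.single k (1 : ℝ) : Coord (d + 2)) 0 = 0 := by simp [hk.symm]
  rw [h2] at h1
  simpa [hK0] using h1

/-- Adapted coordinates of an `m`-Kropina space of Berwald type with symmetric Ricci tensor. -/
theorem exists_isAdaptedChart [IsManifold (𝓡 (d + 2)) ∞ M] (hdim : 2 < d + 2) {m : ℝ} (hm : m ≠ 0)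
    {A : Set (TangentBundle (𝓡 (d + 2)) M)} {F : TangentBundle (𝓡 (d + 2)) M → ℝ}
    (hF : IsKropinaSpace a b m A F) (hclosed : IsClosedOneForm b) (hnull : IsNull a b)
    {Γ : ConnectionCoeffs (d + 2) M} (hΓ : IsBerwaldWithConnection A F Γ)
    (hRic : HasSymmetricRicci Γ) (p : M) :
    ∃ e : OpenPartialHomeomorph M (Coord (d + 2)), p ∈ e.source ∧
      ∃ H φ W h, IsAdaptedChart a b e H φ W h := by
  obtain ⟨e, hN, hp, r, -, ht⟩ := exists_chart_straightening hF hclosed hnull p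
  have hm1 : m - 1 ≠ 0 := by
    have := one_sub_ne_zero_of_kropina hF hnull hN.mem (e.map_source hp)
    intro h
    exact this (by linarith)
  have hd : ∀ x ∈ e.target, DifferentiableAt ℝ (metricForm a e) x := fun x hx =>
    (metricForm_contDiffAt_of hF hN.mem hx).differentiableAt (by simp)
  -- The Weyl coefficient is known only to exist at each point; this identifies it with a multiple
  -- of the smooth function `∂ᵥa(∂ᵤ,∂ᵤ)`, which can be differentiated.
  have hφc : ∀ x ∈ e.target, ∀ c,
      IsWeylAt (metricForm a e) (linForm b e) (connBilin (Γ e x)) m c x →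
      nullPotential a e x = 2 * (m - 1) * c := by
    intro x hx c hw
    have h1 := hN.fderiv_metricForm_single_one (hd x hx) (metricForm_symm hF x) hx hw
      (EuclideanSpace.single 0 1) (EuclideanSpace.single 0 1)
    rw [fderiv_metricForm_single (hd x hx)] at h1
    change nullPotential a e x = _ at h1
    simpa using h1
  have hw : ∀ x ∈ e.target, IsWeylAt (metricForm a e) (linForm b e) (connBilin (Γ e x)) m
      (nullPotential a e x / (2 * (m - 1))) x := by
    intro x hx
    obtain ⟨c, hc⟩ := exists_isWeylAt hdim hm hF hclosed hΓ hN.mem hx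
    have : nullPotential a e x / (2 * (m - 1)) = c := by
      rw [hφc x hx c hc]
      field_simp
    rwa [this]
  have hΓs : ∀ e ∈ charts (d + 2) M, ∀ x ∈ e.target, ∀ i j k, Γ e x i j k = Γ e x i k j :=
    fun e he x hx => (sqCoord_horizontally_constant hF hΓ he hx).1
  refine ⟨e, hp, hN.isAdaptedChart hF.metric ht (fun x hx p q => ?_) fun x hx k hk => ?_⟩
  · rw [hN.fderiv_metricForm_single_one (hd x hx) (metricForm_symm hF x) hx (hw x hx)]
    field_simp
  · exact pd_nullPotential_eq_zero hN hF.metric hm hm1 (hΓs e hN.mem) (hΓ.smooth e hN.mem)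
      ((hasSymmetricRicci_iff hΓs hΓ.smooth).1 hRic e hN.mem) hw hx hk

end NormalForm

end Kropina

/-! ### The main theorem -/

theorem mainTheorem1 {d : ℕ} (hdim : 2 < d + 2) {M : Type*} [TopologicalSpace M]
    [ChartedSpace (Coord (d + 2)) M] [IsManifold (𝓡 (d + 2)) ∞ M]
    (a : TwoTensor (d + 2) M) (b : OneForm (d + 2) M) (m : ℝ) (hm : m ≠ 0)
    (A : Set (TangentBundle (𝓡 (d + 2)) M)) (F : TangentBundle (𝓡 (d + 2)) M → ℝ)
    (hF : IsKropinaSpace a b m A F) (hclosed : IsClosedOneForm b) (hnull : IsNull a b)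
    (Γ : ConnectionCoeffs (d + 2) M) (hΓ : IsBerwaldWithConnection A F Γ) :
    List.TFAE
      [IsLocallyMetrizable Γ,
        HasSymmetricRicci Γ,
        ∀ p : M, ∃ e : OpenPartialHomeomorph M (Coord (d + 2)), p ∈ e.source ∧
          ∃ H φ W h, IsAdaptedChart a b e H φ W h] ∧
    ∀ e H φ W h, IsAdaptedChart a b e H φ W h →
      (∃ Φ, IsIndefiniteIntegral e φ Φ) ∧
      ∀ Φ, IsIndefiniteIntegral e φ Φ →
        IsPseudoRiemannianOn (conformalMetric a m e Φ) e.source ∧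
        IsMetrizedOn Γ (conformalMetric a m e Φ) e.source := by
  have hΓs : ∀ e ∈ charts (d + 2) M, ∀ x ∈ e.target, ∀ i j k, Γ e x i j k = Γ e x i k j :=
    fun e he x hx => (sqCoord_horizontally_constant hF hΓ he hx).1
  refine ⟨?_, fun e H φ W h hA => ⟨hA.exists_isIndefiniteIntegral, fun Φ hΦ =>
    ⟨hA.isPseudoRiemannianOn_conformalMetric hF.metric hΦ m,
      hA.isMetrizedOn_conformalMetric hdim hm hF hclosed hnull hΓ hΦ⟩⟩⟩
  tfae_have 1 → 2 := hasSymmetricRicci_of_isLocallyMetrizable hΓs hΓ.smooth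
  tfae_have 2 → 3 := exists_isAdaptedChart hdim hm hF hclosed hnull hΓ
  tfae_have 3 → 1 := by
    intro h3 p
    obtain ⟨e, hp, H, φ, W, h, hA⟩ := h3 p
    obtain ⟨Φ, hΦ⟩ := hA.exists_isIndefiniteIntegral
    exact ⟨e.source, e.open_source, hp, conformalMetric a m e Φ,
      hA.isPseudoRiemannianOn_conformalMetric hF.metric hΦ m,
      hA.isMetrizedOn_conformalMetric hdim hm hF hclosed hnull hΓ hΦ⟩
  tfae_finish
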